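/- Let $d\in\mathbb N$ and $\alpha>0$. For $x\in\mathbb R^d$, $\xi\in\mathbb R^d\setminus\{0\}$ and $C>0$ put $$Q_{\alpha}^{C}(x,\xi)=\{(y,\eta)\in\mathbb R^{2d}:\ |y-x|\le C|\xi|^{\alpha-1},\ |\eta-\xi|\le C|\xi|^{1-\alpha}\}.$$ Let $\Omega_\alpha=\{(x_j^k,\xi_k):k\in\mathbb N,\ j\in\mathbb Z^d\}\subset\mathbb R^d\times(\mathbb R^d\setminus\{0\})$ be an admissible lattice, that is: (a) for some $C>0$ and $N_0\in\mathbb N$ the blocks $Q_\alpha^C(x_j^k,\xi_k)$ cover $\{(x,\xi):|\xi|\ge 1\}$, and each point of $\mathbb R^{2d}$ belongs to at most $N_0$ of them; (b) the spatial nets have step $\asymp|\xi_k|^{\alpha-1}$: there are $a,b>0$ such that, for every $k$, $|x_i^k-x_j^k|\ge a|\xi_k|^{\alpha-1}$ for $i\ne j$, and every point of $\mathbb R^d$ is at distance at most $b|\xi_k|^{\alpha-1}$ from some $x_j^k$. Let $\phi\in\mathcal S(\mathbb R^d)$ be a window such that $\widehat\phi$ is supported in an annulus $\{c_1\le|\zeta|\le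 c_2\}$ with $0<c_1<c_2<\infty$ and such that the wave packets $\phi_{x_j^k,\xi_k}$, where $$\phi_{x,\xi}(t)=|\xi|^{\frac d2(1-\alpha)}\,\phi\big((t-x)|\xi|^{1-\alpha}\big)\,e^{i t\cdot\xi},$$ form a frame of $L^2(\mathbb R^d)$. For $1\le p,q<\infty$ and $\beta\in\mathbb R$ let $M^{p,q}_{\alpha,\beta}$ be the space of all $f\in\mathcal S'(\mathbb R^d)$ with $$\|f\|_{M^{p,q}_{\alpha,\beta}}=\Big(\sum_k\Big(\sum_{j\in\mathbb Z^d}|\langle f,\phi_{x_j^k,\xi_k}\rangle|^p\Big)^{q/p}(1+|\xi_k|)^{\beta q}\Big)^{1/q}<\infty,$$ where $\langle\cdot,\cdot\rangle$ is conjugate linear in the second argument. **Proposition (Duality).** Let $1<p,q<\infty$, $\frac1p+\frac1{p'}=\frac1q+\frac1{q'}=1$ and $\beta\in\mathbb R$. Then $(M^{p,q}_{\alpha,\beta})'\simeq M^{p',q'}_{\alpha,-\beta}$ with respect to the $L^2$ pairing. That is: $\mathcal S(\mathbb R^d)$ is contained in both spaces, and there is exactly one conjugate-linear topological isomorphism (a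 bijection with equivalence of norms) $T$ from $M^{p',q'}_{\alpha,-\beta}$ onto the space $(M^{p,q}_{\alpha,\beta})'$ of bounded linear functionals, with its operator norm, such that $$(Tg)(f)=\int_{\mathbb R^d}f(x)\,\overline{g(x)}\,dx\qquad\text{for all } f,g\in\mathcal S(\mathbb R^d).$$ -/

import Mathlib

open MeasureTheory SchwartzMap
open scoped ENNReal FourierTransform

noncomputable section

namespace Subdyadic

/-- The Euclidean space `ℝ^d`. -/
abbrev Rd (d : ℕ) : Type := EuclideanSpace ℝ (Fin d)

/-! ### Blocks and lattices in phase space -/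

/-- The block centred at `(x, ξ)` of radius `R |ξ|^(α-1)` in space and `R |ξ|^(1-α)` in
frequency. -/
def block {d : ℕ} (α R : ℝ) (x ξ : Rd d) : Set (Rd d × Rd d) :=
  {z | ‖z.1 - x‖ ≤ R * ‖ξ‖ ^ (α - 1) ∧ ‖z.2 - ξ‖ ≤ R * ‖ξ‖ ^ (1 - α)}

/-- An admissible subdyadic lattice `{(x_j^k, ξ_k) : k ∈ ℕ, j ∈ ℤ^d}`: nonzero frequency centres
`ξ_k`, and above each of them a spatial net of step comparable to `|ξ_k|^(α-1)`, such that the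
blocks of unit size (up to a fixed constant) cover `{|ξ| ≥ 1}` with finite overlap.
Finitely many of the centres may be low-frequency ones. -/
structure PhaseLattice (d : ℕ) (α : ℝ) where
  /-- the frequency centres `ξ_k` -/
  freq : ℕ → Rd d
  /-- the spatial points `x_j^k`, written `pos k j` -/
  pos : ℕ → (Fin d → ℤ) → Rd d
  freq_ne_zero : ∀ k, freq k ≠ 0
  /-- uniform covering and finite overlap, with the same constant `C` in the size of the blocks -/
  cover_overlap : ∃ C : ℝ, 0 < C ∧
    (∀ x ξ : Rd d, 1 ≤ ‖ξ‖ → ∃ k j, (x, ξ) ∈ block α C (pos k j) (freq k)) ∧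
    ∃ N : ℕ, ∀ z : Rd d × Rd d,
      {w : ℕ × (Fin d → ℤ) | z ∈ block α C (pos w.1 w.2) (freq w.1)}.encard ≤ N
  /-- the points `x_j^k`, `j ∈ ℤ^d`, form a net of step `≍ |ξ_k|^(α-1)`, uniformly in `k` -/
  spatial_step : ∃ a b : ℝ, 0 < a ∧ 0 < b ∧ ∀ k,
    (∀ i j, i ≠ j → a * ‖freq k‖ ^ (α - 1) ≤ ‖pos k i - pos k j‖) ∧
    ∀ x : Rd d, ∃ j, ‖x - pos k j‖ ≤ b * ‖freq k‖ ^ (α - 1)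

/-! ### Dispersive wave packets -/

/-- `φ_{x,ξ}(t) = |ξ|^(d(1-α)/2) φ((t - x) |ξ|^(1-α)) e^{i t·ξ}`. -/
def packetFun {d : ℕ} (α : ℝ) (φ : Rd d → ℂ) (x ξ t : Rd d) : ℂ :=
  ((‖ξ‖ ^ ((d : ℝ) / 2 * (1 - α)) : ℝ) : ℂ) * φ (‖ξ‖ ^ (1 - α) • (t - x)) *
    Complex.exp (Complex.I * (inner ℝ t ξ : ℝ))

theorem iteratedDeriv_exp_I (n : ℕ) :
    iteratedDeriv n (fun θ : ℝ => Complex.exp (Complex.I * θ)) =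
      fun θ : ℝ => Complex.I ^ n * Complex.exp (Complex.I * θ) := by
  induction n with
  | zero => simp
  | succ n ih =>
    rw [iteratedDeriv_succ, ih]
    funext θ
    have h : HasDerivAt (fun θ : ℝ => Complex.exp (Complex.I * θ))
        (Complex.exp (Complex.I * θ) * (Complex.I * 1)) θ :=
      (((Complex.ofRealCLM.hasDerivAt (x := θ)).const_mul Complex.I).cexp)
    rw [(h.const_mul (Complex.I ^ n)).deriv]
    ring

theorem hasTemperateGrowth_exp_inner {d : ℕ} (ξ : Rd d) :
    (fun t : Rd d => Complex.exp (Complex.I * (inner ℝ t ξ : ℝ))).HasTemperateGrowth := by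
  have h1 : (fun θ : ℝ => Complex.exp (Complex.I * θ)).HasTemperateGrowth := by
    refine ⟨(contDiff_const.mul Complex.ofRealCLM.contDiff).cexp, fun n => ⟨0, 1, fun θ => ?_⟩⟩
    rw [norm_iteratedFDeriv_eq_norm_iteratedDeriv, iteratedDeriv_exp_I, norm_mul, norm_pow,
      Complex.norm_I, mul_comm Complex.I, Complex.norm_exp_ofReal_mul_I]
    simp
  have h2 : (fun t : Rd d => (inner ℝ t ξ : ℝ)).HasTemperateGrowth := by fun_prop
  exact h1.comp h2

/-- The dilation `t ↦ |ξ|^(1-α) t` of `ℝ^d`, for `ξ ≠ 0`. -/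
def dilation {d : ℕ} (α : ℝ) (ξ : Rd d) (hξ : ξ ≠ 0) : Rd d ≃L[ℝ] Rd d :=
  ContinuousLinearEquiv.smulLeft
    (Units.mk0 (‖ξ‖ ^ (1 - α)) (Real.rpow_pos_of_pos (norm_pos_iff.mpr hξ) _).ne')

/-- The wave packet `φ_{x,ξ}` of a Schwartz window, as a Schwartz function. -/
def packet {d : ℕ} (α : ℝ) (φ : 𝓢(Rd d, ℂ)) (x ξ : Rd d) (hξ : ξ ≠ 0) : 𝓢(Rd d, ℂ) :=
  ((‖ξ‖ ^ ((d : ℝ) / 2 * (1 - α)) : ℝ) : ℂ) •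
    smulLeftCLM ℂ (fun t : Rd d => Complex.exp (Complex.I * (inner ℝ t ξ : ℝ)))
      (compSubConstCLM ℂ x (compCLMOfContinuousLinearEquiv ℂ (dilation α ξ hξ) φ))

theorem packet_apply {d : ℕ} (α : ℝ) (φ : 𝓢(Rd d, ℂ)) (x ξ : Rd d) (hξ : ξ ≠ 0) (t : Rd d) :
    packet α φ x ξ hξ t = packetFun α φ x ξ t := by
  simp only [packet, packetFun, smul_apply, smul_eq_mul,
    smulLeftCLM_apply_apply (hasTemperateGrowth_exp_inner ξ), compSubConstCLM_apply,
    compCLMOfContinuousLinearEquiv_apply, Function.comp_apply]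
  have : dilation α ξ hξ (t - x) = ‖ξ‖ ^ (1 - α) • (t - x) := rfl
  rw [this]
  ring

/-- Complex conjugation of Schwartz functions. -/
def conjSchwartz {d : ℕ} (u : 𝓢(Rd d, ℂ)) : 𝓢(Rd d, ℂ) :=
  postcompCLM (𝕜 := ℝ) (Complex.conjCLE : ℂ →L[ℝ] ℂ) u

theorem conjSchwartz_apply {d : ℕ} (u : 𝓢(Rd d, ℂ)) (t : Rd d) :
    conjSchwartz u t = starRingEnd ℂ (u t) := rfl

/-- The dispersive Gabor transform `V_φ f(x, ξ) = ∫ f(t) conj(φ_{x,ξ}(t)) dt`. -/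
def gaborTransform {d : ℕ} (α : ℝ) (φ f : Rd d → ℂ) (x ξ : Rd d) : ℂ :=
  ∫ t, f t * starRingEnd ℂ (packetFun α φ x ξ t)

/-- The packets of `φ` over the lattice form a frame of `L²(ℝ^d)`. -/
def IsGaborFrame {d : ℕ} {α : ℝ} (Ω : PhaseLattice d α) (φ : 𝓢(Rd d, ℂ)) : Prop :=
  ∃ A B : ℝ, 0 < A ∧ 0 < B ∧ ∀ f : Lp ℂ 2 (volume : Measure (Rd d)),
    ENNReal.ofReal A * ‖f‖ₑ ^ 2 ≤
        ∑' (k : ℕ) (j : Fin d → ℤ), ‖gaborTransform α φ f (Ω.pos k j) (Ω.freq k)‖ₑ ^ 2 ∧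
      ∑' (k : ℕ) (j : Fin d → ℤ), ‖gaborTransform α φ f (Ω.pos k j) (Ω.freq k)‖ₑ ^ 2 ≤
        ENNReal.ofReal B * ‖f‖ₑ ^ 2

/-- The window `φ` is admissible over the lattice: its Fourier transform is supported in an
annulus away from the origin, and its packets form a frame of `L²(ℝ^d)`. -/
def IsAdmissibleWindow {d : ℕ} {α : ℝ} (Ω : PhaseLattice d α) (φ : 𝓢(Rd d, ℂ)) : Prop :=
  (∃ c₁ c₂ : ℝ, 0 < c₁ ∧ c₁ < c₂ ∧
    Function.support (𝓕 φ : 𝓢(Rd d, ℂ)) ⊆ {ζ | c₁ ≤ ‖ζ‖ ∧ ‖ζ‖ ≤ c₂}) ∧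
  IsGaborFrame Ω φ

/-! ### Dispersive modulation spaces -/

/-- The radial weight `w_β(ξ) = (1 + |ξ|)^β`. -/
def weight {d : ℕ} (β : ℝ) (ξ : Rd d) : ℝ := (1 + ‖ξ‖) ^ β

/-- The Gabor coefficient `c_{j,k}(f) = ⟨f, φ_{x_j^k, ξ_k}⟩` of a tempered distribution, the
bracket being conjugate linear in the second argument. -/
def coeff {d : ℕ} {α : ℝ} (Ω : PhaseLattice d α) (φ : 𝓢(Rd d, ℂ)) (f : 𝓢'(Rd d, ℂ))
    (k : ℕ) (j : Fin d → ℤ) : ℂ :=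
  f (conjSchwartz (packet α φ (Ω.pos k j) (Ω.freq k) (Ω.freq_ne_zero k)))

/-- The (extended) norm of `M^{p,q}_{α,β}` for finite exponents,
`(∑_k (∑_j |c_{j,k}(f)|^p)^(q/p) w_β(ξ_k)^q)^(1/q)`. -/
def modENorm {d : ℕ} {α : ℝ} (Ω : PhaseLattice d α) (φ : 𝓢(Rd d, ℂ)) (p q β : ℝ)
    (f : 𝓢'(Rd d, ℂ)) : ℝ≥0∞ :=
  (∑' k : ℕ, (∑' j : Fin d → ℤ, ‖coeff Ω φ f k j‖ₑ ^ p) ^ (q / p) *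
    ENNReal.ofReal (weight β (Ω.freq k)) ^ q) ^ (1 / q)

theorem Lp_add_le_tsum' {ι : Type} [Countable ι] (p : ℝ) (hp : 1 ≤ p) (f g : ι → ℝ≥0∞) :
    (∑' i, (f i + g i) ^ p) ^ (1 / p) ≤ (∑' i, f i ^ p) ^ (1 / p) + (∑' i, g i ^ p) ^ (1 / p) := by
  let _ : MeasurableSpace ι := ⊤
  have := ENNReal.lintegral_Lp_add_le (μ := (Measure.count : Measure ι)) (f := f) (g := g)
    (measurable_from_top.aemeasurable) (measurable_from_top.aemeasurable) hp
  simpa [lintegral_count] using this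

section seminorm

variable {d : ℕ} {α : ℝ} (Ω : PhaseLattice d α) (φ : 𝓢(Rd d, ℂ)) (p q β : ℝ)

theorem modENorm_eq (hq : 0 < q) (f : 𝓢'(Rd d, ℂ)) :
    modENorm Ω φ p q β f = (∑' k : ℕ, ((∑' j : Fin d → ℤ, ‖coeff Ω φ f k j‖ₑ ^ p) ^ (1 / p) *
      ENNReal.ofReal (weight β (Ω.freq k))) ^ q) ^ (1 / q) := by
  unfold modENorm
  congr 2
  funext k
  rw [ENNReal.mul_rpow_of_nonneg _ _ hq.le, ← ENNReal.rpow_mul]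
  congr 2
  ring

theorem modENorm_add_le (hp : 1 ≤ p) (hq : 1 ≤ q) (f g : 𝓢'(Rd d, ℂ)) :
    modENorm Ω φ p q β (f + g) ≤ modENorm Ω φ p q β f + modENorm Ω φ p q β g := by
  have hq0 : 0 < q := by linarith
  have hp0 : 0 < p := by linarith
  rw [modENorm_eq Ω φ p q β hq0, modENorm_eq Ω φ p q β hq0, modENorm_eq Ω φ p q β hq0]
  refine le_trans ?_ (Lp_add_le_tsum' q hq _ _)
  gcongr with k
  rw [← add_mul]
  gcongr
  refine le_trans ?_ (Lp_add_le_tsum' p hp _ _)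
  gcongr with j
  exact enorm_add_le _ _

theorem modENorm_smul (hp : 1 ≤ p) (hq : 1 ≤ q) (c : ℂ) (f : 𝓢'(Rd d, ℂ)) :
    modENorm Ω φ p q β (c • f) = ‖c‖ₑ * modENorm Ω φ p q β f := by
  have hq0 : 0 < q := by linarith
  have hp0 : 0 < p := by linarith
  rw [modENorm_eq Ω φ p q β hq0, modENorm_eq Ω φ p q β hq0]
  have h : ∀ k j, coeff Ω φ (c • f) k j = c * coeff Ω φ f k j := fun _ _ => rfl
  simp only [h, enorm_mul, ENNReal.mul_rpow_of_nonneg _ _ hp0.le, ENNReal.tsum_mul_left,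
    ENNReal.mul_rpow_of_nonneg _ _ (by positivity : (0 : ℝ) ≤ 1 / p), mul_assoc,
    ENNReal.mul_rpow_of_nonneg _ _ hq0.le,
    ENNReal.mul_rpow_of_nonneg _ _ (by positivity : (0 : ℝ) ≤ 1 / q)]
  rw [← ENNReal.rpow_mul, ← ENNReal.rpow_mul, ← ENNReal.rpow_mul]
  simp [hp0.ne', hq0.ne']

theorem modENorm_zero (hp : 1 ≤ p) (hq : 1 ≤ q) : modENorm Ω φ p q β 0 = 0 := by
  have hq0 : 0 < q := by linarith
  have hp0 : 0 < p := by linarith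
  have h : ∀ k j, coeff Ω φ 0 k j = 0 := fun _ _ => rfl
  simp [modENorm, h, hp0, hq0]

/-- The tempered distributions with finite `M^{p,q}_{α,β}` norm, as a linear subspace. -/
def modSubmodule [hp : Fact (1 ≤ p)] [hq : Fact (1 ≤ q)] : Submodule ℂ 𝓢'(Rd d, ℂ) where
  carrier := {f | modENorm Ω φ p q β f < ∞}
  add_mem' {f g} hf hg := (modENorm_add_le Ω φ p q β hp.out hq.out f g).trans_lt
    (ENNReal.add_lt_top.mpr ⟨hf, hg⟩)
  zero_mem' := by simp [modENorm_zero Ω φ p q β hp.out hq.out]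
  smul_mem' c f hf := by
    simp only [Set.mem_ofPred_eq, modENorm_smul Ω φ p q β hp.out hq.out] at hf ⊢
    exact ENNReal.mul_lt_top enorm_lt_top hf

/-- The dispersive modulation space `M^{p,q}_{α,β}`. It carries the topology of its norm, not the
one inherited from the tempered distributions. -/
def ModSpace [Fact (1 ≤ p)] [Fact (1 ≤ q)] : Type := ↥(modSubmodule Ω φ p q β)

variable [hp : Fact (1 ≤ p)] [hq : Fact (1 ≤ q)]

instance : AddCommGroup (ModSpace Ω φ p q β) :=
  inferInstanceAs (AddCommGroup ↥(modSubmodule Ω φ p q β))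

instance : Module ℂ (ModSpace Ω φ p q β) :=
  inferInstanceAs (Module ℂ ↥(modSubmodule Ω φ p q β))

/-- The inclusion of `M^{p,q}_{α,β}` in the tempered distributions. -/
def ModSpace.toDistribution : ModSpace Ω φ p q β →ₗ[ℂ] 𝓢'(Rd d, ℂ) :=
  (modSubmodule Ω φ p q β).subtype

instance : Norm (ModSpace Ω φ p q β) :=
  ⟨fun f => (modENorm Ω φ p q β (ModSpace.toDistribution Ω φ p q β f)).toReal⟩

theorem ModSpace.norm_def (f : ModSpace Ω φ p q β) :
    ‖f‖ = (modENorm Ω φ p q β (ModSpace.toDistribution Ω φ p q β f)).toReal := rfl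

theorem ModSpace.enorm_lt_top (f : ModSpace Ω φ p q β) :
    modENorm Ω φ p q β (ModSpace.toDistribution Ω φ p q β f) < ∞ := f.2

theorem ModSpace.seminormedCore : SeminormedSpace.Core ℂ (ModSpace Ω φ p q β) where
  norm_nonneg _ := ENNReal.toReal_nonneg
  norm_smul c f := by
    rw [ModSpace.norm_def, ModSpace.norm_def, map_smul,
      modENorm_smul Ω φ p q β hp.out hq.out, ENNReal.toReal_mul]
    simp
  norm_triangle f g := by
    rw [ModSpace.norm_def, ModSpace.norm_def, ModSpace.norm_def, map_add,
      ← ENNReal.toReal_add (ModSpace.enorm_lt_top Ω φ p q β f).ne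
        (ModSpace.enorm_lt_top Ω φ p q β g).ne]
    exact ENNReal.toReal_mono (ENNReal.add_lt_top.mpr ⟨ModSpace.enorm_lt_top Ω φ p q β f,
      ModSpace.enorm_lt_top Ω φ p q β g⟩).ne (modENorm_add_le Ω φ p q β hp.out hq.out _ _)

instance : SeminormedAddCommGroup (ModSpace Ω φ p q β) :=
  SeminormedAddCommGroup.ofCore (ModSpace.seminormedCore Ω φ p q β)

instance : NormedSpace ℂ (ModSpace Ω φ p q β) :=
  ⟨fun c f => ((ModSpace.seminormedCore Ω φ p q β).norm_smul c f).le⟩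

end seminorm

end Subdyadic

end

open Subdyadic

open scoped NNReal

namespace Subdyadic

/-! ### Mixed sequence norms -/

section sequences

variable {ι κ : Type*}

/-! The weighted spaces `ℓ^q(ℓ^p)` and `ℓ^{q'}(ℓ^{p'})` with inverse weights are dual to each other.
The theorem carries this duality over through the coefficient map, and the transport works because
the packets and their canonical dual frame are both localized in phase space.

Localization is measured by the quasi-distance `tau`. The radial map `x ↦ |x|^(α-1) x` turns the
frequency blocks into sets of size about one, so finite overlap (`exists_freq_overlap`) bounds the
sums of high negative powers of `tau`. By Schur's test, matrices with rapid off-diagonal decay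
(`Rapid`) then act on every weighted mixed space. The Gram matrix is of this kind (`rapid_gram`):
packets with distant frequencies have disjoint Fourier supports, and those with close frequencies
decay in space.

The main analytic point is a Wiener-type lemma, `rapid_pseudoinverse`: the generalized inverse `H`
of the Gram matrix and the projection `P` onto its range are again `Rapid`. Rapid decay is
equivalent to uniform bounds on the iterated commutators with truncated distance functions, and such
bounds pass to the generalized inverse by algebra (`bddOrder_pseudoinverse`). Hence, by
`exists_schwartz_dual`, the frame expansion of a Schwartz function converges in the Schwartz space
and can be tested against any tempered distribution.

For the duality, `(T g)(f) = ∑_z ⟨f, φ_z⟩ conj (∑_w H(z, w) ⟨g, φ_w⟩)` is bounded by Hölder's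
inequality. For a Schwartz function `u` it equals the conjugate of `g` applied to the conjugate of
`u` (`pairing_ofSchwartz`), so `T g` determines `g`. Conversely, the values of a bounded functional
at the packets lie in the dual sequence space (`exists_seqNorm_functional_le`): a finite combination
of packets with coefficients `e` has the Gram matrix applied to `e` as its coefficient family, so
its norm is controlled by that of `e`. This gives the lower bound for `T` and, with
`exists_representing_distribution`, surjectivity. Density of the Schwartz functions in both spaces
(`denseRange_ofSchwartz`, by means of `P`) gives uniqueness. -/

/-- The extended `ℓ^p` norm of a nonnegative sequence. -/
noncomputable def lpSum (p : ℝ) (a : ι → ℝ≥0∞) : ℝ≥0∞ := (∑' i, a i ^ p) ^ (1 / p)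

/-- The extended weighted `ℓ^q(ℓ^p)` norm of a nonnegative double sequence. -/
noncomputable def mixNorm (p q : ℝ) (w : κ → ℝ≥0∞) (a : κ → ι → ℝ≥0∞) : ℝ≥0∞ :=
  lpSum q fun k => lpSum p (a k) * w k

theorem lpSum_mono {p : ℝ} (hp : 0 ≤ p) {a b : ι → ℝ≥0∞} (h : ∀ i, a i ≤ b i) :
    lpSum p a ≤ lpSum p b := by
  unfold lpSum
  gcongr with i
  exact h i

theorem mixNorm_mono {p q : ℝ} (hp : 0 ≤ p) (hq : 0 ≤ q) (w : κ → ℝ≥0∞) {a b : κ → ι → ℝ≥0∞}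
    (h : ∀ k i, a k i ≤ b k i) : mixNorm p q w a ≤ mixNorm p q w b :=
  lpSum_mono hq fun k => mul_le_mul_left (lpSum_mono hp (h k)) _

theorem lpSum_const_mul {p : ℝ} (hp : 0 < p) (c : ℝ≥0∞) (a : ι → ℝ≥0∞) :
    lpSum p (fun i => c * a i) = c * lpSum p a := by
  unfold lpSum
  simp only [ENNReal.mul_rpow_of_nonneg _ _ hp.le, ENNReal.tsum_mul_left,
    ENNReal.mul_rpow_of_nonneg _ _ (by positivity : (0 : ℝ) ≤ 1 / p)]
  rw [← ENNReal.rpow_mul, mul_one_div_cancel hp.ne', ENNReal.rpow_one]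

theorem mixNorm_const_mul {p q : ℝ} (hp : 0 < p) (hq : 0 < q) (w : κ → ℝ≥0∞) (c : ℝ≥0∞)
    (a : κ → ι → ℝ≥0∞) : mixNorm p q w (fun k i => c * a k i) = c * mixNorm p q w a := by
  unfold mixNorm
  simp only [lpSum_const_mul hp, mul_assoc, lpSum_const_mul hq]

theorem le_lpSum {p : ℝ} (hp : 0 < p) (a : ι → ℝ≥0∞) (i : ι) : a i ≤ lpSum p a := by
  unfold lpSum
  calc a i = (a i ^ p) ^ (1 / p) := by
        rw [← ENNReal.rpow_mul, mul_one_div_cancel hp.ne', ENNReal.rpow_one]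
    _ ≤ _ := by
        gcongr
        exact ENNReal.le_tsum i

theorem le_mixNorm {p q : ℝ} (hp : 0 < p) (hq : 0 < q) (w : κ → ℝ≥0∞) (a : κ → ι → ℝ≥0∞)
    (k : κ) (i : ι) : a k i * w k ≤ mixNorm p q w a :=
  (mul_le_mul_left (le_lpSum hp (a k) i) _).trans
    (le_lpSum hq (fun k => lpSum p (a k) * w k) k)

theorem lpSum_single [DecidableEq ι] {p : ℝ} (hp : 0 < p) (i : ι) (c : ℝ≥0∞) :
    lpSum p (Pi.single i c) = c := by
  unfold lpSum
  rw [tsum_eq_single i]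
  · rw [Pi.single_eq_same, ← ENNReal.rpow_mul, mul_one_div_cancel hp.ne', ENNReal.rpow_one]
  · intro j hj
    rw [Pi.single_eq_of_ne hj, ENNReal.zero_rpow_of_pos hp]

theorem lpSum_zero {p : ℝ} (hp : 0 < p) : lpSum p (0 : ι → ℝ≥0∞) = 0 := by
  simp [lpSum, hp]

theorem mixNorm_single [DecidableEq ι] [DecidableEq κ] {p q : ℝ} (hp : 0 < p) (hq : 0 < q)
    (w : κ → ℝ≥0∞) (k : κ) (i : ι) (c : ℝ≥0∞) :
    mixNorm p q w (Pi.single k (Pi.single i c)) = c * w k := by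
  unfold mixNorm
  rw [← lpSum_single hq k (c * w k)]
  congr 1
  funext l
  by_cases h : l = k
  · subst h
    simp [lpSum_single hp]
  · simp [Pi.single_eq_of_ne h, lpSum_zero hp]

theorem tsum_mul_le_lpSum {p q : ℝ} (hpq : p.HolderConjugate q) (a b : ι → ℝ≥0∞) :
    ∑' i, a i * b i ≤ lpSum p a * lpSum q b := by
  let _ : MeasurableSpace ι := ⊤
  have := ENNReal.lintegral_mul_le_Lp_mul_Lq (Measure.count : Measure ι) hpq (f := a) (g := b)
    measurable_from_top.aemeasurable measurable_from_top.aemeasurable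
  simpa [lintegral_count, lpSum] using this

theorem tsum_mul_le_mixNorm {p p' q q' : ℝ} (hp : p.HolderConjugate p') (hq : q.HolderConjugate q')
    {w : κ → ℝ≥0∞} (hw : ∀ k, w k ≠ 0) (hw' : ∀ k, w k ≠ ∞) (a b : κ → ι → ℝ≥0∞) :
    ∑' k, ∑' i, a k i * b k i ≤ mixNorm p q w a * mixNorm p' q' (fun k => (w k)⁻¹) b := by
  refine le_trans ?_ (tsum_mul_le_lpSum hq _ _)
  gcongr with k
  refine (tsum_mul_le_lpSum hp _ _).trans_eq ?_
  rw [mul_mul_mul_comm, ENNReal.mul_inv_cancel (hw k) (hw' k), mul_one]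

/-- Schur's test as an estimate of bilinear forms. -/
theorem tsum_kernel_le {p q : ℝ} (hpq : p.HolderConjugate q) (K : ι → κ → ℝ≥0∞) {C : ℝ≥0∞}
    (h1 : ∀ i, ∑' j, K i j ≤ C) (h2 : ∀ j, ∑' i, K i j ≤ C) (a : ι → ℝ≥0∞) (b : κ → ℝ≥0∞) :
    ∑' i, ∑' j, K i j * (a i * b j) ≤ C * (lpSum p a * lpSum q b) := by
  have hp0 := hpq.pos
  have hq0 := hpq.symm.pos
  -- The kernel is split as `K^(1/p) K^(1/q)`, and Hölder's inequality is applied on the product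
  -- index set; the first factor sees the row sums, the second the column sums.
  have key := tsum_mul_le_lpSum hpq (fun z : ι × κ => K z.1 z.2 ^ (1 / p) * a z.1)
    (fun z : ι × κ => K z.1 z.2 ^ (1 / q) * b z.2)
  have e : ∀ z : ι × κ, (K z.1 z.2 ^ (1 / p) * a z.1) * (K z.1 z.2 ^ (1 / q) * b z.2) =
      K z.1 z.2 * (a z.1 * b z.2) := by
    intro z
    rw [mul_mul_mul_comm, ← ENNReal.rpow_add_of_nonneg _ _ (by positivity) (by positivity),
      one_div, one_div, hpq.inv_add_inv_eq_one, ENNReal.rpow_one]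
  simp only [e] at key
  rw [ENNReal.tsum_prod' (f := fun z : ι × κ => K z.1 z.2 * (a z.1 * b z.2))] at key
  refine key.trans ?_
  have ha : lpSum p (fun z : ι × κ => K z.1 z.2 ^ (1 / p) * a z.1) ≤ C ^ (1 / p) * lpSum p a := by
    unfold lpSum
    rw [← ENNReal.mul_rpow_of_nonneg _ _ (by positivity)]
    gcongr
    rw [ENNReal.tsum_prod', ← ENNReal.tsum_mul_left]
    gcongr with i
    simp only [ENNReal.mul_rpow_of_nonneg _ _ hp0.le, ← ENNReal.rpow_mul,
      one_div_mul_cancel hp0.ne', ENNReal.rpow_one, ENNReal.tsum_mul_right]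
    gcongr
    exact h1 i
  have hb : lpSum q (fun z : ι × κ => K z.1 z.2 ^ (1 / q) * b z.2) ≤ C ^ (1 / q) * lpSum q b := by
    unfold lpSum
    rw [← ENNReal.mul_rpow_of_nonneg _ _ (by positivity)]
    gcongr
    rw [ENNReal.tsum_prod', ENNReal.tsum_comm, ← ENNReal.tsum_mul_left]
    gcongr with i
    simp only [ENNReal.mul_rpow_of_nonneg _ _ hq0.le, ← ENNReal.rpow_mul,
      one_div_mul_cancel hq0.ne', ENNReal.rpow_one, ENNReal.tsum_mul_right]
    gcongr
    exact h2 i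
  calc _ ≤ (C ^ (1 / p) * lpSum p a) * (C ^ (1 / q) * lpSum q b) := by gcongr
    _ = C * (lpSum p a * lpSum q b) := by
      rw [mul_mul_mul_comm, ← ENNReal.rpow_add_of_nonneg _ _ (by positivity) (by positivity),
        one_div, one_div, hpq.inv_add_inv_eq_one, ENNReal.rpow_one]

/-- Schur's test for the bilinear form of a kernel on a mixed sequence space. -/
theorem tsum_kernel_le_mixNorm {p p' q q' : ℝ} (hp : p.HolderConjugate p')
    (hq : q.HolderConjugate q') {w : κ → ℝ≥0∞} (hw : ∀ k, w k ≠ 0) (hw' : ∀ k, w k ≠ ∞)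
    (K : κ → ι → κ → ι → ℝ≥0∞) (n : κ → κ → ℝ≥0∞) {C : ℝ≥0∞}
    (h1 : ∀ k l i, ∑' j, K k i l j ≤ n k l) (h2 : ∀ k l j, ∑' i, K k i l j ≤ n k l)
    (h3 : ∀ k, ∑' l, n k l * (w k * (w l)⁻¹) ≤ C) (h4 : ∀ l, ∑' k, n k l * (w k * (w l)⁻¹) ≤ C)
    (a b : κ → ι → ℝ≥0∞) :
    ∑' k, ∑' i, ∑' l, ∑' j, K k i l j * (b k i * a l j) ≤
      C * (mixNorm p q w a * mixNorm p' q' (fun k => (w k)⁻¹) b) := by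
  -- Schur's test is used twice: across blocks with the kernel `n k l * w k / w l`, and then inside
  -- each pair of blocks with bound `n k l`.
  have h := tsum_kernel_le hq.symm (fun k l => n k l * (w k * (w l)⁻¹)) h3 h4
    (fun k => lpSum p' (b k) * (w k)⁻¹) (fun l => lpSum p (a l) * w l)
  rw [mul_comm (mixNorm p q w a)]
  refine le_trans ?_ h
  gcongr with k
  rw [ENNReal.tsum_comm]
  gcongr with l
  refine (tsum_kernel_le hp.symm (fun i j => K k i l j) (h1 k l) (h2 k l) (b k) (a l)).trans_eq ?_
  calc n k l * (lpSum p' (b k) * lpSum p (a l))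
      = n k l * ((w k * (w k)⁻¹) * ((w l)⁻¹ * w l)) * (lpSum p' (b k) * lpSum p (a l)) := by
        rw [ENNReal.mul_inv_cancel (hw k) (hw' k), ENNReal.inv_mul_cancel (hw l) (hw' l)]
        simp
    _ = _ := by ring

/-- The extremal sequence of Hölder's inequality on a finite set, extended by zero so that it can
serve as a finitely supported test sequence. -/
theorem exists_dual_finset [DecidableEq ι] {p q : ℝ} (hpq : p.HolderConjugate q) (s : Finset ι)
    (a : ι → ℝ≥0) :
    ∃ b : ι → ℝ≥0, (∀ i ∉ s, b i = 0) ∧ ∑ i ∈ s, b i ^ q ≤ 1 ∧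
      ∑ i ∈ s, a i * b i = (∑ i ∈ s, a i ^ p) ^ (1 / p) := by
  obtain ⟨g, hg, h⟩ := (NNReal.isGreatest_Lp s a hpq).1
  refine ⟨fun i => if i ∈ s then g i else 0, fun i hi => if_neg hi, ?_, ?_⟩
  · refine le_trans (le_of_eq (Finset.sum_congr rfl fun i hi => ?_)) hg
    simp only [if_pos hi]
  · rw [← h]
    exact Finset.sum_congr rfl fun i hi => by simp only [if_pos hi]

theorem lpSum_eq_sum {p : ℝ} (hp : 0 < p) (s : Finset ι) (a : ι → ℝ≥0∞)
    (h : ∀ i ∉ s, a i = 0) : lpSum p a = (∑ i ∈ s, a i ^ p) ^ (1 / p) := by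
  unfold lpSum
  rw [tsum_eq_sum]
  intro i hi
  rw [h i hi, ENNReal.zero_rpow_of_pos hp]

theorem lpSum_le_iff {p : ℝ} (hp : 0 < p) (a : ι → ℝ≥0∞) (C : ℝ≥0∞) :
    lpSum p a ≤ C ↔ ∀ s : Finset ι, (∑ i ∈ s, a i ^ p) ^ (1 / p) ≤ C := by
  unfold lpSum
  rw [one_div, ENNReal.rpow_inv_le_iff hp, ENNReal.tsum_eq_iSup_sum, iSup_le_iff]
  exact forall_congr' fun s => (ENNReal.rpow_inv_le_iff hp).symm

/-- The converse of Hölder's inequality in a mixed sequence space: finitely supported sequences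
determine the norm by duality. -/
theorem mixNorm_le_of_forall_dual [DecidableEq ι] [DecidableEq κ] {p p' q q' : ℝ}
    (hp : p.HolderConjugate p') (hq : q.HolderConjugate q') {w : κ → ℝ≥0∞} (hw : ∀ k, w k ≠ 0)
    (hw' : ∀ k, w k ≠ ∞) (a : κ → ι → ℝ≥0∞) (C : ℝ≥0∞)
    (h : ∀ (s : Finset κ) (t : Finset ι) (b : κ → ι → ℝ≥0), (∀ k i, k ∉ s ∨ i ∉ t → b k i = 0) →
      mixNorm p' q' (fun k => (w k)⁻¹) (fun k i => (b k i : ℝ≥0∞)) ≤ 1 →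
      ∑' k, ∑' i, a k i * b k i ≤ C) :
    mixNorm p q w a ≤ C := by
  rcases eq_or_ne C ∞ with rfl | hC
  · exact le_top
  -- An infinite entry would be detected by the test sequence with the single entry `w k`, which has
  -- norm one.
  have hfin : ∀ k i, a k i ≠ ∞ := by
    intro k i hki
    have h1 := h {k} {i} (Pi.single k (Pi.single i (w k).toNNReal)) (by
      rintro l j (hl | hj)
      · rw [Pi.single_eq_of_ne (by simpa using hl)]
        rfl
      · by_cases hl : l = k
        · subst hl
          rw [Pi.single_eq_same, Pi.single_eq_of_ne (by simpa using hj)]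
        · rw [Pi.single_eq_of_ne hl]
          rfl) (by
      have : (fun l j => ((Pi.single k (Pi.single i (w k).toNNReal) : κ → ι → ℝ≥0) l j : ℝ≥0∞)) =
          Pi.single k (Pi.single i (w k)) := by
        funext l j
        by_cases hl : l = k
        · subst hl
          by_cases hj : j = i
          · subst hj
            simp [hw']
          · simp [Pi.single_eq_of_ne hj]
        · simp [Pi.single_eq_of_ne hl]
      rw [this, mixNorm_single hp.symm.pos hq.symm.pos, ENNReal.mul_inv_cancel (hw k) (hw' k)])
    refine hC (top_le_iff.mp (le_trans ?_ h1))
    refine le_trans ?_ (ENNReal.le_tsum k)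
    refine le_trans ?_ (ENNReal.le_tsum i)
    simp [hki, hw, hw', ENNReal.top_mul]
  lift a to κ → ι → ℝ≥0 using hfin
  lift w to κ → ℝ≥0 using hw'
  have hw0 : ∀ k, w k ≠ 0 := fun k => by simpa using hw k
  have fin : ∀ (s : Finset κ) (t : Finset ι),
      (∑ k ∈ s, ((∑ i ∈ t, (a k i : ℝ≥0∞) ^ p) ^ (1 / p) * w k) ^ q) ^ (1 / q) ≤ C := by
    intro s t
    -- Nested extremizers: `b k` norms the `k`-th row, `c` norms the sequence of weighted row norms,
    -- and `c k * w k * b k i` is the test sequence.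
    choose b hb0 hb1 hb2 using fun k => exists_dual_finset hp t (a k)
    obtain ⟨c, hc0, hc1, hc2⟩ := exists_dual_finset hq s
      (fun k => (∑ i ∈ t, a k i ^ p) ^ (1 / p) * w k)
    have h1 := h s t (fun k i => c k * w k * b k i) (by
      rintro k i (hk | hi)
      · simp [hc0 k hk]
      · simp [hb0 k i hi]) (by
      unfold mixNorm
      rw [lpSum_eq_sum hq.symm.pos s]
      · have h1 : ∀ k ∈ s, (lpSum p' (fun i => ((c k * w k * b k i : ℝ≥0) : ℝ≥0∞)) *
            ((w k : ℝ≥0∞))⁻¹) ^ q' ≤ (c k : ℝ≥0∞) ^ q' := by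
          intro k _
          apply ENNReal.rpow_le_rpow _ hq.symm.nonneg
          simp only [ENNReal.coe_mul]
          rw [lpSum_const_mul hp.symm.pos, lpSum_eq_sum hp.symm.pos t]
          · have : (∑ i ∈ t, (b k i : ℝ≥0∞) ^ p') ^ (1 / p') ≤ 1 := by
              apply ENNReal.rpow_le_one _ (by have := hp.symm.pos; positivity)
              simp only [← ENNReal.coe_rpow_of_nonneg _ hp.symm.nonneg]
              exact_mod_cast hb1 k
            calc _ ≤ (c k : ℝ≥0∞) * w k * 1 * (w k : ℝ≥0∞)⁻¹ := by gcongr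
              _ = c k := by
                rw [mul_one, mul_assoc, ENNReal.mul_inv_cancel (by simpa using hw0 k) (by simp),
                  mul_one]
          · intro i hi
            simp [hb0 k i hi]
        refine ENNReal.rpow_le_one (le_trans (Finset.sum_le_sum h1) ?_)
          (by have := hq.symm.pos; positivity)
        simp only [← ENNReal.coe_rpow_of_nonneg _ hq.symm.nonneg]
        exact_mod_cast hc1
      · intro k hk
        simp [hc0 k hk, lpSum, hp.symm.pos])
    refine le_trans (le_of_eq ?_) h1
    rw [tsum_eq_sum (s := s) (fun k hk => by simp [hc0 k hk])]
    have e : ∀ k ∈ s, ∑' i, (a k i : ℝ≥0∞) * ((c k * w k * b k i : ℝ≥0) : ℝ≥0∞) =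
        (((∑ i ∈ t, a k i ^ p) ^ (1 / p) * w k * c k : ℝ≥0) : ℝ≥0∞) := by
      intro k _
      rw [tsum_eq_sum (s := t) (fun i hi => by simp [hb0 k i hi])]
      rw [← hb2 k]
      push_cast
      rw [Finset.sum_mul, Finset.sum_mul]
      exact Finset.sum_congr rfl fun i _ => by ring
    have hq1 : 0 ≤ 1 / q := by have := hq.pos; positivity
    have hp1 : 0 ≤ 1 / p := by have := hp.pos; positivity
    rw [Finset.sum_congr rfl e, ← ENNReal.ofNNReal_finsetSum, hc2]
    simp only [ENNReal.coe_rpow_of_nonneg _ hq1, ENNReal.coe_rpow_of_nonneg _ hp1,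
      ENNReal.coe_rpow_of_nonneg _ hq.nonneg, ENNReal.coe_rpow_of_nonneg _ hp.nonneg,
      ENNReal.ofNNReal_finsetSum, ENNReal.coe_mul]
  unfold mixNorm
  rw [lpSum_le_iff hq.pos]
  intro s
  have ht : Filter.Tendsto (fun t : Finset ι =>
      (∑ k ∈ s, ((∑ i ∈ t, (a k i : ℝ≥0∞) ^ p) ^ (1 / p) * w k) ^ q) ^ (1 / q)) Filter.atTop
      (nhds ((∑ k ∈ s, (lpSum p (fun i => (a k i : ℝ≥0∞)) * w k) ^ q) ^ (1 / q))) := by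
    refine (ENNReal.continuous_rpow_const.tendsto _).comp (tendsto_finsetSum _ fun k _ => ?_)
    refine (ENNReal.continuous_rpow_const.tendsto _).comp ?_
    refine ENNReal.Tendsto.mul_const ?_ (Or.inr (by simp))
    exact (ENNReal.continuous_rpow_const.tendsto _).comp ENNReal.summable.hasSum
  exact le_of_tendsto' ht fun t => fin s t

/-- Schur's test on a mixed sequence space. -/
theorem mixNorm_kernel_le {p p' q q' : ℝ} (hp : p.HolderConjugate p')
    (hq : q.HolderConjugate q') {w : κ → ℝ≥0∞} (hw : ∀ k, w k ≠ 0) (hw' : ∀ k, w k ≠ ∞)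
    (K : κ → ι → κ → ι → ℝ≥0∞) (n : κ → κ → ℝ≥0∞) {C : ℝ≥0∞}
    (h1 : ∀ k l i, ∑' j, K k i l j ≤ n k l) (h2 : ∀ k l j, ∑' i, K k i l j ≤ n k l)
    (h3 : ∀ k, ∑' l, n k l * (w k * (w l)⁻¹) ≤ C) (h4 : ∀ l, ∑' k, n k l * (w k * (w l)⁻¹) ≤ C)
    (a : κ → ι → ℝ≥0∞) :
    mixNorm p q w (fun k i => ∑' l, ∑' j, K k i l j * a l j) ≤ C * mixNorm p q w a := by
  classical
  refine mixNorm_le_of_forall_dual hp hq hw hw' _ _ fun s t b _ hb => ?_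
  have := tsum_kernel_le_mixNorm hp hq hw hw' K n h1 h2 h3 h4 a (fun k i => (b k i : ℝ≥0∞))
  calc _ = ∑' k, ∑' i, ∑' l, ∑' j, K k i l j * (b k i * a l j) := by
        congr 1; funext k; congr 1; funext i
        rw [← ENNReal.tsum_mul_right]
        congr 1; funext l
        rw [← ENNReal.tsum_mul_right]
        congr 1; funext j
        ring
    _ ≤ C * (mixNorm p q w a * 1) := this.trans (by gcongr)
    _ = _ := by rw [mul_one]

theorem tendsto_lpSum_compl [DecidableEq ι] {p : ℝ} (hp : 0 < p) (a : ι → ℝ≥0∞)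
    (ha : lpSum p a ≠ ∞) :
    Filter.Tendsto (fun t : Finset ι => lpSum p (fun i => if i ∈ t then 0 else a i)) Filter.atTop
      (nhds 0) := by
  have hp' : 0 < 1 / p := by positivity
  have hs : ∑' i, a i ^ p ≠ ∞ := by
    intro h
    exact ha (by rw [lpSum, h, ENNReal.top_rpow_of_pos hp'])
  have h0 := (ENNReal.continuous_rpow_const (y := 1 / p)).tendsto 0
  rw [ENNReal.zero_rpow_of_pos hp'] at h0
  refine h0.comp ?_
  refine (ENNReal.tendsto_tsum_compl_atTop_zero hs).congr fun t => ?_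
  have h1 : Function.support (fun i => (if i ∈ t then 0 else a i) ^ p) ⊆ {i | i ∉ t} := by
    intro i hi hit
    simp [hit, hp] at hi
  refine Eq.trans ?_ (tsum_subtype_eq_of_support_subset h1)
  exact tsum_congr fun i => by simp only [if_neg i.2]

/-- The tails of a sequence of finite mixed norm tend to zero in this norm. -/
theorem exists_mixNorm_tail_le [DecidableEq ι] [DecidableEq κ] {p q : ℝ} (hp : 0 < p) (hq : 0 < q)
    {w : κ → ℝ≥0∞} (hw : ∀ k, w k ≠ 0) (hw' : ∀ k, w k ≠ ∞) (a : κ → ι → ℝ≥0∞)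
    (ha : mixNorm p q w a ≠ ∞) {ε : ℝ≥0∞} (hε : ε ≠ 0) :
    ∃ F : Finset (κ × ι), mixNorm p q w (fun k i => if (k, i) ∈ F then 0 else a k i) ≤ ε := by
  have hq' : 0 < 1 / q := by positivity
  have hsum : ∑' k, (lpSum p (a k) * w k) ^ q ≠ ∞ := by
    intro h
    exact ha (by unfold mixNorm; rw [lpSum, h, ENNReal.top_rpow_of_pos hq'])
  have hk : ∀ k, lpSum p (a k) ≠ ∞ := by
    intro k h
    apply ENNReal.ne_top_of_tsum_ne_top hsum k
    rw [h, ENNReal.top_mul (hw k), ENNReal.top_rpow_of_pos hq]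
  -- Half of `ε ^ q` is spent on the rows outside a finite set `s`, the other half on the entries
  -- outside a finite set `t` in the rows of `s`.
  have hε2 : 0 < (ε ^ q) / 2 := by
    apply ENNReal.half_pos
    simp [ENNReal.rpow_eq_zero_iff, hε, hq.not_gt]
  obtain ⟨s, hs⟩ := ((ENNReal.tendsto_tsum_compl_atTop_zero hsum).eventually
    (gt_mem_nhds hε2)).exists
  have ht : Filter.Tendsto (fun t : Finset ι => ∑ k ∈ s,
      (lpSum p (fun i => if i ∈ t then 0 else a k i) * w k) ^ q) Filter.atTop
      (nhds (∑ k ∈ s, ((0 : ℝ≥0∞) * w k) ^ q)) := by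
    refine tendsto_finsetSum _ fun k _ => ?_
    refine (ENNReal.continuous_rpow_const.tendsto _).comp ?_
    exact ENNReal.Tendsto.mul_const (tendsto_lpSum_compl hp (a k) (hk k)) (Or.inr (hw' k))
  have h0 : ∑ k ∈ s, ((0 : ℝ≥0∞) * w k) ^ q = 0 := by simp [hq]
  rw [h0] at ht
  obtain ⟨t, ht⟩ := (ht.eventually (gt_mem_nhds hε2)).exists
  refine ⟨s ×ˢ t, ?_⟩
  set f : κ → ℝ≥0∞ := fun k => (lpSum p (fun i => if (k, i) ∈ s ×ˢ t then 0 else a k i) * w k) ^ q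
    with hf
  have h1 : ∑ k ∈ s, f k ≤ ε ^ q / 2 := by
    refine le_trans (le_of_eq (Finset.sum_congr rfl fun k hk => ?_)) ht.le
    simp only [hf, Finset.mem_product, hk, true_and]
  have h2 : ∑' k : {k // k ∉ s}, f k ≤ ε ^ q / 2 := by
    refine le_trans (ENNReal.tsum_le_tsum fun k => ?_) hs.le
    refine ENNReal.rpow_le_rpow (mul_le_mul_left (lpSum_mono hp.le fun i => ?_) _) hq.le
    split_ifs
    exacts [zero_le, le_rfl]
  have hle : ∑' k, f k ≤ ε ^ q := by
    rw [← ENNReal.sum_add_tsum_compl s f, ← ENNReal.add_halves (ε ^ q)]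
    exact add_le_add h1 h2
  unfold mixNorm
  rw [lpSum, one_div, ENNReal.rpow_inv_le_iff hq]
  exact hle

end sequences

end Subdyadic

namespace Subdyadic

/-! ### Counting points -/

/-- A family of points of `ℝ^d` of which at most `N` lie in any ball of radius `c` satisfies a
uniform bound for the sums of `(1 + |y - y_i|)^(-d-1)`; the bound depends on `d`, `c`, `N` only. -/
theorem exists_tsum_le_of_encard_le (d : ℕ) {c : ℝ} (hc : 0 < c) (N : ℕ) :
    ∃ C : ℝ≥0∞, C ≠ ∞ ∧ ∀ {ι : Type} [Countable ι] (y : ι → Rd d),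
      (∀ z, {i | ‖z - y i‖ ≤ c}.encard ≤ N) → ∀ x,
        ∑' i, ENNReal.ofReal ((1 + ‖x - y i‖) ^ (d + 1))⁻¹ ≤ C := by
  set I : ℝ≥0∞ := ∫⁻ z : Rd d, ENNReal.ofReal ((1 + ‖z‖) ^ (d + 1))⁻¹ with hI
  have hIfin : I ≠ ∞ := by
    have h := finite_integral_one_add_norm (E := Rd d) (μ := volume) (r := (d : ℝ) + 1)
      (by simp)
    refine ne_of_lt (lt_of_le_of_lt (le_of_eq ?_) h)
    refine lintegral_congr fun z => ?_
    rw [Real.rpow_neg (by positivity)]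
    norm_cast
  set v : ℝ≥0∞ := volume (Metric.closedBall (0 : Rd d) c) with hv
  have hv0 : v ≠ 0 := (Metric.measure_closedBall_pos volume _ hc).ne'
  have hvt : v ≠ ∞ := measure_closedBall_lt_top.ne
  -- Comparison with the integral `I`: on a ball of radius `c` the summand varies by a factor of at
  -- most `(1 + c)^(d+1)`, each point lies in at most `N` of the balls, and `v` is the volume of a
  -- ball.
  refine ⟨(N * (ENNReal.ofReal ((1 + c) ^ (d + 1)) * I)) / v,
    ENNReal.div_ne_top (ENNReal.mul_ne_top (by simp) (ENNReal.mul_ne_top (by simp) hIfin)) hv0, ?_⟩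
  intro ι _ y hy x
  rw [ENNReal.le_div_iff_mul_le (Or.inl hv0) (Or.inl hvt), ← ENNReal.tsum_mul_right]
  set g : Rd d → ℝ≥0∞ := fun z => ENNReal.ofReal ((1 + c) ^ (d + 1)) *
    ENNReal.ofReal ((1 + ‖z - x‖) ^ (d + 1))⁻¹ with hg
  have hgm : Measurable g := by
    apply Measurable.const_mul
    apply ENNReal.measurable_ofReal.comp
    fun_prop
  have h1 : ∀ i, ENNReal.ofReal ((1 + ‖x - y i‖) ^ (d + 1))⁻¹ * v ≤
      ∫⁻ z, (Metric.closedBall (y i) c).indicator g z := by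
    intro i
    rw [lintegral_indicator Metric.isClosed_closedBall.measurableSet,
      show v = volume (Metric.closedBall (y i) c) by
        rw [hv, Measure.addHaar_closedBall_center volume (y i)], ← setLIntegral_const]
    refine setLIntegral_mono hgm fun z hz => ?_
    simp only [hg]
    rw [← ENNReal.ofReal_mul (by positivity)]
    apply ENNReal.ofReal_le_ofReal
    rw [← div_eq_mul_inv, inv_le_comm₀ (by positivity) (by positivity), inv_div,
      div_le_iff₀ (by positivity), mul_comm, ← mul_pow]
    gcongr
    have : ‖z - x‖ ≤ ‖z - y i‖ + ‖x - y i‖ := by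
      rw [norm_sub_rev x]
      exact norm_sub_le_norm_sub_add_norm_sub z (y i) x
    rw [mem_closedBall_iff_norm] at hz
    nlinarith [norm_nonneg (x - y i)]
  calc _ ≤ ∑' i, ∫⁻ z, (Metric.closedBall (y i) c).indicator g z := ENNReal.tsum_le_tsum h1
    _ = ∫⁻ z, ∑' i, (Metric.closedBall (y i) c).indicator g z :=
      (lintegral_tsum fun i =>
        (hgm.indicator Metric.isClosed_closedBall.measurableSet).aemeasurable).symm
    _ ≤ ∫⁻ z, N * g z := by
      refine lintegral_mono fun z => ?_
      have e : ∀ i, (Metric.closedBall (y i) c).indicator g z =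
          {i | ‖z - y i‖ ≤ c}.indicator (fun _ => g z) i := by
        intro i
        by_cases h : ‖z - y i‖ ≤ c
        · rw [Set.indicator_of_mem (mem_closedBall_iff_norm.mpr h), Set.indicator_of_mem]
          exact h
        · rw [Set.indicator_of_notMem (mt mem_closedBall_iff_norm.mp h), Set.indicator_of_notMem]
          exact h
      simp only [e]
      rw [← tsum_subtype, ENNReal.tsum_const]
      gcongr
      exact_mod_cast hy z
    _ = N * (ENNReal.ofReal ((1 + c) ^ (d + 1)) * I) := by
      rw [lintegral_const_mul _ hgm, lintegral_const_mul _ (by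
        apply ENNReal.measurable_ofReal.comp
        fun_prop), lintegral_sub_right_eq_self
          (fun z : Rd d => ENNReal.ofReal ((1 + ‖z‖) ^ (d + 1))⁻¹) x]

/-- At the point `(x, η)` the overlap hypothesis counts pairs `(k, j)`. When `η` lies in the
frequency block of every `k ∈ K`, it therefore controls the total number of spatial balls through
`x` above `K`. -/
theorem PhaseLattice.sum_encard_le {d : ℕ} {α : ℝ} (Ω : PhaseLattice d α) {C : ℝ} {N : ℕ}
    (hN : ∀ z : Rd d × Rd d,
      {w : ℕ × (Fin d → ℤ) | z ∈ block α C (Ω.pos w.1 w.2) (Ω.freq w.1)}.encard ≤ N)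
    (η : Rd d) (K : Finset ℕ) (hK : ∀ k ∈ K, ‖η - Ω.freq k‖ ≤ C * ‖Ω.freq k‖ ^ (1 - α))
    (x : Rd d) :
    ∑ k ∈ K, ∑' j, (Metric.closedBall (Ω.pos k j) (C * ‖Ω.freq k‖ ^ (α - 1))).indicator
      (fun _ => (1 : ℝ≥0∞)) x ≤ N := by
  have h1 : ∑ k ∈ K, ∑' j, (Metric.closedBall (Ω.pos k j)
      (C * ‖Ω.freq k‖ ^ (α - 1))).indicator (fun _ => (1 : ℝ≥0∞)) x ≤
      ∑' w : ℕ × (Fin d → ℤ), {w : ℕ × (Fin d → ℤ) |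
        (x, η) ∈ block α C (Ω.pos w.1 w.2) (Ω.freq w.1)}.indicator (fun _ => (1 : ℝ≥0∞)) w := by
    rw [ENNReal.tsum_prod']
    refine le_trans (Finset.sum_le_sum fun k hk => ?_) (ENNReal.sum_le_tsum K)
    refine ENNReal.tsum_le_tsum fun j => ?_
    by_cases h : x ∈ Metric.closedBall (Ω.pos k j) (C * ‖Ω.freq k‖ ^ (α - 1))
    · rw [Set.indicator_of_mem h, Set.indicator_of_mem]
      exact ⟨mem_closedBall_iff_norm.mp h, hK k hk⟩
    · rw [Set.indicator_of_notMem h]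
      exact zero_le
  refine h1.trans ?_
  rw [← tsum_subtype, ENNReal.tsum_const, mul_one]
  exact_mod_cast hN (x, η)

/-- The frequency blocks of a phase space lattice overlap finitely. -/
theorem PhaseLattice.exists_freq_overlap {d : ℕ} {α : ℝ} (Ω : PhaseLattice d α) :
    ∃ (C : ℝ) (N : ℕ), 0 < C ∧ ∀ η : Rd d,
      {k | ‖η - Ω.freq k‖ ≤ C * ‖Ω.freq k‖ ^ (1 - α)}.encard ≤ N := by
  obtain ⟨C, hC, -, N, hN⟩ := Ω.cover_overlap
  obtain ⟨a, b, ha, hb, hab⟩ := Ω.spatial_step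
  set B : ℝ≥0∞ := N * (2 ^ d * ENNReal.ofReal ((b / C) ^ d)) with hB
  have hBt : B ≠ ∞ := ENNReal.mul_ne_top (by simp) (ENNReal.mul_ne_top (by simp) (by simp))
  -- A single `x` need not lie in a `C`-ball above every `k ∈ K`, as `C` may be smaller than the net
  -- constant `b`. The counting function is therefore averaged over a large ball: each `k`
  -- contributes at least a fixed proportion, while the total is at most `N` everywhere.
  have key : ∀ (η : Rd d) (K : Finset ℕ),
      (∀ k ∈ K, ‖η - Ω.freq k‖ ≤ C * ‖Ω.freq k‖ ^ (1 - α)) → (K.card : ℝ≥0∞) ≤ B := by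
    intro η K hK
    set s : ℕ → ℝ := fun k => ‖Ω.freq k‖ ^ (α - 1) with hs
    have hs0 : ∀ k, 0 < s k := fun k =>
      Real.rpow_pos_of_pos (norm_pos_iff.mpr (Ω.freq_ne_zero k)) _
    -- With this `M`, all `C`-balls around net points needed to cover the ball of radius `M` stay
    -- inside the ball of radius `2 * M`.
    obtain ⟨M, hM0, hM⟩ : ∃ M : ℝ, 0 < M ∧ ∀ k ∈ K, (C + b) * s k ≤ M := by
      refine ⟨1 + ∑ k ∈ K, (C + b) * s k, ?_, fun k hk => ?_⟩
      · have : 0 ≤ ∑ k ∈ K, (C + b) * s k :=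
          Finset.sum_nonneg fun k _ => by have := (hs0 k).le; positivity
        linarith
      · have := Finset.single_le_sum (f := fun k => (C + b) * s k)
          (fun k _ => by have := (hs0 k).le; positivity) hk
        linarith
    set v : ℝ≥0∞ := volume (Metric.closedBall (0 : Rd d) M) with hv
    have hv0 : v ≠ 0 := (Metric.measure_closedBall_pos volume _ hM0).ne'
    have hvt : v ≠ ∞ := measure_closedBall_lt_top.ne
    set D := Metric.closedBall (0 : Rd d) (2 * M) with hD
    have hDv : volume D = 2 ^ d * v := by
      rw [hD, hv, Measure.addHaar_closedBall _ _ (by positivity),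
        Measure.addHaar_closedBall _ _ (by positivity), mul_pow,
        ENNReal.ofReal_mul (by positivity), mul_assoc]
      simp [ENNReal.ofReal_pow]
    have low : ∀ k ∈ K, v ≤ ENNReal.ofReal ((b / C) ^ d) *
        ∑' j, volume (Metric.closedBall (Ω.pos k j) (C * s k) ∩ D) := by
      intro k hk
      have hsk := hs0 k
      have hb' : 0 < b * s k := by positivity
      have hC' : 0 < C * s k := by positivity
      have hsub : Metric.closedBall (0 : Rd d) M ⊆
          ⋃ j : {j // ‖Ω.pos k j‖ ≤ M + b * s k}, Metric.closedBall (Ω.pos k j) (b * s k) := by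
        intro x hx
        obtain ⟨j, hj⟩ := (hab k).2 x
        rw [mem_closedBall_zero_iff] at hx
        refine Set.mem_iUnion.mpr ⟨⟨j, ?_⟩, mem_closedBall_iff_norm.mpr hj⟩
        have := norm_sub_norm_le (Ω.pos k j) x
        rw [norm_sub_rev] at this
        linarith
      rw [← ENNReal.tsum_mul_left]
      calc v ≤ ∑' j : {j // ‖Ω.pos k j‖ ≤ M + b * s k},
              volume (Metric.closedBall (Ω.pos k j) (b * s k)) :=
            (measure_mono hsub).trans (measure_iUnion_le _)
        _ ≤ ∑' j : {j // ‖Ω.pos k j‖ ≤ M + b * s k}, ENNReal.ofReal ((b / C) ^ d) *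
              volume (Metric.closedBall (Ω.pos k j) (C * s k) ∩ D) := by
            refine ENNReal.tsum_le_tsum fun j => ?_
            rw [Set.inter_eq_left.mpr, Measure.addHaar_closedBall _ _ hb'.le,
              Measure.addHaar_closedBall _ _ hC'.le, ← mul_assoc,
              ← ENNReal.ofReal_mul (by positivity)]
            · apply le_of_eq
              congr 2
              rw [finrank_euclideanSpace, Fintype.card_fin, ← mul_pow]
              congr 1
              field_simp
            · refine Metric.closedBall_subset_closedBall' ?_
              rw [dist_zero_right]
              have := hM k hk
              nlinarith [j.2]
        _ ≤ _ := ENNReal.tsum_comp_le_tsum_of_injective Subtype.val_injective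
              (fun j => ENNReal.ofReal ((b / C) ^ d) *
                volume (Metric.closedBall (Ω.pos k j) (C * s k) ∩ D))
    have up : ∑ k ∈ K, ∑' j, volume (Metric.closedBall (Ω.pos k j) (C * s k) ∩ D) ≤
        N * volume D := by
      calc _ = ∑ k ∈ K, ∑' j, ∫⁻ x in D, (Metric.closedBall (Ω.pos k j) (C * s k)).indicator
              (fun _ => (1 : ℝ≥0∞)) x := by
            refine Finset.sum_congr rfl fun k _ => tsum_congr fun j => ?_
            rw [lintegral_indicator Metric.isClosed_closedBall.measurableSet, setLIntegral_const,
              one_mul, Measure.restrict_apply Metric.isClosed_closedBall.measurableSet]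
        _ = ∫⁻ x in D, ∑ k ∈ K, ∑' j, (Metric.closedBall (Ω.pos k j) (C * s k)).indicator
              (fun _ => (1 : ℝ≥0∞)) x := by
            rw [lintegral_finsetSum']
            · refine Finset.sum_congr rfl fun k _ => (lintegral_tsum fun j => ?_).symm
              exact (measurable_const.indicator
                Metric.isClosed_closedBall.measurableSet).aemeasurable
            · intro k _
              exact (Measurable.tsum fun j => measurable_const.indicator
                Metric.isClosed_closedBall.measurableSet).aemeasurable
        _ ≤ ∫⁻ x in D, N := lintegral_mono fun x => Ω.sum_encard_le hN η K hK x
        _ = _ := by rw [setLIntegral_const]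
    have h2 : (K.card : ℝ≥0∞) * v ≤ B * v := by
      calc (K.card : ℝ≥0∞) * v = ∑ k ∈ K, v := by simp
        _ ≤ ∑ k ∈ K, ENNReal.ofReal ((b / C) ^ d) *
              ∑' j, volume (Metric.closedBall (Ω.pos k j) (C * s k) ∩ D) :=
            Finset.sum_le_sum low
        _ ≤ ENNReal.ofReal ((b / C) ^ d) * (N * volume D) := by
            rw [← Finset.mul_sum]
            gcongr
        _ = B * v := by
            rw [hDv, hB]
            ring
    exact (ENNReal.mul_le_mul_iff_left hv0 hvt).mp h2
  obtain ⟨n, hn⟩ := ENNReal.exists_nat_gt hBt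
  refine ⟨C, n, hC, fun η => ?_⟩
  by_contra hlt
  push Not at hlt
  obtain ⟨t, ht, htc⟩ := Set.exists_subset_encard_eq (k := ((n + 1 : ℕ) : ℕ∞))
    (by exact_mod_cast Order.add_one_le_of_lt hlt)
  have htf : t.Finite := Set.finite_of_encard_eq_coe htc
  have h1 := key η htf.toFinset (fun k hk => ht (by simpa using hk))
  have h2 : htf.toFinset.card = n + 1 := by
    rw [htf.encard_eq_coe_toFinset_card] at htc
    exact_mod_cast htc
  rw [h2] at h1
  have h3 : ((n + 1 : ℕ) : ℝ≥0∞) < n := lt_of_le_of_lt h1 hn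
  norm_cast at h3
  omega

/-- The frequency centres stay away from the origin. -/
theorem PhaseLattice.exists_le_norm_freq {d : ℕ} {α : ℝ} (hα : 0 < α) (Ω : PhaseLattice d α) :
    ∃ r : ℝ, 0 < r ∧ ∀ k, r ≤ ‖Ω.freq k‖ := by
  obtain ⟨C, N, hC, hN⟩ := Ω.exists_freq_overlap
  have hpos : ∀ k, 0 < ‖Ω.freq k‖ := fun k => norm_pos_iff.mpr (Ω.freq_ne_zero k)
  -- If `|ξ|^α ≤ C`, then `|ξ| ≤ C |ξ|^(1-α)`: the frequency block of `ξ` contains the origin, which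
  -- happens finitely often.
  have hfin : {k | ‖Ω.freq k‖ < C ^ α⁻¹}.Finite := by
    refine Set.Finite.subset (Set.finite_of_encard_le_coe (hN 0)) fun k hk => ?_
    have h1 : ‖Ω.freq k‖ ^ α ≤ C := by
      have := Real.rpow_le_rpow (hpos k).le (le_of_lt hk) hα.le
      rwa [← Real.rpow_mul hC.le, inv_mul_cancel₀ hα.ne', Real.rpow_one] at this
    change ‖0 - Ω.freq k‖ ≤ _
    rw [zero_sub, norm_neg]
    calc ‖Ω.freq k‖ = ‖Ω.freq k‖ ^ α * ‖Ω.freq k‖ ^ (1 - α) := by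
          rw [← Real.rpow_add (hpos k)]
          simp
      _ ≤ _ := by gcongr
  have hCα : 0 < C ^ α⁻¹ := Real.rpow_pos_of_pos hC _
  have hr : ∃ r : ℝ, 0 < r ∧ ∀ k ∈ hfin.toFinset, r ≤ ‖Ω.freq k‖ := by
    generalize hfin.toFinset = s
    induction s using Finset.induction_on with
    | empty => exact ⟨1, one_pos, by simp⟩
    | insert k s _ ih =>
      obtain ⟨r, hr, h⟩ := ih
      refine ⟨min r ‖Ω.freq k‖, lt_min hr (hpos k), fun l hl => ?_⟩
      rcases Finset.mem_insert.mp hl with rfl | hl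
      · exact min_le_right _ _
      · exact (min_le_left _ _).trans (h l hl)
  obtain ⟨r, hr, h⟩ := hr
  refine ⟨min r (C ^ α⁻¹), lt_min hr hCα, fun k => ?_⟩
  by_cases hk : ‖Ω.freq k‖ < C ^ α⁻¹
  · exact (min_le_left _ _).trans (h k (by simpa using hk))
  · exact (min_le_right _ _).trans (not_lt.mp hk)

end Subdyadic

namespace Subdyadic

/-! ### The geometry of the lattice -/

/-- Comparability with ratio `v` is assumed in both directions, so the exponent may have either
sign. -/
theorem rpow_le_abs_rpow_mul {a b v : ℝ} (ha : 0 < a) (hb : 0 < b) (hv : 1 ≤ v)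
    (hab : a ≤ v * b) (hba : b ≤ v * a) (γ : ℝ) : a ^ γ ≤ v ^ |γ| * b ^ γ := by
  have hv0 : 0 < v := by linarith
  rcases le_total 0 γ with h | h
  · rw [abs_of_nonneg h, ← Real.mul_rpow hv0.le hb.le]
    exact Real.rpow_le_rpow ha.le hab h
  · rw [abs_of_nonpos h]
    have h1 : (v * a) ^ γ ≤ b ^ γ := Real.rpow_le_rpow_of_nonpos hb hba h
    rw [Real.mul_rpow hv0.le ha.le] at h1
    calc a ^ γ = v ^ (-γ) * (v ^ γ * a ^ γ) := by
          rw [← mul_assoc, ← Real.rpow_add hv0]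
          simp
      _ ≤ _ := by gcongr

/-- The radial power map `x ↦ |x|^(γ-1) x`. -/
noncomputable def radialPow {d : ℕ} (γ : ℝ) (x : Rd d) : Rd d := ‖x‖ ^ (γ - 1) • x

theorem norm_radialPow {d : ℕ} (γ : ℝ) {x : Rd d} (hx : x ≠ 0) : ‖radialPow γ x‖ = ‖x‖ ^ γ := by
  have h := norm_pos_iff.mpr hx
  rw [radialPow, norm_smul, Real.norm_of_nonneg (by positivity)]
  nth_rewrite 2 [← Real.rpow_one ‖x‖]
  rw [← Real.rpow_add h]
  simp

theorem radialPow_inv {d : ℕ} {γ : ℝ} (hγ : γ ≠ 0) {x : Rd d} (hx : x ≠ 0) :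
    radialPow γ⁻¹ (radialPow γ x) = x := by
  have h := norm_pos_iff.mpr hx
  rw [radialPow, norm_radialPow γ hx, radialPow, smul_smul, ← Real.rpow_mul h.le,
    ← Real.rpow_add h]
  have : γ * (γ⁻¹ - 1) + (γ - 1) = 0 := by field_simp; ring
  rw [this, Real.rpow_zero, one_smul]

/-- For `γ ≥ 1` this is Bernoulli's inequality; for `γ ≤ 1` it suffices that `u ≤ u ^ γ ≤ 1`. -/
theorem abs_sub_rpow_le {u γ : ℝ} (hu : 0 < u) (hu1 : u ≤ 1) (hγ : 0 < γ) :
    |u - u ^ γ| ≤ (1 + γ) * (1 - u) := by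
  rcases le_total 1 γ with h | h
  · have h1 := one_add_mul_self_le_rpow_one_add (s := u - 1) (by linarith) h
    rw [add_sub_cancel] at h1
    have h2 : u ^ γ ≤ u := by
      simpa using Real.rpow_le_rpow_of_exponent_ge hu hu1 h
    rw [abs_of_nonneg (by linarith)]
    nlinarith
  · have h2 : u ≤ u ^ γ := by
      simpa using Real.rpow_le_rpow_of_exponent_ge hu hu1 h
    have h3 : u ^ γ ≤ 1 := Real.rpow_le_one hu.le hu1 hγ.le
    rw [abs_of_nonpos (by linarith)]
    nlinarith

/-- Integrating the derivative along the segment fails near the origin when `γ < 1`. Instead the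
difference is split into `|a|^(γ-1) (a - b)` and a multiple of `b`, which reduces to one variable
through the ratio `|b| / |a|`. -/
theorem norm_radialPow_sub_le {d : ℕ} {γ : ℝ} (hγ : 0 < γ) {a b : Rd d} (hab : ‖b‖ ≤ ‖a‖) :
    ‖radialPow γ a - radialPow γ b‖ ≤ (2 + γ) * ‖a‖ ^ (γ - 1) * ‖a - b‖ := by
  by_cases hb : b = 0
  · subst hb
    have : radialPow γ (0 : Rd d) = 0 := by simp [radialPow]
    rw [this, sub_zero, sub_zero, radialPow, norm_smul, Real.norm_of_nonneg (by positivity)]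
    have : 0 ≤ ‖a‖ ^ (γ - 1) * ‖a‖ := by positivity
    nlinarith
  have hb0 := norm_pos_iff.mpr hb
  have ha0 : 0 < ‖a‖ := hb0.trans_le hab
  have h1 : radialPow γ a - radialPow γ b =
      ‖a‖ ^ (γ - 1) • (a - b) + (‖a‖ ^ (γ - 1) - ‖b‖ ^ (γ - 1)) • b := by
    simp only [radialPow, smul_sub, sub_smul]
    abel
  have h2 : |‖a‖ ^ (γ - 1) - ‖b‖ ^ (γ - 1)| * ‖b‖ ≤
      (1 + γ) * ‖a‖ ^ (γ - 1) * ‖a - b‖ := by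
    set u := ‖b‖ / ‖a‖ with hu
    have hu0 : 0 < u := by positivity
    have hu1 : u ≤ 1 := by rw [hu, div_le_one ha0]; exact hab
    have hbu : ‖b‖ = u * ‖a‖ := by rw [hu]; field_simp
    have h3 := abs_sub_rpow_le hu0 hu1 hγ
    have e : u ^ (γ - 1) * u = u ^ γ := by
      nth_rewrite 2 [← Real.rpow_one u]
      rw [← Real.rpow_add hu0]
      simp
    have h4 : |‖a‖ ^ (γ - 1) - ‖b‖ ^ (γ - 1)| * ‖b‖ = ‖a‖ ^ (γ - 1) * ‖a‖ * |u - u ^ γ| := by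
      rw [hbu, Real.mul_rpow hu0.le ha0.le, ← e, ← one_sub_mul, ← one_sub_mul, abs_mul, abs_mul,
        abs_of_pos hu0, abs_of_nonneg (by positivity : 0 ≤ ‖a‖ ^ (γ - 1))]
      ring
    have h5 : ‖a‖ * (1 - u) ≤ ‖a - b‖ := by
      have := norm_sub_norm_le a b
      rw [hbu] at this
      linarith
    rw [h4]
    have : 0 ≤ ‖a‖ ^ (γ - 1) := by positivity
    calc ‖a‖ ^ (γ - 1) * ‖a‖ * |u - u ^ γ| ≤ ‖a‖ ^ (γ - 1) * ‖a‖ * ((1 + γ) * (1 - u)) := by gcongr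
      _ = (1 + γ) * ‖a‖ ^ (γ - 1) * (‖a‖ * (1 - u)) := by ring
      _ ≤ _ := by gcongr
  rw [h1]
  refine (norm_add_le _ _).trans ?_
  rw [norm_smul, norm_smul, Real.norm_of_nonneg (by positivity), Real.norm_eq_abs]
  linarith

namespace PhaseLattice

variable {d : ℕ} {α : ℝ} (Ω : PhaseLattice d α)

/-- The frequency width `|ξ_k|^(1-α)` of the blocks above `ξ_k`. -/
noncomputable def width (k : ℕ) : ℝ := ‖Ω.freq k‖ ^ (1 - α)

/-- A distance of the frequency centres, in units of the width of the blocks. -/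
noncomputable def freqDist (k l : ℕ) : ℝ :=
  ‖radialPow α (Ω.freq k) - radialPow α (Ω.freq l)‖

/-- A quasi-distance of two lattice points. -/
noncomputable def tau (z w : ℕ × (Fin d → ℤ)) : ℝ :=
  1 + Ω.freqDist z.1 w.1 + (Ω.width z.1 + Ω.width w.1) * ‖Ω.pos z.1 z.2 - Ω.pos w.1 w.2‖

theorem norm_freq_pos (k : ℕ) : 0 < ‖Ω.freq k‖ := norm_pos_iff.mpr (Ω.freq_ne_zero k)

theorem width_pos (k : ℕ) : 0 < Ω.width k := Real.rpow_pos_of_pos (Ω.norm_freq_pos k) _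

theorem width_mul (k : ℕ) : Ω.width k * ‖Ω.freq k‖ ^ (α - 1) = 1 := by
  rw [width, ← Real.rpow_add (Ω.norm_freq_pos k)]
  simp

theorem freqDist_nonneg (k l : ℕ) : 0 ≤ Ω.freqDist k l := norm_nonneg _

theorem freqDist_comm (k l : ℕ) : Ω.freqDist k l = Ω.freqDist l k := norm_sub_rev _ _

theorem freqDist_triangle (k l m : ℕ) : Ω.freqDist k m ≤ Ω.freqDist k l + Ω.freqDist l m :=
  norm_sub_le_norm_sub_add_norm_sub _ _ _

theorem tau_comm (z w : ℕ × (Fin d → ℤ)) : Ω.tau z w = Ω.tau w z := by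
  rw [tau, tau, freqDist_comm, norm_sub_rev, add_comm (Ω.width _)]

theorem one_add_freqDist_le_tau (z w : ℕ × (Fin d → ℤ)) : 1 + Ω.freqDist z.1 w.1 ≤ Ω.tau z w := by
  have := Ω.width_pos z.1
  have := Ω.width_pos w.1
  rw [tau]
  have : 0 ≤ (Ω.width z.1 + Ω.width w.1) * ‖Ω.pos z.1 z.2 - Ω.pos w.1 w.2‖ := by positivity
  linarith

theorem one_le_tau (z w : ℕ × (Fin d → ℤ)) : 1 ≤ Ω.tau z w := by
  have := Ω.one_add_freqDist_le_tau z w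
  have := Ω.freqDist_nonneg z.1 w.1
  linarith

theorem tau_pos (z w : ℕ × (Fin d → ℤ)) : 0 < Ω.tau z w := one_pos.trans_le (Ω.one_le_tau z w)

theorem width_mul_norm_le_tau (z w : ℕ × (Fin d → ℤ)) :
    1 + Ω.width z.1 * ‖Ω.pos z.1 z.2 - Ω.pos w.1 w.2‖ ≤ Ω.tau z w := by
  have := Ω.freqDist_nonneg z.1 w.1
  have := (Ω.width_pos w.1).le
  rw [tau, add_mul]
  have : 0 ≤ Ω.width w.1 * ‖Ω.pos z.1 z.2 - Ω.pos w.1 w.2‖ := by positivity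
  linarith

theorem width_mul_norm_le_tau' (z w : ℕ × (Fin d → ℤ)) :
    1 + Ω.width w.1 * ‖Ω.pos z.1 z.2 - Ω.pos w.1 w.2‖ ≤ Ω.tau z w := by
  rw [tau_comm, norm_sub_rev]
  exact Ω.width_mul_norm_le_tau w z


/-- The inverse radial map sends a small ball around the image of `ξ_l` into the frequency block of
`ξ_l`. Finite overlap of the blocks thus bounds the number of image points in any such ball, and the
counting estimate applies. -/
theorem exists_tsum_freqDist_le (hα : 0 < α) : ∃ C : ℝ≥0∞, C ≠ ∞ ∧ ∀ k,
    ∑' l, ENNReal.ofReal ((1 + Ω.freqDist k l) ^ (d + 1))⁻¹ ≤ C := by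
  obtain ⟨R, N, hR, hN⟩ := Ω.exists_freq_overlap
  obtain ⟨r, hr, hrk⟩ := Ω.exists_le_norm_freq hα
  set A : ℝ := (2 + α⁻¹) * 2 ^ |α⁻¹ - 1| with hA
  have hA0 : 0 < A := by positivity
  have hrα : 0 < r ^ α := Real.rpow_pos_of_pos hr _
  -- The bound `r ^ α / 2` keeps `z` and the image point comparable in size; the bound `R / A` makes
  -- the inverse image land in the block of radius `R`.
  set c : ℝ := min (r ^ α / 2) (R / A) with hc
  have hc0 : 0 < c := lt_min (by positivity) (by positivity)
  have hcA : A * c ≤ R := by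
    have := min_le_right (r ^ α / 2) (R / A)
    rwa [← hc, le_div_iff₀ hA0, mul_comm] at this
  obtain ⟨C, hC, h⟩ := exists_tsum_le_of_encard_le d hc0 N
  refine ⟨C, hC, fun k => h (fun l => radialPow α (Ω.freq l)) (fun z => ?_) _⟩
  refine (Set.encard_le_encard fun l hl => ?_).trans (hN (radialPow α⁻¹ z))
  change ‖z - radialPow α (Ω.freq l)‖ ≤ c at hl
  change ‖radialPow α⁻¹ z - Ω.freq l‖ ≤ _
  set y := radialPow α (Ω.freq l) with hy
  have hyn : ‖y‖ = ‖Ω.freq l‖ ^ α := norm_radialPow α (Ω.freq_ne_zero l)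
  have hyc : c ≤ ‖y‖ / 2 := by
    rw [hyn]
    refine (min_le_left _ _).trans ?_
    have := Real.rpow_le_rpow hr.le (hrk l) hα.le
    linarith
  have hy0 : 0 < ‖y‖ := by linarith
  have hξ : Ω.freq l = radialPow α⁻¹ y := (radialPow_inv hα.ne' (Ω.freq_ne_zero l)).symm
  have hz1 : ‖z‖ ≤ 2 * ‖y‖ := by
    have := norm_sub_norm_le z y
    linarith
  have hz2 : ‖y‖ ≤ 2 * ‖z‖ := by
    have := norm_sub_norm_le y z
    rw [norm_sub_rev] at this
    linarith
  have hz0 : 0 < ‖z‖ := by linarith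
  have hyw : ‖y‖ ^ (α⁻¹ - 1) = ‖Ω.freq l‖ ^ (1 - α) := by
    rw [hyn, ← Real.rpow_mul (norm_nonneg _)]
    congr 1
    field_simp
  have hα' : 0 < α⁻¹ := inv_pos.mpr hα
  have main : ‖radialPow α⁻¹ z - radialPow α⁻¹ y‖ ≤ A * ‖y‖ ^ (α⁻¹ - 1) * ‖z - y‖ := by
    rcases le_total ‖y‖ ‖z‖ with hle | hle
    · refine (norm_radialPow_sub_le hα' hle).trans ?_
      have := rpow_le_abs_rpow_mul hz0 hy0 one_le_two hz1 hz2 (α⁻¹ - 1)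
      calc _ ≤ (2 + α⁻¹) * (2 ^ |α⁻¹ - 1| * ‖y‖ ^ (α⁻¹ - 1)) * ‖z - y‖ := by gcongr
        _ = _ := by rw [hA]; ring
    · rw [norm_sub_rev, norm_sub_rev z]
      refine (norm_radialPow_sub_le hα' hle).trans ?_
      have : (2 + α⁻¹) ≤ A := by
        rw [hA]
        have : (1 : ℝ) ≤ 2 ^ |α⁻¹ - 1| := Real.one_le_rpow one_le_two (abs_nonneg _)
        nlinarith
      gcongr
  nth_rewrite 1 [hξ]
  refine main.trans ?_
  rw [hyw]
  have : 0 ≤ ‖Ω.freq l‖ ^ (1 - α) := by positivity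
  calc A * ‖Ω.freq l‖ ^ (1 - α) * ‖z - y‖ ≤ A * ‖Ω.freq l‖ ^ (1 - α) * c := by gcongr
    _ = A * c * ‖Ω.freq l‖ ^ (1 - α) := by ring
    _ ≤ _ := by gcongr

/-- After dilation by the width, the spatial net above any `k` is `a`-separated, so a ball of radius
`a / 3` contains at most one of its points. -/
theorem exists_tsum_width_le : ∃ C : ℝ≥0∞, C ≠ ∞ ∧ ∀ k x,
    ∑' j, ENNReal.ofReal ((1 + Ω.width k * ‖x - Ω.pos k j‖) ^ (d + 1))⁻¹ ≤ C := by
  obtain ⟨a, b, ha, -, hab⟩ := Ω.spatial_step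
  obtain ⟨C, hC, h⟩ := exists_tsum_le_of_encard_le d (c := a / 3) (by positivity) 1
  refine ⟨C, hC, fun k x => ?_⟩
  have hw := Ω.width_pos k
  have h1 := h (fun j => Ω.width k • Ω.pos k j) (fun z => ?_) (Ω.width k • x)
  · refine le_trans (le_of_eq (tsum_congr fun j => ?_)) h1
    rw [← smul_sub, norm_smul, Real.norm_of_nonneg hw.le]
  · rw [Nat.cast_one, Set.encard_le_one_iff]
    intro i j hi hj
    by_contra hij
    have h2 := (hab k).1 i j hij
    have h3 : a ≤ Ω.width k * ‖Ω.pos k i - Ω.pos k j‖ := by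
      calc a = Ω.width k * (a * ‖Ω.freq k‖ ^ (α - 1)) := by
            rw [mul_left_comm, Ω.width_mul, mul_one]
        _ ≤ _ := by gcongr
    have h4 : Ω.width k * ‖Ω.pos k i - Ω.pos k j‖ =
        ‖(z - Ω.width k • Ω.pos k j) - (z - Ω.width k • Ω.pos k i)‖ := by
      rw [sub_sub_sub_cancel_left, ← smul_sub, norm_smul, Real.norm_of_nonneg hw.le]
    have h5 := norm_sub_le (z - Ω.width k • Ω.pos k j) (z - Ω.width k • Ω.pos k i)
    change ‖z - Ω.width k • Ω.pos k i‖ ≤ a / 3 at hi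
    change ‖z - Ω.width k • Ω.pos k j‖ ≤ a / 3 at hj
    linarith

/-- Sizes of frequency centres change at most polynomially in their distance. -/
theorem exists_norm_freq_le (hα : 0 < α) : ∃ C : ℝ, 1 ≤ C ∧ ∀ k l,
    ‖Ω.freq k‖ ≤ (C * (1 + Ω.freqDist k l)) ^ α⁻¹ * ‖Ω.freq l‖ := by
  obtain ⟨r, hr, hrk⟩ := Ω.exists_le_norm_freq hα
  have hrα : 0 < r ^ α := Real.rpow_pos_of_pos hr _
  -- The lower bound `r` on the centres turns the additive inequality `|ξ_k|^α ≤ |ξ_l|^α + D` into a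
  -- multiplicative one.
  refine ⟨max 1 (r ^ α)⁻¹, le_max_left _ _, fun k l => ?_⟩
  have hD := Ω.freqDist_nonneg k l
  have h1 : ‖Ω.freq k‖ ^ α ≤ ‖Ω.freq l‖ ^ α + Ω.freqDist k l := by
    rw [← norm_radialPow α (Ω.freq_ne_zero k), ← norm_radialPow α (Ω.freq_ne_zero l)]
    have := norm_sub_norm_le (radialPow α (Ω.freq k)) (radialPow α (Ω.freq l))
    rw [freqDist]
    linarith
  have h2 : r ^ α ≤ ‖Ω.freq l‖ ^ α := Real.rpow_le_rpow hr.le (hrk l) hα.le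
  set M := max 1 (r ^ α)⁻¹ with hM
  have hM0 : 0 < M := one_pos.trans_le (le_max_left _ _)
  have h3 : 1 ≤ M * ‖Ω.freq l‖ ^ α := by
    calc (1 : ℝ) = (r ^ α)⁻¹ * r ^ α := by field_simp
      _ ≤ _ := by
        gcongr
        exact le_max_right _ _
  have h4 : ‖Ω.freq k‖ ^ α ≤ M * (1 + Ω.freqDist k l) * ‖Ω.freq l‖ ^ α := by
    have h5 : (1 : ℝ) ≤ M := le_max_left _ _
    have : 0 ≤ ‖Ω.freq l‖ ^ α := by positivity
    nlinarith
  have h5 := Real.rpow_le_rpow (by positivity) h4 (inv_nonneg.mpr hα.le)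
  rwa [Real.mul_rpow (by positivity) (by positivity), ← Real.rpow_mul (norm_nonneg _),
    ← Real.rpow_mul (norm_nonneg _), mul_inv_cancel₀ hα.ne', Real.rpow_one, Real.rpow_one] at h5

/-- Powers of quantities that, like the size of the frequency, change at most polynomially. -/
theorem exists_rpow_le (hα : 0 < α) (γ : ℝ) :
    ∃ (C : ℝ) (m : ℕ), 1 ≤ C ∧ ∀ f : ℕ → ℝ, (∀ k, 0 < f k) →
    (∀ v : ℝ, 1 ≤ v → ∀ k l, ‖Ω.freq k‖ ≤ v * ‖Ω.freq l‖ → f k ≤ v * f l) → ∀ k l,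
    f k ^ γ ≤ C * (1 + Ω.freqDist k l) ^ m * f l ^ γ := by
  obtain ⟨C, hC, h⟩ := Ω.exists_norm_freq_le hα
  refine ⟨C ^ ⌈α⁻¹ * |γ|⌉₊, ⌈α⁻¹ * |γ|⌉₊, one_le_pow₀ hC, fun f hf hfv k l => ?_⟩
  have hD := Ω.freqDist_nonneg k l
  have hu : 1 ≤ C * (1 + Ω.freqDist k l) := by nlinarith
  have hv : 1 ≤ (C * (1 + Ω.freqDist k l)) ^ α⁻¹ := Real.one_le_rpow hu (inv_nonneg.mpr hα.le)
  have h1 := rpow_le_abs_rpow_mul (hf k) (hf l) hv (hfv _ hv k l (h k l))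
    (hfv _ hv l k (by rw [Ω.freqDist_comm k l]; exact h l k)) γ
  refine h1.trans ?_
  rw [← mul_pow, ← Real.rpow_natCast, ← Real.rpow_mul (by linarith)]
  have := hf l
  gcongr
  exact Nat.le_ceil _

theorem exists_norm_freq_rpow_le (hα : 0 < α) (γ : ℝ) : ∃ (C : ℝ) (m : ℕ), 1 ≤ C ∧ ∀ k l,
    ‖Ω.freq k‖ ^ γ ≤ C * (1 + Ω.freqDist k l) ^ m * ‖Ω.freq l‖ ^ γ := by
  obtain ⟨C, m, hC, h⟩ := Ω.exists_rpow_le hα γ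
  exact ⟨C, m, hC, h _ Ω.norm_freq_pos fun v _ k l hkl => hkl⟩

theorem exists_weight_le (hα : 0 < α) (β : ℝ) : ∃ (C : ℝ) (m : ℕ), 1 ≤ C ∧ ∀ k l,
    weight β (Ω.freq k) ≤ C * (1 + Ω.freqDist k l) ^ m * weight β (Ω.freq l) := by
  obtain ⟨C, m, hC, h⟩ := Ω.exists_rpow_le hα β
  exact ⟨C, m, hC, h (fun k => 1 + ‖Ω.freq k‖) (fun k => by positivity)
    fun v hv k l hkl => by linarith⟩

theorem exists_width_le (hα : 0 < α) : ∃ (C : ℝ) (m : ℕ), 1 ≤ C ∧ ∀ k l,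
    Ω.width k ≤ C * (1 + Ω.freqDist k l) ^ m * Ω.width l :=
  Ω.exists_norm_freq_rpow_le hα (1 - α)

/-- Frequencies whose blocks, enlarged by a fixed factor, meet are at bounded distance. -/
theorem exists_freqDist_le (hα : 0 < α) (R : ℝ) : ∃ C : ℝ, ∀ k l,
    ‖Ω.freq k - Ω.freq l‖ ≤ R * (Ω.width k + Ω.width l) → Ω.freqDist k l ≤ C := by
  obtain ⟨r, hr, hrk⟩ := Ω.exists_le_norm_freq hα
  -- the ratio of the widths is bounded
  obtain ⟨B, hB0, hB⟩ : ∃ B : ℝ, 0 ≤ B ∧ ∀ k l, ‖Ω.freq l‖ ≤ ‖Ω.freq k‖ →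
      ‖Ω.freq k - Ω.freq l‖ ≤ R * (Ω.width k + Ω.width l) → Ω.width l ≤ B * Ω.width k := by
    rcases le_total α 1 with h1 | h1
    · refine ⟨1, zero_le_one, fun k l hlk _ => ?_⟩
      rw [one_mul]
      exact Real.rpow_le_rpow (norm_nonneg _) hlk (by linarith)
    -- Here the width decreases with `|ξ|`, so the smaller frequency has the wider block. That width
    -- is still at most `r^(-α)` times the frequency, so the assumed closeness forces the two
    -- frequencies to be comparable.
    · set E : ℝ := 1 + 2 * |R| * r ^ (-α) with hE
      have hE1 : 1 ≤ E := by
        have : 0 ≤ 2 * |R| * r ^ (-α) := by positivity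
        linarith
      refine ⟨E ^ |1 - α|, by positivity, fun k l hlk h => ?_⟩
      have hl := Ω.norm_freq_pos l
      have hk := Ω.norm_freq_pos k
      have hw : Ω.width k ≤ Ω.width l :=
        Real.rpow_le_rpow_of_nonpos hl hlk (by linarith)
      have hw2 : Ω.width l ≤ r ^ (-α) * ‖Ω.freq l‖ := by
        have : Ω.width l = ‖Ω.freq l‖ ^ (-α) * ‖Ω.freq l‖ := by
          rw [width]
          nth_rewrite 3 [← Real.rpow_one ‖Ω.freq l‖]
          rw [← Real.rpow_add hl]
          congr 1
          ring
        rw [this]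
        gcongr ?_ * _
        exact Real.rpow_le_rpow_of_nonpos hr (hrk l) (by linarith)
      have h2 : ‖Ω.freq k‖ ≤ E * ‖Ω.freq l‖ := by
        have h3 := norm_sub_norm_le (Ω.freq k) (Ω.freq l)
        have h4 : R * (Ω.width k + Ω.width l) ≤ |R| * (2 * (r ^ (-α) * ‖Ω.freq l‖)) := by
          have := Ω.width_pos k
          have := Ω.width_pos l
          gcongr
          · exact le_abs_self R
          · linarith
        have : E * ‖Ω.freq l‖ = ‖Ω.freq l‖ + |R| * (2 * (r ^ (-α) * ‖Ω.freq l‖)) := by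
          rw [hE]; ring
        linarith
      exact rpow_le_abs_rpow_mul hl hk hE1 (hlk.trans (by nlinarith)) h2 _
  have half : ∀ k l, ‖Ω.freq l‖ ≤ ‖Ω.freq k‖ →
      ‖Ω.freq k - Ω.freq l‖ ≤ R * (Ω.width k + Ω.width l) →
      Ω.freqDist k l ≤ (2 + α) * (|R| * (1 + B)) := by
    intro k l hlk h
    have h1 := norm_radialPow_sub_le hα hlk
    have hw := Ω.width_pos k
    have hw' := Ω.width_pos l
    have h2 : R * (Ω.width k + Ω.width l) ≤ |R| * (1 + B) * Ω.width k := by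
      have := hB k l hlk h
      calc R * (Ω.width k + Ω.width l) ≤ |R| * (Ω.width k + B * Ω.width k) := by
            gcongr
            exact le_abs_self R
        _ = _ := by ring
    calc Ω.freqDist k l ≤ (2 + α) * ‖Ω.freq k‖ ^ (α - 1) * (|R| * (1 + B) * Ω.width k) := by
          refine h1.trans ?_
          gcongr
          exact h.trans h2
      _ = (2 + α) * (|R| * (1 + B)) * (Ω.width k * ‖Ω.freq k‖ ^ (α - 1)) := by ring
      _ = _ := by rw [Ω.width_mul, mul_one]
  refine ⟨(2 + α) * (|R| * (1 + B)), fun k l h => ?_⟩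
  rcases le_total ‖Ω.freq l‖ ‖Ω.freq k‖ with hlk | hlk
  · exact half k l hlk h
  · rw [freqDist_comm]
    refine half l k hlk ?_
    rwa [norm_sub_rev, add_comm (Ω.width l)]

end PhaseLattice

end Subdyadic

/-! ### Summation over the lattice, localized kernels and polynomial comparison of distances. -/

namespace Subdyadic

namespace PhaseLattice

variable {d : ℕ} {α : ℝ} (Ω : PhaseLattice d α)

/-- Of the `n + (d + 1)` powers of `tau`, `n` are spent on the frequency distance and `d + 1` on
summing over the spatial net. -/
theorem exists_tsum_block_tau_le : ∃ C : ℝ≥0∞, C ≠ ∞ ∧ ∀ (n k l : ℕ) (i : Fin d → ℤ),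
    ∑' j, ENNReal.ofReal (Ω.tau (k, i) (l, j) ^ (n + (d + 1)))⁻¹ ≤
      ENNReal.ofReal ((1 + Ω.freqDist k l) ^ n)⁻¹ * C := by
  obtain ⟨C, hC, h⟩ := Ω.exists_tsum_width_le
  refine ⟨C, hC, fun n k l i => ?_⟩
  refine le_trans ?_ (mul_le_mul_right (h l (Ω.pos k i)) _)
  rw [← ENNReal.tsum_mul_left]
  refine ENNReal.tsum_le_tsum fun j => ?_
  have hD := Ω.freqDist_nonneg k l
  have hW := (Ω.width_pos l).le
  have h0 := (Ω.tau_pos (k, i) (l, j)).le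
  have h1 := Ω.one_add_freqDist_le_tau (k, i) (l, j)
  have h2 := Ω.width_mul_norm_le_tau' (k, i) (l, j)
  rw [← ENNReal.ofReal_mul (by positivity), ← mul_inv, pow_add]
  apply ENNReal.ofReal_le_ofReal
  gcongr


theorem exists_tsum_tau_le (hα : 0 < α) : ∃ (N : ℕ) (C : ℝ≥0∞), C ≠ ∞ ∧ ∀ z,
    ∑' w, ENNReal.ofReal (Ω.tau z w ^ N)⁻¹ ≤ C := by
  obtain ⟨C, hC, h⟩ := Ω.exists_tsum_block_tau_le
  obtain ⟨C', hC', h'⟩ := Ω.exists_tsum_freqDist_le hα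
  refine ⟨(d + 1) + (d + 1), C' * C, ENNReal.mul_ne_top hC' hC, fun z => ?_⟩
  rw [ENNReal.tsum_prod']
  refine le_trans (ENNReal.tsum_le_tsum fun l => h (d + 1) z.1 l z.2) ?_
  rw [ENNReal.tsum_mul_right]
  gcongr
  exact h' z.1

/-- The weight of the space `M^{p,q}_{α,β}` on the index set of the frequencies. -/
noncomputable def freqWeight (β : ℝ) (k : ℕ) : ℝ≥0∞ := ENNReal.ofReal (weight β (Ω.freq k))

theorem weight_freq_pos (β : ℝ) (k : ℕ) : 0 < weight β (Ω.freq k) :=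
  Real.rpow_pos_of_pos (by positivity) _

theorem freqWeight_ne_zero (β : ℝ) (k : ℕ) : Ω.freqWeight β k ≠ 0 := by
  simpa [freqWeight] using Ω.weight_freq_pos β k

theorem freqWeight_ne_top (β : ℝ) (k : ℕ) : Ω.freqWeight β k ≠ ∞ := ENNReal.ofReal_ne_top

theorem freqWeight_neg (β : ℝ) (k : ℕ) : Ω.freqWeight (-β) k = (Ω.freqWeight β k)⁻¹ := by
  rw [freqWeight, freqWeight, ← ENNReal.ofReal_inv_of_pos (Ω.weight_freq_pos β k), weight, weight,
    Real.rpow_neg (by positivity)]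

/-- Rapidly decaying kernels act on the mixed sequence spaces. -/
theorem exists_kernel_le (hα : 0 < α) (β : ℝ) : ∃ (N : ℕ) (C : ℝ≥0∞), C ≠ ∞ ∧
    ∀ {p p' q q' : ℝ}, p.HolderConjugate p' → q.HolderConjugate q' →
      ∀ a b : ℕ → (Fin d → ℤ) → ℝ≥0∞,
      (∑' k, ∑' i, ∑' l, ∑' j, ENNReal.ofReal (Ω.tau (k, i) (l, j) ^ N)⁻¹ * (b k i * a l j) ≤
        C * (mixNorm p q (Ω.freqWeight β) a * mixNorm p' q' (Ω.freqWeight (-β)) b)) ∧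
      mixNorm p q (Ω.freqWeight β)
        (fun k i => ∑' l, ∑' j, ENNReal.ofReal (Ω.tau (k, i) (l, j) ^ N)⁻¹ * a l j) ≤
        C * mixNorm p q (Ω.freqWeight β) a := by
  obtain ⟨C, hC, h⟩ := Ω.exists_tsum_block_tau_le
  obtain ⟨C', hC', h'⟩ := Ω.exists_tsum_freqDist_le hα
  obtain ⟨A, m, hA, hm⟩ := Ω.exists_weight_le hα β
  -- The exponent `m + (d + 1) + (d + 1)` used below absorbs the quotient of the weights (`m`), the
  -- sum over frequencies and the sum over positions (`d + 1` each).
  set n : ℕ → ℕ → ℝ≥0∞ := fun k l => ENNReal.ofReal ((1 + Ω.freqDist k l) ^ (m + (d + 1)))⁻¹ * C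
    with hn
  have hn_comm : ∀ k l, n k l = n l k := fun k l => by simp only [hn, Ω.freqDist_comm k l]
  have h1 : ∀ k l i, ∑' j, ENNReal.ofReal (Ω.tau (k, i) (l, j) ^ (m + (d + 1) + (d + 1)))⁻¹ ≤
      n k l := fun k l i => h (m + (d + 1)) k l i
  have h2 : ∀ k l j, ∑' i, ENNReal.ofReal (Ω.tau (k, i) (l, j) ^ (m + (d + 1) + (d + 1)))⁻¹ ≤
      n k l := fun k l j => by
    simp only [fun i => Ω.tau_comm (k, i) (l, j), hn_comm k l]
    exact h1 l k j
  have hw : ∀ k l, n k l * (Ω.freqWeight β k * (Ω.freqWeight β l)⁻¹) ≤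
      ENNReal.ofReal ((1 + Ω.freqDist k l) ^ (d + 1))⁻¹ * (C * ENNReal.ofReal A) := by
    intro k l
    have hD := Ω.freqDist_nonneg k l
    have hwl := Ω.weight_freq_pos β l
    have e : Ω.freqWeight β k * (Ω.freqWeight β l)⁻¹ ≤
        ENNReal.ofReal (A * (1 + Ω.freqDist k l) ^ m) := by
      rw [freqWeight, freqWeight, ← ENNReal.ofReal_inv_of_pos hwl,
        ← ENNReal.ofReal_mul (Ω.weight_freq_pos β k).le]
      apply ENNReal.ofReal_le_ofReal
      rw [← div_eq_mul_inv, div_le_iff₀ hwl]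
      exact hm k l
    calc _ ≤ (ENNReal.ofReal ((1 + Ω.freqDist k l) ^ (m + (d + 1)))⁻¹ * C) *
          ENNReal.ofReal (A * (1 + Ω.freqDist k l) ^ m) := by
          simp only [hn]
          gcongr
      _ = ENNReal.ofReal ((1 + Ω.freqDist k l) ^ (m + (d + 1)))⁻¹ *
          ENNReal.ofReal ((1 + Ω.freqDist k l) ^ m) * (C * ENNReal.ofReal A) := by
          rw [ENNReal.ofReal_mul (by positivity)]
          ring
      _ = _ := by
          rw [← ENNReal.ofReal_mul (by positivity)]
          congr 2
          rw [pow_add]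
          field_simp
  set B : ℝ≥0∞ := C' * (C * ENNReal.ofReal A) with hB
  have hBt : B ≠ ∞ := ENNReal.mul_ne_top hC' (ENNReal.mul_ne_top hC ENNReal.ofReal_ne_top)
  have h3 : ∀ k, ∑' l, n k l * (Ω.freqWeight β k * (Ω.freqWeight β l)⁻¹) ≤ B := by
    intro k
    refine le_trans (ENNReal.tsum_le_tsum fun l => hw k l) ?_
    rw [ENNReal.tsum_mul_right, hB]
    gcongr
    exact h' k
  have h4 : ∀ l, ∑' k, n k l * (Ω.freqWeight β k * (Ω.freqWeight β l)⁻¹) ≤ B := by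
    intro l
    refine le_trans (ENNReal.tsum_le_tsum fun k => hw k l) ?_
    rw [ENNReal.tsum_mul_right, hB]
    gcongr
    simp only [fun k => Ω.freqDist_comm k l]
    exact h' l
  refine ⟨m + (d + 1) + (d + 1), B, hBt, fun {p p' q q'} hp hq a b => ⟨?_, ?_⟩⟩
  · have e : Ω.freqWeight (-β) = fun k => (Ω.freqWeight β k)⁻¹ := funext (Ω.freqWeight_neg β)
    rw [e]
    exact tsum_kernel_le_mixNorm hp hq (Ω.freqWeight_ne_zero β) (Ω.freqWeight_ne_top β)
      (fun k i l j => ENNReal.ofReal (Ω.tau (k, i) (l, j) ^ (m + (d + 1) + (d + 1)))⁻¹) n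
      h1 h2 h3 h4 a b
  · exact mixNorm_kernel_le hp hq (Ω.freqWeight_ne_zero β) (Ω.freqWeight_ne_top β)
      (fun k i l j => ENNReal.ofReal (Ω.tau (k, i) (l, j) ^ (m + (d + 1) + (d + 1)))⁻¹) n
      h1 h2 h3 h4 a

/-- Spatial distances are measured in the widths at the two end points. Replacing one end point
changes the width by a power of `1 + freqDist`, so the triangle inequality holds only up to a power.
-/
theorem exists_tau_triangle (hα : 0 < α) : ∃ (C : ℝ) (m : ℕ), 1 ≤ C ∧ ∀ z w v,
    Ω.tau z v ≤ C * (Ω.tau z w * Ω.tau w v) ^ m := by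
  obtain ⟨C, m, hC, h⟩ := Ω.exists_width_le hα
  refine ⟨4 + 2 * C, m + 1, by linarith, fun z w v => ?_⟩
  set a := Ω.tau z w with ha
  set b := Ω.tau w v with hb
  have ha1 : 1 ≤ a := Ω.one_le_tau z w
  have hb1 : 1 ≤ b := Ω.one_le_tau w v
  set x := ‖Ω.pos z.1 z.2 - Ω.pos w.1 w.2‖ with hx
  set y := ‖Ω.pos w.1 w.2 - Ω.pos v.1 v.2‖ with hy
  have hx0 : 0 ≤ x := norm_nonneg _
  have hy0 : 0 ≤ y := norm_nonneg _
  have hz := (Ω.width_pos z.1).le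
  have hw := (Ω.width_pos w.1).le
  have hv := (Ω.width_pos v.1).le
  have hD1 := Ω.freqDist_nonneg z.1 w.1
  have hD2 := Ω.freqDist_nonneg w.1 v.1
  have t1 : Ω.freqDist z.1 v.1 ≤ (a - 1) + (b - 1) := by
    have := Ω.freqDist_triangle z.1 w.1 v.1
    have := Ω.one_add_freqDist_le_tau z w
    have := Ω.one_add_freqDist_le_tau w v
    linarith
  have t2 : ‖Ω.pos z.1 z.2 - Ω.pos v.1 v.2‖ ≤ x + y := norm_sub_le_norm_sub_add_norm_sub _ _ _
  have p1 : Ω.width z.1 * x ≤ a := by linarith [Ω.width_mul_norm_le_tau z w]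
  have p2 : Ω.width w.1 * x ≤ a := by linarith [Ω.width_mul_norm_le_tau' z w]
  have p3 : Ω.width w.1 * y ≤ b := by linarith [Ω.width_mul_norm_le_tau w v]
  have p4 : Ω.width v.1 * y ≤ b := by linarith [Ω.width_mul_norm_le_tau' w v]
  have hab : 1 ≤ a * b := by nlinarith
  have pow1 : 1 ≤ (a * b) ^ m := one_le_pow₀ hab
  have q1 : Ω.width v.1 * x ≤ C * (a * b) ^ (m + 1) := by
    calc Ω.width v.1 * x ≤ (C * (1 + Ω.freqDist v.1 w.1) ^ m * Ω.width w.1) * x := by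
          gcongr
          exact h v.1 w.1
      _ = C * (1 + Ω.freqDist w.1 v.1) ^ m * (Ω.width w.1 * x) := by
          rw [Ω.freqDist_comm v.1]; ring
      _ ≤ C * (a * b) ^ m * (a * b) := by
          have f1 : (1 + Ω.freqDist w.1 v.1) ^ m ≤ (a * b) ^ m :=
            pow_le_pow_left₀ (by linarith)
              ((Ω.one_add_freqDist_le_tau w v).trans (by nlinarith)) m
          exact mul_le_mul (mul_le_mul_of_nonneg_left f1 (by linarith)) (p2.trans (by nlinarith))
            (by positivity) (by positivity)
      _ = _ := by ring
  have q2 : Ω.width z.1 * y ≤ C * (a * b) ^ (m + 1) := by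
    calc Ω.width z.1 * y ≤ (C * (1 + Ω.freqDist z.1 w.1) ^ m * Ω.width w.1) * y := by
          gcongr
          exact h z.1 w.1
      _ = C * (1 + Ω.freqDist z.1 w.1) ^ m * (Ω.width w.1 * y) := by ring
      _ ≤ C * (a * b) ^ m * (a * b) := by
          have f1 : (1 + Ω.freqDist z.1 w.1) ^ m ≤ (a * b) ^ m :=
            pow_le_pow_left₀ (by linarith)
              ((Ω.one_add_freqDist_le_tau z w).trans (by nlinarith)) m
          exact mul_le_mul (mul_le_mul_of_nonneg_left f1 (by linarith)) (p3.trans (by nlinarith))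
            (by positivity) (by positivity)
      _ = _ := by ring
  have q3 : a + b ≤ 2 * (a * b) ^ (m + 1) := by
    have : a * b ≤ (a * b) ^ (m + 1) := le_self_pow₀ hab (by omega)
    nlinarith
  calc Ω.tau z v ≤ 1 + ((a - 1) + (b - 1)) + (Ω.width z.1 + Ω.width v.1) * (x + y) := by
        rw [tau]
        gcongr
    _ ≤ _ := by linarith

/-- For every lattice point there is a slowly varying function that is comparable, up to powers,
to the quasi-distance from it. -/
theorem exists_slowly_varying (hα : 0 < α) :
    ∃ (E : ℕ × (Fin d → ℤ) → ℕ × (Fin d → ℤ) → ℝ) (C : ℝ) (m : ℕ),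
    1 ≤ C ∧ (∀ z₀ z, 1 ≤ E z₀ z) ∧ (∀ z, E z z = 1) ∧
    (∀ z₀ z w, |E z₀ z - E z₀ w| ≤ C * Ω.tau z w) ∧ ∀ z₀ z, Ω.tau z₀ z ≤ C * E z₀ z ^ m := by
  obtain ⟨C, m, hC, h⟩ := Ω.exists_width_le hα
  set X : ℕ × (Fin d → ℤ) → ℕ × (Fin d → ℤ) → ℝ := fun z₀ z =>
    Ω.width z₀.1 * ‖Ω.pos z₀.1 z₀.2 - Ω.pos z.1 z.2‖ with hX
  -- Moving from `z` to `w` changes `X z₀` by at most `C * E^m * tau z w`, the factor `E^m` coming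
  -- from the change of width. The root of order `m + 1` compensates for this factor: `E^(m+1) + C
  -- E^m τ ≤ (E + C τ)^(m+1)`.
  set E : ℕ × (Fin d → ℤ) → ℕ × (Fin d → ℤ) → ℝ := fun z₀ z =>
    max (1 + Ω.freqDist z₀.1 z.1) (X z₀ z ^ (((m + 1 : ℕ) : ℝ)⁻¹)) with hE
  have hX0 : ∀ z₀ z, 0 ≤ X z₀ z := fun z₀ z => by
    have := (Ω.width_pos z₀.1).le
    simp only [hX]
    positivity
  have hE1 : ∀ z₀ z, 1 ≤ E z₀ z := fun z₀ z =>
    le_trans (by linarith [Ω.freqDist_nonneg z₀.1 z.1]) (le_max_left _ _)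
  have hED : ∀ z₀ z, 1 + Ω.freqDist z₀.1 z.1 ≤ E z₀ z := fun z₀ z => le_max_left _ _
  have hEX : ∀ z₀ z, X z₀ z ≤ E z₀ z ^ (m + 1) := fun z₀ z => by
    have h1 : X z₀ z ^ (((m + 1 : ℕ) : ℝ)⁻¹) ≤ E z₀ z := le_max_right _ _
    have h2 := pow_le_pow_left₀ (Real.rpow_nonneg (hX0 z₀ z) _) h1 (m + 1)
    rwa [← Real.rpow_natCast, ← Real.rpow_mul (hX0 z₀ z), inv_mul_cancel₀ (by positivity),
      Real.rpow_one] at h2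
  have key : ∀ z₀ z w, E z₀ w ≤ E z₀ z + C * Ω.tau z w := by
    intro z₀ z w
    have ht := Ω.one_le_tau z w
    have hz := hE1 z₀ z
    refine max_le ?_ ?_
    · have := Ω.freqDist_triangle z₀.1 z.1 w.1
      have := Ω.one_add_freqDist_le_tau z w
      have := hED z₀ z
      nlinarith
    · have h1 : X z₀ w ≤ (E z₀ z + C * Ω.tau z w) ^ (m + 1) := by
        have hw0 := (Ω.width_pos z₀.1).le
        have hw1 := (Ω.width_pos z.1).le
        have hD := Ω.freqDist_nonneg z₀.1 z.1
        calc X z₀ w ≤ Ω.width z₀.1 * (‖Ω.pos z₀.1 z₀.2 - Ω.pos z.1 z.2‖ +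
                ‖Ω.pos z.1 z.2 - Ω.pos w.1 w.2‖) := by
              simp only [hX]
              gcongr
              exact norm_sub_le_norm_sub_add_norm_sub _ _ _
          _ = X z₀ z + Ω.width z₀.1 * ‖Ω.pos z.1 z.2 - Ω.pos w.1 w.2‖ := by
              simp only [hX]; ring
          _ ≤ E z₀ z ^ (m + 1) + C * (1 + Ω.freqDist z₀.1 z.1) ^ m *
                (Ω.width z.1 * ‖Ω.pos z.1 z.2 - Ω.pos w.1 w.2‖) := by
              refine add_le_add (hEX z₀ z) ?_
              rw [← mul_assoc]
              gcongr
              exact h z₀.1 z.1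
          _ ≤ E z₀ z ^ (m + 1) + C * E z₀ z ^ m * Ω.tau z w := by
              gcongr
              · exact hED z₀ z
              · linarith [Ω.width_mul_norm_le_tau z w]
          _ = E z₀ z ^ m * (E z₀ z + C * Ω.tau z w) := by ring
          _ ≤ (E z₀ z + C * Ω.tau z w) ^ m * (E z₀ z + C * Ω.tau z w) := by
              gcongr
              nlinarith
          _ = _ := by ring
      have h2 := Real.rpow_le_rpow (hX0 z₀ w) h1 (by positivity : 0 ≤ ((m + 1 : ℕ) : ℝ)⁻¹)
      rwa [Real.pow_rpow_inv_natCast (by nlinarith) (by omega)] at h2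
  -- The exponent is `m` for passing from the width at `z` to the width at `z₀`, plus `m + 1` for `X
  -- ≤ E ^ (m + 1)`.
  refine ⟨E, 2 + C, 2 * m + 1, by linarith, hE1, fun z => ?_, fun z₀ z w => ?_, fun z₀ z => ?_⟩
  · have : ((m + 1 : ℕ) : ℝ)⁻¹ ≠ 0 := by positivity
    simp only [hE, hX, freqDist, sub_self, norm_zero, add_zero, mul_zero]
    rw [Real.zero_rpow this]
    norm_num
  · have h1 := key z₀ z w
    have h2 := key z₀ w z
    rw [Ω.tau_comm w z] at h2
    have := Ω.one_le_tau z w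
    rw [abs_le]
    constructor <;> nlinarith
  · have hE0 := hE1 z₀ z
    have h1 : E z₀ z ≤ E z₀ z ^ (2 * m + 1) := le_self_pow₀ hE0 (by omega)
    have h2 : X z₀ z ≤ E z₀ z ^ (2 * m + 1) :=
      (hEX z₀ z).trans (pow_le_pow_right₀ hE0 (by omega))
    have h3 : Ω.width z.1 * ‖Ω.pos z₀.1 z₀.2 - Ω.pos z.1 z.2‖ ≤ C * E z₀ z ^ (2 * m + 1) := by
      have hD := Ω.freqDist_nonneg z₀.1 z.1
      have := hX0 z₀ z
      calc _ ≤ (C * (1 + Ω.freqDist z.1 z₀.1) ^ m * Ω.width z₀.1) *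
              ‖Ω.pos z₀.1 z₀.2 - Ω.pos z.1 z.2‖ := by
            gcongr
            exact h z.1 z₀.1
        _ = C * (1 + Ω.freqDist z₀.1 z.1) ^ m * X z₀ z := by
            rw [Ω.freqDist_comm z.1, hX]; ring
        _ ≤ C * E z₀ z ^ m * E z₀ z ^ (m + 1) := by
            gcongr
            · exact hED z₀ z
            · exact hEX z₀ z
        _ = _ := by ring
    have h4 := hED z₀ z
    calc Ω.tau z₀ z = (1 + Ω.freqDist z₀.1 z.1) + X z₀ z +
          Ω.width z.1 * ‖Ω.pos z₀.1 z₀.2 - Ω.pos z.1 z.2‖ := by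
          simp only [tau, hX]; ring
      _ ≤ _ := by linarith

theorem exists_norm_freq_rpow_le_pow (hα : 0 < α) (γ : ℝ) : ∃ (C : ℝ) (m : ℕ), 0 ≤ C ∧ ∀ k,
    ‖Ω.freq k‖ ^ γ ≤ C * (1 + ‖Ω.freq k‖) ^ m := by
  obtain ⟨r, hr, hrk⟩ := Ω.exists_le_norm_freq hα
  rcases le_total 0 γ with h | h
  · refine ⟨1, ⌈γ⌉₊, zero_le_one, fun k => ?_⟩
    rw [one_mul, ← Real.rpow_natCast]
    calc ‖Ω.freq k‖ ^ γ ≤ (1 + ‖Ω.freq k‖) ^ γ :=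
          Real.rpow_le_rpow (norm_nonneg _) (by linarith) h
      _ ≤ _ := Real.rpow_le_rpow_of_exponent_le (by linarith [norm_nonneg (Ω.freq k)])
          (Nat.le_ceil _)
  · refine ⟨r ^ γ, 0, by positivity, fun k => ?_⟩
    rw [pow_zero, mul_one]
    exact Real.rpow_le_rpow_of_nonpos hr (hrk k) h

/-- For a fixed base point, `tau` and `(1 + |x|)(1 + |ξ|)` bound each other polynomially; this
direction and `exists_tau_le_norm` translate between decay over the lattice and decay of Schwartz
type. -/
theorem exists_norm_le_tau (hα : 0 < α) (z₀ : ℕ × (Fin d → ℤ)) : ∃ (C : ℝ) (m : ℕ), 0 ≤ C ∧ ∀ z,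
    (1 + ‖Ω.pos z.1 z.2‖) * (1 + ‖Ω.freq z.1‖) ≤ C * Ω.tau z z₀ ^ m := by
  obtain ⟨C, m, hC, h⟩ := Ω.exists_weight_le hα 1
  have hw := Ω.width_pos z₀.1
  refine ⟨(1 + ‖Ω.pos z₀.1 z₀.2‖ + (Ω.width z₀.1)⁻¹) * (C * (1 + ‖Ω.freq z₀.1‖)), m + 1,
    by positivity, fun z => ?_⟩
  have ht := Ω.one_le_tau z z₀
  have hD := Ω.freqDist_nonneg z.1 z₀.1
  have h1 : 1 + ‖Ω.freq z.1‖ ≤ C * Ω.tau z z₀ ^ m * (1 + ‖Ω.freq z₀.1‖) := by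
    have := h z.1 z₀.1
    simp only [weight, Real.rpow_one] at this
    refine this.trans ?_
    gcongr
    exact Ω.one_add_freqDist_le_tau z z₀
  have h2 : ‖Ω.pos z.1 z.2‖ ≤ ‖Ω.pos z₀.1 z₀.2‖ + (Ω.width z₀.1)⁻¹ * Ω.tau z z₀ := by
    have h3 := Ω.width_mul_norm_le_tau' z z₀
    have h4 : ‖Ω.pos z.1 z.2 - Ω.pos z₀.1 z₀.2‖ ≤ (Ω.width z₀.1)⁻¹ * Ω.tau z z₀ := by
      rw [inv_mul_eq_div, le_div_iff₀ hw]
      linarith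
    have := norm_sub_norm_le (Ω.pos z.1 z.2) (Ω.pos z₀.1 z₀.2)
    linarith
  have h3 : 1 + ‖Ω.pos z.1 z.2‖ ≤ (1 + ‖Ω.pos z₀.1 z₀.2‖ + (Ω.width z₀.1)⁻¹) * Ω.tau z z₀ := by
    have := norm_nonneg (Ω.pos z₀.1 z₀.2)
    nlinarith
  calc _ ≤ ((1 + ‖Ω.pos z₀.1 z₀.2‖ + (Ω.width z₀.1)⁻¹) * Ω.tau z z₀) *
        (C * Ω.tau z z₀ ^ m * (1 + ‖Ω.freq z₀.1‖)) := by gcongr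
    _ = _ := by ring

theorem exists_tau_le_norm (hα : 0 < α) (z₀ : ℕ × (Fin d → ℤ)) : ∃ (C : ℝ) (m : ℕ), 0 ≤ C ∧ ∀ z,
    Ω.tau z z₀ ≤ C * ((1 + ‖Ω.pos z.1 z.2‖) * (1 + ‖Ω.freq z.1‖)) ^ m := by
  obtain ⟨A, a, hA, h1⟩ := Ω.exists_norm_freq_rpow_le_pow hα α
  obtain ⟨B, b, hB, h2⟩ := Ω.exists_norm_freq_rpow_le_pow hα (1 - α)
  set c₀ := ‖Ω.freq z₀.1‖ ^ α with hc
  have hc0 : 0 ≤ c₀ := by positivity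
  set w₀ := Ω.width z₀.1 with hw
  have hw0 : 0 < w₀ := Ω.width_pos _
  set x₀ := ‖Ω.pos z₀.1 z₀.2‖ with hx
  have hx0 : 0 ≤ x₀ := norm_nonneg _
  refine ⟨(1 + c₀ + A) + (B + w₀) * (1 + x₀), a + b + 1, by positivity, fun z => ?_⟩
  set X := 1 + ‖Ω.pos z.1 z.2‖ with hX
  set Y := 1 + ‖Ω.freq z.1‖ with hY
  have hX1 : 1 ≤ X := by linarith [norm_nonneg (Ω.pos z.1 z.2)]
  have hY1 : 1 ≤ Y := by linarith [norm_nonneg (Ω.freq z.1)]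
  have hXY : 1 ≤ X * Y := by nlinarith
  have hYX : Y ≤ X * Y := by nlinarith
  have hXX : X ≤ X * Y := by nlinarith
  have p1 : Ω.freqDist z.1 z₀.1 ≤ A * Y ^ a + c₀ := by
    refine (norm_sub_le _ _).trans ?_
    rw [norm_radialPow α (Ω.freq_ne_zero _), norm_radialPow α (Ω.freq_ne_zero _)]
    exact add_le_add (h1 z.1) le_rfl
  have p2 : ‖Ω.pos z.1 z.2 - Ω.pos z₀.1 z₀.2‖ ≤ (1 + x₀) * X := by
    have := norm_sub_le (Ω.pos z.1 z.2) (Ω.pos z₀.1 z₀.2)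
    nlinarith
  have p3 : Ω.width z.1 ≤ B * Y ^ b := h2 z.1
  have k1 : Y ^ a ≤ (X * Y) ^ (a + b + 1) :=
    (pow_le_pow_left₀ (by linarith) hYX a).trans (pow_le_pow_right₀ hXY (by omega))
  have k2 : Y ^ b ≤ (X * Y) ^ b := pow_le_pow_left₀ (by linarith) hYX b
  have k3 : 1 ≤ (X * Y) ^ (a + b + 1) := one_le_pow₀ hXY
  have k4 : (X * Y) ^ b * (X * Y) ≤ (X * Y) ^ (a + b + 1) := by
    rw [← pow_succ]
    exact pow_le_pow_right₀ hXY (by omega)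
  have k5 : 1 ≤ (X * Y) ^ b := one_le_pow₀ hXY
  calc Ω.tau z z₀ ≤ 1 + (A * Y ^ a + c₀) + (B * Y ^ b + w₀) * ((1 + x₀) * X) := by
        rw [tau]
        gcongr
    _ ≤ 1 + (A * (X * Y) ^ (a + b + 1) + c₀) +
        (B * (X * Y) ^ b + w₀ * (X * Y) ^ b) * ((1 + x₀) * (X * Y)) := by
        gcongr
        exact le_mul_of_one_le_right hw0.le k5
    _ = 1 + (A * (X * Y) ^ (a + b + 1) + c₀) +
        (B + w₀) * (1 + x₀) * ((X * Y) ^ b * (X * Y)) := by ring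
    _ ≤ 1 * (X * Y) ^ (a + b + 1) + (A * (X * Y) ^ (a + b + 1) + c₀ * (X * Y) ^ (a + b + 1)) +
        (B + w₀) * (1 + x₀) * (X * Y) ^ (a + b + 1) := by
        gcongr
        · linarith
        · exact le_mul_of_one_le_right hc0 k3
    _ = _ := by ring

end PhaseLattice

end Subdyadic

namespace Subdyadic

/-! ### Commutators with a family of operators -/

section commutators

variable {𝓐 I : Type*} [NormedRing 𝓐]

/-- The commutator of families with a fixed family. -/
def adFamily (e x : I → 𝓐) : I → 𝓐 := fun i => e i * x i - x i * e i

/-- The iterated commutators up to order `n` of a family are uniformly bounded. -/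
def BddOrder (e : I → 𝓐) : ℕ → (I → 𝓐) → Prop
  | 0, x => ∃ C, ∀ i, ‖x i‖ ≤ C
  | n + 1, x => (∃ C, ∀ i, ‖x i‖ ≤ C) ∧ BddOrder e n (adFamily e x)

theorem BddOrder.bdd {e : I → 𝓐} {n : ℕ} {x : I → 𝓐} (h : BddOrder e n x) :
    ∃ C, ∀ i, ‖x i‖ ≤ C := by
  cases n with
  | zero => exact h
  | succ n => exact h.1

theorem BddOrder.of_succ {e : I → 𝓐} {n : ℕ} {x : I → 𝓐} (h : BddOrder e (n + 1) x) :
    BddOrder e n x := by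
  induction n generalizing x with
  | zero => exact h.1
  | succ n ih => exact ⟨h.1, ih h.2⟩

theorem BddOrder.iterate {e : I → 𝓐} {n : ℕ} {x : I → 𝓐} (h : BddOrder e n x) :
    ∃ C, ∀ i, ‖((adFamily e)^[n] x) i‖ ≤ C := by
  induction n generalizing x with
  | zero => exact h
  | succ n ih => exact ih h.2

theorem bddOrder_of_forall {e : I → 𝓐} {x : I → 𝓐}
    (h : ∀ n, ∃ C, ∀ i, ‖((adFamily e)^[n] x) i‖ ≤ C) (n : ℕ) : BddOrder e n x := by
  induction n generalizing x with
  | zero => exact h 0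
  | succ n ih => exact ⟨h 0, ih fun m => h (m + 1)⟩

theorem BddOrder.add {e : I → 𝓐} {n : ℕ} {x y : I → 𝓐} (hx : BddOrder e n x)
    (hy : BddOrder e n y) : BddOrder e n (x + y) := by
  have aux : ∀ {x y : I → 𝓐}, (∃ C, ∀ i, ‖x i‖ ≤ C) → (∃ C, ∀ i, ‖y i‖ ≤ C) →
      ∃ C, ∀ i, ‖(x + y) i‖ ≤ C := by
    rintro x y ⟨C, hC⟩ ⟨D, hD⟩
    exact ⟨C + D, fun i => (norm_add_le _ _).trans (add_le_add (hC i) (hD i))⟩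
  induction n generalizing x y with
  | zero => exact aux hx hy
  | succ n ih =>
    refine ⟨aux hx.1 hy.1, ?_⟩
    have : adFamily e (x + y) = adFamily e x + adFamily e y := by
      funext i
      simp only [adFamily, Pi.add_apply]
      noncomm_ring
    rw [this]
    exact ih hx.2 hy.2

theorem BddOrder.neg {e : I → 𝓐} {n : ℕ} {x : I → 𝓐} (hx : BddOrder e n x) :
    BddOrder e n (-x) := by
  induction n generalizing x with
  | zero =>
    obtain ⟨C, hC⟩ := hx
    exact ⟨C, fun i => by simpa using hC i⟩
  | succ n ih =>
    obtain ⟨C, hC⟩ := hx.1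
    refine ⟨⟨C, fun i => by simpa using hC i⟩, ?_⟩
    have : adFamily e (-x) = -adFamily e x := by
      funext i
      simp only [adFamily, Pi.neg_apply]
      noncomm_ring
    rw [this]
    exact ih hx.2

/-- Commutation with `e` is a derivation, so the Leibniz rule gives the induction step. -/
theorem BddOrder.mul {e : I → 𝓐} {n : ℕ} {x y : I → 𝓐} (hx : BddOrder e n x)
    (hy : BddOrder e n y) : BddOrder e n (x * y) := by
  have aux : ∀ {x y : I → 𝓐}, (∃ C, ∀ i, ‖x i‖ ≤ C) → (∃ C, ∀ i, ‖y i‖ ≤ C) →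
      ∃ C, ∀ i, ‖(x * y) i‖ ≤ C := by
    rintro x y ⟨C, hC⟩ ⟨D, hD⟩
    refine ⟨C * D, fun i => (norm_mul_le _ _).trans ?_⟩
    exact mul_le_mul (hC i) (hD i) (norm_nonneg _) ((norm_nonneg _).trans (hC i))
  induction n generalizing x y with
  | zero => exact aux hx hy
  | succ n ih =>
    refine ⟨aux hx.1 hy.1, ?_⟩
    have : adFamily e (x * y) = adFamily e x * y + x * adFamily e y := by
      funext i
      simp only [adFamily, Pi.add_apply, Pi.mul_apply]
      noncomm_ring
    rw [this]
    exact (ih hx.2 hy.of_succ).add (ih hx.of_succ hy.2)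

theorem bddOrder_one (e : I → 𝓐) (n : ℕ) : BddOrder e n 1 := by
  have hz : ∀ n, BddOrder e n 0 := by
    intro n
    induction n with
    | zero => exact ⟨0, fun i => by simp⟩
    | succ n ih =>
      refine ⟨⟨0, fun i => by simp⟩, ?_⟩
      have : adFamily e 0 = 0 := by
        funext i
        simp [adFamily]
      rwa [this]
  cases n with
  | zero => exact ⟨‖(1 : 𝓐)‖, fun i => le_rfl⟩
  | succ n =>
    refine ⟨⟨‖(1 : 𝓐)‖, fun i => le_rfl⟩, ?_⟩
    have : adFamily e 1 = 0 := by
      funext i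
      simp [adFamily]
    rw [this]
    exact hz n

/-- If the iterated commutators of `g` with a family are uniformly bounded, then so are those of
a generalized inverse `h` of `g` and of the idempotent `p = g h`. -/
theorem bddOrder_pseudoinverse {e : I → 𝓐} {g h p : 𝓐} (hg : ∀ n, BddOrder e n fun _ => g)
    (hpg : p * g = g) (hgp : g * p = g) (hgh : g * h = p) (hhg : h * g = p) (hph : p * h = h)
    (hhp : h * p = h) (n : ℕ) : (BddOrder e n fun _ => p) ∧ BddOrder e n fun _ => h := by
  induction n with
  | zero => exact ⟨⟨‖p‖, fun _ => le_rfl⟩, ⟨‖h‖, fun _ => le_rfl⟩⟩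
  | succ n ih =>
    obtain ⟨ip, ih⟩ := ih
    have hg' : BddOrder e n (adFamily e fun _ => g) := (hg (n + 1)).2
    set P : I → 𝓐 := fun _ => p
    set H : I → 𝓐 := fun _ => h
    set G : I → 𝓐 := fun _ => g
    have i1 : BddOrder e n (1 + -P) := (bddOrder_one e n).add ip.neg
    have hpp : p * p = p := by
      nth_rewrite 2 [← hgh]
      rw [← mul_assoc, hpg, hgh]
    -- With `δ` the commutator, `δp = h δ(g) (1 - p) + (1 - p) δ(g) h`. Bounds of order `n` for `p`
    -- and `h` thus give bounds of order `n` for `δp`, that is, order `n + 1` for `p`.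
    have eP : adFamily e P = H * adFamily e G * (1 + -P) + (1 + -P) * adFamily e G * H := by
      funext i
      change e i * p - p * e i = h * (e i * g - g * e i) * (1 + -p) +
        (1 + -p) * (e i * g - g * e i) * h
      have e1 : h * (e i * g - g * e i) * (1 + -p) = p * (e i * p) - p * e i := by
        calc _ = h * e i * (g - g * p) - (h * g) * e i * (1 + -p) := by noncomm_ring
          _ = _ := by rw [hgp, hhg]; noncomm_ring
      have e2 : (1 + -p) * (e i * g - g * e i) * h = e i * p - p * (e i * p) := by
        calc _ = (1 + -p) * e i * (g * h) - (g - p * g) * e i * h := by noncomm_ring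
          _ = _ := by rw [hpg, hgh]; noncomm_ring
      rw [e1, e2]
      noncomm_ring
    have bP : BddOrder e n (adFamily e P) := by
      rw [eP]
      exact ((ih.mul hg').mul i1).add ((i1.mul hg').mul ih)
    -- This replaces `δ(g⁻¹) = -g⁻¹ δ(g) g⁻¹`; the two additional terms account for the range of `p`
    -- not being invariant under `e`.
    have eH : adFamily e H = adFamily e P * H + -(H * adFamily e G * H) +
        H * adFamily e P * (1 + -P) := by
      funext i
      change e i * h - h * e i = (e i * p - p * e i) * h + -(h * (e i * g - g * e i) * h) +
        h * (e i * p - p * e i) * (1 + -p)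
      have e1 : (e i * p - p * e i) * h = e i * h - p * (e i * h) := by
        rw [sub_mul, mul_assoc, hph, mul_assoc]
      have e2 : h * (e i * g - g * e i) * h = h * e i * p - p * (e i * h) := by
        calc _ = h * e i * (g * h) - (h * g) * (e i * h) := by noncomm_ring
          _ = _ := by rw [hgh, hhg]
      have e3 : h * (e i * p - p * e i) * (1 + -p) = h * e i * p - h * e i := by
        calc _ = h * e i * (p - p * p) - (h * p) * e i * (1 + -p) := by noncomm_ring
          _ = _ := by rw [hpp, hhp]; noncomm_ring
      rw [e1, e2, e3]
      noncomm_ring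
    have bH : BddOrder e n (adFamily e H) := by
      rw [eH]
      exact ((bP.mul ih).add ((ih.mul hg').mul ih).neg).add ((ih.mul bP).mul i1)
    exact ⟨⟨ip.bdd, bP⟩, ⟨ih.bdd, bH⟩⟩

end commutators

/-! ### Operators on `ℓ²` -/

section operators

variable {Λ : Type*}

/-- The Hilbert space of square summable families. -/
abbrev Ltwo (Λ : Type*) : Type _ := lp (fun _ : Λ => ℂ) 2

/-- The entries of an operator on `ℓ²`. -/
noncomputable def entry [DecidableEq Λ] (T : Ltwo Λ →L[ℂ] Ltwo Λ) (z w : Λ) : ℂ :=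
  T (lp.single 2 w 1) z

theorem hasSum_single_smul [DecidableEq Λ] (f : Ltwo Λ) :
    HasSum (fun w => f w • (lp.single 2 w 1 : Ltwo Λ)) f := by
  have h := lp.hasSum_single (by simp) f
  refine h.congr_fun fun w => ?_
  rw [← lp.single_smul, smul_eq_mul, mul_one]

theorem hasSum_entry [DecidableEq Λ] (T : Ltwo Λ →L[ℂ] Ltwo Λ) (f : Ltwo Λ) (z : Λ) :
    HasSum (fun w => entry T z w * f w) (T f z) := by
  have h := (hasSum_single_smul f).mapL ((lp.evalCLM ℂ (fun _ : Λ => ℂ) (p := 2) z).comp T)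
  refine h.congr_fun fun w => ?_
  rw [map_smul, smul_eq_mul, mul_comm]
  rfl

theorem lpSum_enorm (f : Ltwo Λ) : lpSum 2 (fun z => ‖f z‖ₑ) = ‖f‖ₑ := by
  have h := lp.norm_rpow_eq_tsum (p := 2) (by simp) f
  have hs := (lp.memℓp f).summable (by simp)
  simp only [ENNReal.toReal_ofNat] at h hs
  have e : ∑' z, ‖f z‖ₑ ^ (2 : ℝ) = ‖f‖ₑ ^ (2 : ℝ) := by
    rw [← ofReal_norm, ENNReal.ofReal_rpow_of_nonneg (norm_nonneg _) (by norm_num), h,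
      ENNReal.ofReal_tsum_of_nonneg (fun z => by positivity) hs]
    refine tsum_congr fun z => ?_
    rw [← ofReal_norm, ENNReal.ofReal_rpow_of_nonneg (norm_nonneg _) (by norm_num)]
  rw [lpSum, e, ← ENNReal.rpow_mul]
  norm_num

theorem holderConjugate_two : Real.HolderConjugate 2 2 := by
  rw [Real.holderConjugate_iff]
  norm_num

/-- Schur's test for operators on `ℓ²`. -/
theorem norm_le_of_entry [DecidableEq Λ] (T : Ltwo Λ →L[ℂ] Ltwo Λ) {C : ℝ≥0}
    (h1 : ∀ z, ∑' w, ‖entry T z w‖ₑ ≤ C) (h2 : ∀ w, ∑' z, ‖entry T z w‖ₑ ≤ C) : ‖T‖ ≤ C := by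
  refine T.opNorm_le_bound C.coe_nonneg fun f => ?_
  have hT : ∀ z, ‖T f z‖ₑ ≤ ∑' w, ‖entry T z w‖ₑ * ‖f w‖ₑ := by
    intro z
    rw [← (hasSum_entry T f z).tsum_eq]
    refine (enorm_tsum_le_tsum_enorm).trans_eq (tsum_congr fun w => enorm_mul _ _)
  have key := tsum_kernel_le holderConjugate_two (fun z w => ‖entry T z w‖ₑ) h1 h2
    (fun z => ‖T f z‖ₑ) (fun w => ‖f w‖ₑ)
  rw [lpSum_enorm, lpSum_enorm] at key
  -- The bilinear estimate is tested with `T f` itself, and one factor `‖T f‖` is cancelled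
  -- afterwards.
  have h3 : ‖T f‖ₑ * ‖T f‖ₑ ≤ ‖T f‖ₑ * (C * ‖f‖ₑ) := by
    have e : ‖T f‖ₑ * ‖T f‖ₑ = ∑' z, ‖T f z‖ₑ * ‖T f z‖ₑ := by
      nth_rewrite 1 2 [← lpSum_enorm]
      rw [lpSum, ← ENNReal.rpow_add_of_nonneg _ _ (by norm_num) (by norm_num)]
      norm_num
      exact tsum_congr fun z => sq _
    rw [e]
    calc ∑' z, ‖T f z‖ₑ * ‖T f z‖ₑ ≤ ∑' z, ‖T f z‖ₑ * ∑' w, ‖entry T z w‖ₑ * ‖f w‖ₑ := by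
          gcongr with z
          exact hT z
      _ = ∑' z, ∑' w, ‖entry T z w‖ₑ * (‖T f z‖ₑ * ‖f w‖ₑ) := by
          refine tsum_congr fun z => ?_
          rw [← ENNReal.tsum_mul_left]
          exact tsum_congr fun w => by ring
      _ ≤ _ := key
      _ = _ := by ring
  by_cases h0 : ‖T f‖ₑ = 0
  · rw [enorm_eq_zero] at h0
    rw [h0, norm_zero]
    positivity
  · have h4 := (ENNReal.mul_le_mul_iff_right h0 enorm_ne_top).mp h3
    rw [← ofReal_norm, ← ofReal_norm, ← ENNReal.ofReal_coe_nnreal,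
      ← ENNReal.ofReal_mul C.coe_nonneg] at h4
    exact (ENNReal.ofReal_le_ofReal_iff (by positivity)).mp h4

/-- The diagonal operator of a bounded sequence. -/
noncomputable def diagOp (e : Λ → ℝ) (R : ℝ) (h : ∀ z, |e z| ≤ R) : Ltwo Λ →L[ℂ] Ltwo Λ :=
  have bound : ∀ (f : Ltwo Λ) (z : Λ), ‖(e z : ℂ) * f z‖ ≤ ‖((R : ℂ) • f) z‖ := fun f z => by
    have hR : |R| = R := abs_of_nonneg ((abs_nonneg _).trans (h z))
    rw [lp.coeFn_smul, Pi.smul_apply, smul_eq_mul, norm_mul, norm_mul, Complex.norm_real,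
      Complex.norm_real, Real.norm_eq_abs, Real.norm_eq_abs, hR]
    exact mul_le_mul_of_nonneg_right (h z) (norm_nonneg _)
  LinearMap.mkContinuous
    { toFun := fun f => ⟨fun z => (e z : ℂ) * f z,
        (lp.memℓp ((R : ℂ) • f)).mono' (bound f)⟩
      map_add' := fun f g => by
        ext z
        exact mul_add _ _ _
      map_smul' := fun c f => by
        ext z
        simp [mul_left_comm] } ‖(R : ℂ)‖ (fun f => by
      rw [← norm_smul]
      exact lp.norm_mono (by simp) (bound f))

theorem diagOp_apply (e : Λ → ℝ) (R : ℝ) (h : ∀ z, |e z| ≤ R) (f : Ltwo Λ) (z : Λ) :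
    diagOp e R h f z = e z * f z := rfl

/-- A diagonal operator acts on the left and on the right by scalars on each entry. Iterated
commutators therefore multiply entries by powers of `e z - e w`, which is how they record
off-diagonal decay. -/
theorem entry_commutator [DecidableEq Λ] (e : Λ → ℝ) (R : ℝ) (h : ∀ z, |e z| ≤ R)
    (T : Ltwo Λ →L[ℂ] Ltwo Λ) (z w : Λ) :
    entry (diagOp e R h * T - T * diagOp e R h) z w = (e z - e w : ℝ) * entry T z w := by
  have h1 : diagOp e R h (lp.single 2 w 1) = (e w : ℂ) • (lp.single 2 w 1 : Ltwo Λ) := by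
    ext v
    rw [diagOp_apply, lp.coeFn_smul, Pi.smul_apply, smul_eq_mul]
    by_cases hv : v = w
    · subst hv
      rfl
    · rw [lp.single_apply_ne _ _ _ hv]
      simp
  change diagOp e R h (T (lp.single 2 w 1)) z - T (diagOp e R h (lp.single 2 w 1)) z = _
  rw [h1, map_smul, diagOp_apply, lp.coeFn_smul, Pi.smul_apply, smul_eq_mul, entry]
  push_cast
  ring

theorem norm_entry_le [DecidableEq Λ] (T : Ltwo Λ →L[ℂ] Ltwo Λ) (z w : Λ) :
    ‖entry T z w‖ ≤ ‖T‖ := by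
  refine (lp.norm_apply_le_norm (by simp) _ z).trans ((T.le_opNorm _).trans ?_)
  rw [lp.norm_single (by simp)]
  simp

end operators

end Subdyadic

namespace Subdyadic

/-! ### Analysis operator, Gram matrix and canonical dual of a frame. -/

section frames

variable {Λ X : Type*} [NormedAddCommGroup X] [InnerProductSpace ℂ X] [CompleteSpace X]

/-- The analysis operator of a frame. -/
theorem exists_analysis_operator (φ : Λ → X) {A B : ℝ} (hA : 0 < A) (hB : 0 < B)
    (h : ∀ f : X, ENNReal.ofReal A * ‖f‖ₑ ^ 2 ≤ ∑' z, ‖inner ℂ (φ z) f‖ₑ ^ 2 ∧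
      ∑' z, ‖inner ℂ (φ z) f‖ₑ ^ 2 ≤ ENNReal.ofReal B * ‖f‖ₑ ^ 2) :
    ∃ V : X →L[ℂ] Ltwo Λ, (∀ f z, V f z = inner ℂ (φ z) f) ∧ IsUnit (V.adjoint ∘L V) := by
  have conv : ∀ f : X, ∀ z, ‖inner ℂ (φ z) f‖ₑ ^ 2 = ENNReal.ofReal (‖inner ℂ (φ z) f‖ ^ 2) := by
    intro f z
    rw [← ofReal_norm, ENNReal.ofReal_pow (norm_nonneg _)]
  have hs : ∀ f : X, Summable fun z => ‖inner ℂ (φ z) f‖ ^ 2 := by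
    intro f
    have h1 : ∑' z, ‖inner ℂ (φ z) f‖ₑ ^ 2 ≠ ∞ :=
      ne_top_of_le_ne_top (ENNReal.mul_ne_top (by simp) (by simp)) (h f).2
    simp only [conv] at h1
    have h2 := ENNReal.summable_toReal h1
    refine h2.congr fun z => ?_
    rw [ENNReal.toReal_ofReal (by positivity)]
  have hmem : ∀ f : X, Memℓp (fun z => inner ℂ (φ z) f) 2 := by
    intro f
    refine memℓp_gen ((hs f).congr fun z => ?_)
    simp
  have hsum : ∀ f : X, ENNReal.ofReal (∑' z, ‖inner ℂ (φ z) f‖ ^ 2) =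
      ∑' z, ‖inner ℂ (φ z) f‖ₑ ^ 2 := by
    intro f
    rw [ENNReal.ofReal_tsum_of_nonneg (fun z => by positivity) (hs f)]
    exact tsum_congr fun z => (conv f z).symm
  have hf : ∀ f : X, ‖f‖ₑ ^ 2 = ENNReal.ofReal (‖f‖ ^ 2) := fun f => by
    rw [← ofReal_norm, ENNReal.ofReal_pow (norm_nonneg _)]
  have hn : ∀ f : X, ‖(⟨fun z => inner ℂ (φ z) f, hmem f⟩ : Ltwo Λ)‖ ^ 2 =
      ∑' z, ‖inner ℂ (φ z) f‖ ^ 2 := by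
    intro f
    have := lp.norm_rpow_eq_tsum (p := 2) (by simp) (⟨fun z => inner ℂ (φ z) f, hmem f⟩ : Ltwo Λ)
    simp only [ENNReal.toReal_ofNat] at this
    exact_mod_cast this
  have hup : ∀ f : X, ‖(⟨fun z => inner ℂ (φ z) f, hmem f⟩ : Ltwo Λ)‖ ^ 2 ≤ B * ‖f‖ ^ 2 := by
    intro f
    rw [hn, ← ENNReal.ofReal_le_ofReal_iff (by positivity), hsum, ENNReal.ofReal_mul hB.le, ← hf]
    exact (h f).2
  have hlow : ∀ f : X, A * ‖f‖ ^ 2 ≤ ‖(⟨fun z => inner ℂ (φ z) f, hmem f⟩ : Ltwo Λ)‖ ^ 2 := by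
    intro f
    rw [hn, ← ENNReal.ofReal_le_ofReal_iff (tsum_nonneg fun z => by positivity), hsum,
      ENNReal.ofReal_mul hA.le, ← hf]
    exact (h f).1
  let V : X →L[ℂ] Ltwo Λ := LinearMap.mkContinuous
    { toFun := fun f => ⟨fun z => inner ℂ (φ z) f, hmem f⟩
      map_add' := fun f g => by
        ext z
        exact inner_add_right _ _ _
      map_smul' := fun c f => by
        ext z
        exact inner_smul_right _ _ _ } (Real.sqrt B) (fun f => by
      refine (sq_le_sq₀ (norm_nonneg _) (by positivity)).mp ?_
      rw [mul_pow, Real.sq_sqrt hB.le]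
      exact hup f)
  refine ⟨V, fun f z => rfl, ?_⟩
  -- The lower frame bound says that the frame operator is coercive.
  refine ContinuousLinearMap.isUnit_of_forall_le_norm_inner_map _ (c := ⟨A, hA.le⟩) hA fun f => ?_
  change ‖f‖ ^ 2 * A ≤ ‖inner ℂ (V.adjoint (V f)) f‖
  rw [ContinuousLinearMap.adjoint_inner_left, inner_self_eq_norm_sq_to_K, mul_comm]
  refine (hlow f).trans (le_of_eq ?_)
  rw [norm_pow, RCLike.norm_ofReal, abs_of_nonneg (norm_nonneg _)]
  rfl

theorem entry_adjoint [DecidableEq Λ] (T : Ltwo Λ →L[ℂ] Ltwo Λ) (z w : Λ) :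
    entry T.adjoint w z = starRingEnd ℂ (entry T z w) := by
  have h1 := lp.inner_single_left (𝕜 := ℂ) w (1 : ℂ) (T.adjoint (lp.single 2 z 1))
  have h2 := lp.inner_single_right (𝕜 := ℂ) z (1 : ℂ) (T (lp.single 2 w 1))
  rw [ContinuousLinearMap.adjoint_inner_right] at h1
  simp only [RCLike.inner_apply, map_one, mul_one, one_mul] at h1 h2
  rw [entry, entry, ← h1, h2]

theorem adjoint_single [DecidableEq Λ] (φ : Λ → X) (V : X →L[ℂ] Ltwo Λ)
    (hV : ∀ f z, V f z = inner ℂ (φ z) f) (z : Λ) : V.adjoint (lp.single 2 z 1) = φ z := by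
  refine ext_inner_right ℂ fun f => ?_
  rw [ContinuousLinearMap.adjoint_inner_left, lp.inner_single_left, hV]
  simp

theorem hasSum_adjoint (φ : Λ → X) (V : X →L[ℂ] Ltwo Λ)
    (hV : ∀ f z, V f z = inner ℂ (φ z) f) (b : Ltwo Λ) :
    HasSum (fun z => b z • φ z) (V.adjoint b) := by
  classical
  refine ((hasSum_single_smul b).mapL V.adjoint).congr_fun fun z => ?_
  rw [map_smul, adjoint_single φ V hV]

/-- The Gram matrix of a frame, its generalized inverse, the projection onto its range and the
dual frame. -/
theorem exists_gram_operators [DecidableEq Λ] (φ : Λ → X) (V : X →L[ℂ] Ltwo Λ)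
    (hV : ∀ f z, V f z = inner ℂ (φ z) f) (hu : IsUnit (V.adjoint ∘L V)) :
    ∃ (g h p : Ltwo Λ →L[ℂ] Ltwo Λ) (ψ : Λ → X),
      (∀ z w, entry g z w = inner ℂ (φ z) (φ w)) ∧
      (p * g = g ∧ g * p = g ∧ g * h = p ∧ h * g = p ∧ p * h = h ∧ h * p = h) ∧
      (∀ z w, entry h w z = starRingEnd ℂ (entry h z w)) ∧
      (∀ z w, entry p w z = starRingEnd ℂ (entry p z w)) ∧
      (∀ u : X, HasSum (fun z => (h (V u)) z • φ z) u) ∧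
      (∀ w, HasSum (fun z => entry p z w • φ z) (φ w)) ∧
      (∀ w, HasSum (fun z => entry h z w • φ z) (ψ w)) ∧
      ∀ z w, inner ℂ (φ z) (ψ w) = entry p z w := by
  obtain ⟨⟨S, R, hSR, hRS⟩, hS⟩ := hu
  change S = _ at hS
  have sr : ∀ x, S (R x) = x := fun x => congrArg (fun T : X →L[ℂ] X => T x) hSR
  have rs : ∀ x, R (S x) = x := fun x => congrArg (fun T : X →L[ℂ] X => T x) hRS
  have vv : ∀ x, V.adjoint (V x) = S x := fun x => by rw [hS]; rfl
  have hSadj : S.adjoint = S := by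
    rw [hS, ContinuousLinearMap.adjoint_comp, ContinuousLinearMap.adjoint_adjoint]
  have hRadj : R.adjoint = R := by
    ext x
    refine ext_inner_right ℂ fun y => ?_
    calc inner ℂ (R.adjoint x) y = inner ℂ x (R y) := ContinuousLinearMap.adjoint_inner_left _ _ _
      _ = inner ℂ (S (R x)) (R y) := by rw [sr]
      _ = inner ℂ (S.adjoint (R x)) (R y) := by rw [hSadj]
      _ = inner ℂ (R x) (S (R y)) := ContinuousLinearMap.adjoint_inner_left _ _ _
      _ = _ := by rw [sr]
  -- With `S = V* V` and `R = S⁻¹`, the Gram matrix is `V V*`, the projection onto its range is `V R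
  -- V*`, and the generalized inverse is `V R² V*`. Then `h V u = V R u` is the family of canonical
  -- dual coefficients of `u`, and `R φ_w` are the dual vectors.
  set g : Ltwo Λ →L[ℂ] Ltwo Λ := V ∘L V.adjoint with hg
  set p : Ltwo Λ →L[ℂ] Ltwo Λ := V ∘L R ∘L V.adjoint with hp
  set h : Ltwo Λ →L[ℂ] Ltwo Λ := V ∘L R ∘L R ∘L V.adjoint with hh
  have ag : ∀ x, g x = V (V.adjoint x) := fun x => rfl
  have ap : ∀ x, p x = V (R (V.adjoint x)) := fun x => rfl
  have ah : ∀ x, h x = V (R (R (V.adjoint x))) := fun x => rfl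
  refine ⟨g, h, p, fun w => R (φ w), fun z w => ?_, ⟨?_, ?_, ?_, ?_, ?_, ?_⟩, fun z w => ?_,
    fun z w => ?_, fun u => ?_, fun w => ?_, fun w => ?_, fun z w => ?_⟩
  · rw [entry, ag, adjoint_single φ V hV, hV]
  · ext1 x
    change p (g x) = g x
    rw [ag, ap, vv, rs]
  · ext1 x
    change g (p x) = g x
    rw [ag, ap, vv, sr, ag]
  · ext1 x
    change g (h x) = p x
    rw [ag, ah, vv, sr, ap]
  · ext1 x
    change h (g x) = p x
    rw [ag, ah, vv, rs, ap]
  · ext1 x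
    change p (h x) = h x
    rw [ap, ah, vv, rs]
  · ext1 x
    change h (p x) = h x
    rw [ap, ah, vv, rs, ah]
  · rw [← entry_adjoint]
    congr 1
    rw [hh]
    simp only [ContinuousLinearMap.adjoint_comp, ContinuousLinearMap.adjoint_adjoint, hRadj]
    rfl
  · rw [← entry_adjoint]
    congr 1
    rw [hp]
    simp only [ContinuousLinearMap.adjoint_comp, ContinuousLinearMap.adjoint_adjoint, hRadj]
    rfl
  · have e : V.adjoint (h (V u)) = u := by rw [ah, vv, vv, rs, sr]
    have := hasSum_adjoint φ V hV (h (V u))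
    rwa [e] at this
  · have e : V.adjoint (p (lp.single 2 w 1)) = φ w := by rw [ap, vv, sr, adjoint_single φ V hV]
    have := hasSum_adjoint φ V hV (p (lp.single 2 w 1))
    rw [e] at this
    exact this
  · have e : V.adjoint (h (lp.single 2 w 1)) = R (φ w) := by
      rw [ah, vv, sr, adjoint_single φ V hV]
    have := hasSum_adjoint φ V hV (h (lp.single 2 w 1))
    rw [e] at this
    exact this
  · rw [entry, ap, adjoint_single φ V hV, hV]

end frames

/-! ### The Wiener-type lemma: generalized inverses of localized matrices are localized. -/

section localization

variable {d : ℕ} {α : ℝ} (Ω : PhaseLattice d α)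

/-- Rapid off-diagonal decay of a matrix over the lattice. -/
def PhaseLattice.Rapid (M : ℕ × (Fin d → ℤ) → ℕ × (Fin d → ℤ) → ℂ) : Prop :=
  ∀ N : ℕ, ∃ C : ℝ, ∀ z w, ‖M z w‖ * Ω.tau z w ^ N ≤ C

theorem PhaseLattice.Rapid.le {M : ℕ × (Fin d → ℤ) → ℕ × (Fin d → ℤ) → ℂ} {Ω : PhaseLattice d α}
    (hM : Ω.Rapid M) (N : ℕ) : ∃ C : ℝ≥0, ∀ z w, ‖M z w‖ ≤ C * (Ω.tau z w ^ N)⁻¹ := by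
  obtain ⟨C, hC⟩ := hM N
  refine ⟨C.toNNReal, fun z w => ?_⟩
  have := pow_pos (Ω.tau_pos z w) N
  rw [← div_eq_mul_inv, le_div_iff₀ this]
  exact (hC z w).trans (Real.le_coe_toNNReal C)

/-- The inverse of a localized Gram matrix is localized. -/
theorem PhaseLattice.rapid_pseudoinverse (hα : 0 < α)
    {g h p : Ltwo (ℕ × (Fin d → ℤ)) →L[ℂ] Ltwo (ℕ × (Fin d → ℤ))}
    (hgr : Ω.Rapid (entry g))
    (hpg : p * g = g) (hgp : g * p = g) (hgh : g * h = p) (hhg : h * g = p) (hph : p * h = h)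
    (hhp : h * p = h) : Ω.Rapid (entry p) ∧ Ω.Rapid (entry h) := by
  obtain ⟨E, A, m, hA, hE1, hEz, hEL, hEt⟩ := Ω.exists_slowly_varying hα
  obtain ⟨N₀, S, hS, hSum⟩ := Ω.exists_tsum_tau_le hα
  -- The index is a base point together with a truncation level. Truncation makes the diagonal
  -- operators bounded without changing the Lipschitz constant, so the commutator bounds are uniform
  -- in both.
  set c : (ℕ × (Fin d → ℤ)) × ℕ → (ℕ × (Fin d → ℤ)) → ℝ := fun i z => min (E i.1 z) i.2 with hc
  have hcb : ∀ i z, |c i z| ≤ i.2 := fun i z => by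
    have : 0 ≤ c i z := le_min (zero_le_one.trans (hE1 i.1 z)) (Nat.cast_nonneg _)
    rw [abs_of_nonneg this]
    exact min_le_right _ _
  have hcL : ∀ i z w, |c i z - c i w| ≤ A * Ω.tau z w := fun i z w => by
    refine (abs_min_sub_min_le_max _ _ _ _).trans ?_
    rw [sub_self, abs_zero, max_eq_left (abs_nonneg _)]
    exact hEL i.1 z w
  set e : (ℕ × (Fin d → ℤ)) × ℕ → (Ltwo (ℕ × (Fin d → ℤ)) →L[ℂ] Ltwo (ℕ × (Fin d → ℤ))) :=
    fun i => diagOp (c i) i.2 (hcb i) with he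
  have hent : ∀ (T : Ltwo (ℕ × (Fin d → ℤ)) →L[ℂ] Ltwo (ℕ × (Fin d → ℤ))) (n : ℕ) i z w,
      entry (((adFamily e)^[n] fun _ => T) i) z w = ((c i z - c i w) ^ n : ℝ) * entry T z w := by
    intro T n i z w
    induction n with
    | zero => simp
    | succ n ih =>
      rw [Function.iterate_succ_apply', adFamily, entry_commutator, ih]
      push_cast
      ring
  have hg : ∀ n, BddOrder e n fun _ => g := by
    refine fun n => bddOrder_of_forall (fun n => ?_) n
    -- The `n` powers cancel those from the commutators, and `N₀` powers remain for Schur's test.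
    obtain ⟨C, hC⟩ := hgr.le (n + N₀)
    have key : ∀ i z w, ‖entry (((adFamily e)^[n] fun _ => g) i) z w‖ₑ ≤
        ENNReal.ofReal (A ^ n * C) * ENNReal.ofReal (Ω.tau z w ^ N₀)⁻¹ := by
      intro i z w
      have ht := Ω.tau_pos z w
      rw [hent, ← ofReal_norm, ← ENNReal.ofReal_mul (by positivity)]
      apply ENNReal.ofReal_le_ofReal
      rw [norm_mul, Complex.norm_real, norm_pow, Real.norm_eq_abs]
      calc |c i z - c i w| ^ n * ‖entry g z w‖
          ≤ (A * Ω.tau z w) ^ n * (C * (Ω.tau z w ^ (n + N₀))⁻¹) := by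
            gcongr
            · exact hcL i z w
            · exact hC z w
        _ = _ := by
            rw [pow_add, mul_pow]
            field_simp
    have hBt : ENNReal.ofReal (A ^ n * C) * S ≠ ∞ := ENNReal.mul_ne_top (by simp) hS
    refine ⟨(ENNReal.ofReal (A ^ n * C) * S).toNNReal, fun i => ?_⟩
    refine norm_le_of_entry _ (fun z => ?_) (fun w => ?_)
    · rw [ENNReal.coe_toNNReal hBt]
      refine (ENNReal.tsum_le_tsum fun w => key i z w).trans ?_
      rw [ENNReal.tsum_mul_left]
      gcongr
      exact hSum z
    · rw [ENNReal.coe_toNNReal hBt]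
      refine (ENNReal.tsum_le_tsum fun z => key i z w).trans ?_
      rw [ENNReal.tsum_mul_left]
      gcongr
      simp only [fun z => Ω.tau_comm z w]
      exact hSum w
  have main : ∀ T : Ltwo (ℕ × (Fin d → ℤ)) →L[ℂ] Ltwo (ℕ × (Fin d → ℤ)),
      (∀ n, BddOrder e n fun _ => T) → Ω.Rapid (entry T) := by
    intro T hT N
    obtain ⟨C, hC⟩ := (hT (m * N)).iterate
    refine ⟨A ^ N * (2 ^ (m * N) * (C + ‖T‖)), fun z w => ?_⟩
    have h1 : (E w z - 1) ^ (m * N) * ‖entry T z w‖ ≤ C := by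
      -- With base point `w` and this level, the truncation is inactive at both `z` and `w`, and `E
      -- w w = 1`; the entry is thus multiplied by `(E w z - 1) ^ (m * N)`.
      have h2 := (norm_entry_le _ z w).trans (hC (w, ⌈E w z⌉₊))
      rw [hent] at h2
      have h3 : c (w, ⌈E w z⌉₊) z = E w z := min_eq_left (Nat.le_ceil _)
      have h4 : c (w, ⌈E w z⌉₊) w = 1 := by
        simp only [hc, hEz]
        apply min_eq_left
        exact (hE1 w z).trans (Nat.le_ceil _)
      rw [h3, h4, norm_mul, Complex.norm_real, norm_pow, Real.norm_of_nonneg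
        (by linarith [hE1 w z])] at h2
      exact h2
    have h5 : E w z ^ (m * N) ≤ 2 ^ (m * N) * ((E w z - 1) ^ (m * N) + 1) := by
      have := hE1 w z
      rcases le_total (E w z - 1) 1 with hle | hle
      · calc E w z ^ (m * N) ≤ 2 ^ (m * N) := pow_le_pow_left₀ (by linarith) (by linarith) _
          _ ≤ _ := le_mul_of_one_le_right (by positivity) (by
            have : 0 ≤ (E w z - 1) ^ (m * N) := pow_nonneg (by linarith) _
            linarith)
      · calc E w z ^ (m * N) ≤ (2 * (E w z - 1)) ^ (m * N) :=
              pow_le_pow_left₀ (by linarith) (by linarith) _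
          _ = 2 ^ (m * N) * (E w z - 1) ^ (m * N) := mul_pow _ _ _
          _ ≤ _ := by gcongr; linarith
    have h6 : ‖entry T z w‖ * E w z ^ (m * N) ≤ 2 ^ (m * N) * (C + ‖T‖) := by
      calc ‖entry T z w‖ * E w z ^ (m * N)
          ≤ ‖entry T z w‖ * (2 ^ (m * N) * ((E w z - 1) ^ (m * N) + 1)) := by gcongr
        _ = 2 ^ (m * N) * ((E w z - 1) ^ (m * N) * ‖entry T z w‖ + ‖entry T z w‖) := by ring
        _ ≤ _ := by
          gcongr
          exact norm_entry_le T z w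
    calc ‖entry T z w‖ * Ω.tau z w ^ N ≤ ‖entry T z w‖ * (A * E w z ^ m) ^ N := by
          gcongr
          · exact (Ω.tau_pos z w).le
          · rw [Ω.tau_comm]
            exact hEt w z
      _ = A ^ N * (‖entry T z w‖ * E w z ^ (m * N)) := by
          rw [mul_pow, ← pow_mul]; ring
      _ ≤ _ := by gcongr
  have hb := bddOrder_pseudoinverse hg hpg hgp hgh hhg hph hhp
  exact ⟨main p fun n => (hb n).1, main h fun n => (hb n).2⟩

/-- The canonical dual of a localized frame is localized. -/
theorem PhaseLattice.exists_localized_dual {X : Type*} [NormedAddCommGroup X]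
    [InnerProductSpace ℂ X] [CompleteSpace X] (hα : 0 < α) (φ : ℕ × (Fin d → ℤ) → X) {A B : ℝ}
    (hA : 0 < A) (hB : 0 < B)
    (hφ : ∀ f : X, ENNReal.ofReal A * ‖f‖ₑ ^ 2 ≤ ∑' z, ‖inner ℂ (φ z) f‖ₑ ^ 2 ∧
      ∑' z, ‖inner ℂ (φ z) f‖ₑ ^ 2 ≤ ENNReal.ofReal B * ‖f‖ₑ ^ 2)
    (hG : Ω.Rapid fun z w => inner ℂ (φ z) (φ w)) :
    ∃ (H P : ℕ × (Fin d → ℤ) → ℕ × (Fin d → ℤ) → ℂ) (ψ : ℕ × (Fin d → ℤ) → X),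
      Ω.Rapid H ∧ Ω.Rapid P ∧ (∀ z w, H w z = starRingEnd ℂ (H z w)) ∧
      (∀ z w, P w z = starRingEnd ℂ (P z w)) ∧
      (∀ u : X, ∃ b : ℕ × (Fin d → ℤ) → ℂ,
        (∀ z, HasSum (fun w => H z w * inner ℂ (φ w) u) (b z)) ∧ HasSum (fun z => b z • φ z) u) ∧
      (∀ w, HasSum (fun z => P z w • φ z) (φ w)) ∧
      (∀ w, HasSum (fun z => H z w • φ z) (ψ w)) ∧ ∀ z w, inner ℂ (φ z) (ψ w) = P z w := by
  obtain ⟨V, hV, hu⟩ := exists_analysis_operator φ hA hB hφ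
  obtain ⟨g, h, p, ψ, h1, ⟨hpg, hgp, hgh, hhg, hph, hhp⟩, h2, h3, h4, h5, h6, h7⟩ :=
    exists_gram_operators φ V hV hu
  have hgr : Ω.Rapid (entry g) := by
    intro N
    obtain ⟨C, hC⟩ := hG N
    exact ⟨C, fun z w => by rw [h1]; exact hC z w⟩
  obtain ⟨hp, hh⟩ := Ω.rapid_pseudoinverse hα hgr hpg hgp hgh hhg hph hhp
  refine ⟨entry h, entry p, ψ, hh, hp, h2, h3, fun u => ⟨fun z => h (V u) z, fun z => ?_, h4 u⟩,
    h5, h6, h7⟩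
  simp only [← hV]
  exact hasSum_entry h (V u) z

end localization

end Subdyadic

namespace Subdyadic

/-! ### Decay of Schwartz functions and scaled integrals. -/

section decay

variable {d : ℕ}

theorem exists_seminorm_decay (d n : ℕ) : ∃ q : Seminorm ℂ 𝓢(Rd d, ℂ), Continuous q ∧
    ∀ u t, (1 + ‖t‖) ^ n * ‖u t‖ ≤ q u := by
  refine ⟨(2 ^ n : ℝ≥0) • (Finset.Iic (n, 0)).sup (schwartzSeminormFamily ℂ (Rd d) ℂ), ?_,
    fun u t => ?_⟩
  · have h : Continuous ((Finset.Iic (n, 0)).sup (schwartzSeminormFamily ℂ (Rd d) ℂ) :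
        Seminorm ℂ 𝓢(Rd d, ℂ)) := Seminorm.continuous_finsetSup fun i _ =>
        (schwartz_withSeminorms ℂ (Rd d) ℂ).continuous_seminorm i
    exact h.const_smul (2 ^ n : ℝ≥0)
  · have := one_add_le_sup_seminorm_apply (𝕜 := ℂ) (m := (n, 0)) le_rfl le_rfl u t
    rw [norm_iteratedFDeriv_zero] at this
    exact this

theorem integral_comp_smul_sub {E : Type*} [NormedAddCommGroup E] [NormedSpace ℝ E] (f : Rd d → E)
    {s : ℝ} (hs : 0 < s) (x : Rd d) : ∫ t, f (s • (t - x)) = (s ^ d)⁻¹ • ∫ t, f t := by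
  rw [integral_sub_right_eq_self (fun t => f (s • t)), Measure.integral_comp_smul,
    finrank_euclideanSpace_fin, abs_of_nonneg (by positivity)]

theorem integrable_inv_one_add_norm_pow (d : ℕ) :
    Integrable fun t : Rd d => ((1 + ‖t‖) ^ (d + 1))⁻¹ := by
  have h := integrable_one_add_norm (E := Rd d) (μ := volume) (r := (d + 1 : ℕ)) (by simp)
  refine h.congr (Filter.Eventually.of_forall fun t => ?_)
  simp only
  rw [Real.rpow_neg (by positivity), Real.rpow_natCast]

theorem norm_integral_le_of_decay {E : Type*} [NormedAddCommGroup E] [NormedSpace ℝ E]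
    {f : Rd d → E} {C s : ℝ} (hs : 0 < s) (x : Rd d)
    (h : ∀ t, ‖f t‖ ≤ C * ((1 + s * ‖t - x‖) ^ (d + 1))⁻¹) :
    ‖∫ t, f t‖ ≤ C * ((s ^ d)⁻¹ * ∫ t : Rd d, ((1 + ‖t‖) ^ (d + 1))⁻¹) := by
  have e : ∀ t : Rd d, C * ((1 + s * ‖t - x‖) ^ (d + 1))⁻¹ =
      C * (fun y : Rd d => ((1 + ‖y‖) ^ (d + 1))⁻¹) (s • (t - x)) := fun t => by
    simp only [norm_smul, Real.norm_of_nonneg hs.le]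
  have hi : Integrable fun t : Rd d =>
      C * (fun y : Rd d => ((1 + ‖y‖) ^ (d + 1))⁻¹) (s • (t - x)) :=
    ((((integrable_inv_one_add_norm_pow d).comp_smul hs.ne').comp_sub_right x)).const_mul C
  refine (norm_integral_le_of_norm_le hi
    (Filter.Eventually.of_forall fun t => (h t).trans_eq (e t))).trans_eq ?_
  rw [integral_const_mul, integral_comp_smul_sub (fun y : Rd d => ((1 + ‖y‖) ^ (d + 1))⁻¹) hs x,
    smul_eq_mul]

end decay

/-! ### Packets in space and frequency, and their Gram matrix. -/

section packets

variable {d : ℕ} {α : ℝ}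

theorem norm_packet (φ : 𝓢(Rd d, ℂ)) (x ξ : Rd d) (hξ : ξ ≠ 0) (t : Rd d) :
    ‖packet α φ x ξ hξ t‖ =
      ‖ξ‖ ^ ((d : ℝ) / 2 * (1 - α)) * ‖φ (‖ξ‖ ^ (1 - α) • (t - x))‖ := by
  rw [packet_apply, packetFun, norm_mul, norm_mul, Complex.norm_real, mul_comm Complex.I,
    Complex.norm_exp_ofReal_mul_I, mul_one, Real.norm_of_nonneg (by positivity)]

/-- The transform uses the character `e^{2πi·}`, so modulation by `e^{i t·ξ}` is a shift by `ξ /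
(2π)`. Translation contributes only a unimodular factor, and dilation gives the Jacobian. -/
theorem norm_fourier_packet (φ : 𝓢(Rd d, ℂ)) (x ξ : Rd d) (hξ : ξ ≠ 0) (η : Rd d) :
    ‖𝓕 (packet α φ x ξ hξ) η‖ = ‖ξ‖ ^ ((d : ℝ) / 2 * (1 - α)) * ((‖ξ‖ ^ (1 - α)) ^ d)⁻¹ *
      ‖𝓕 φ ((‖ξ‖ ^ (1 - α))⁻¹ • (η - (2 * Real.pi)⁻¹ • ξ))‖ := by
  set s := ‖ξ‖ ^ (1 - α) with hs
  set σ := ‖ξ‖ ^ ((d : ℝ) / 2 * (1 - α)) with hσ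
  have hs0 : 0 < s := Real.rpow_pos_of_pos (norm_pos_iff.mpr hξ) _
  have hσ0 : 0 ≤ σ := by positivity
  set ζ := η - (2 * Real.pi)⁻¹ • ξ with hζ
  rw [fourier_coe, fourier_coe, Real.fourier_eq, Real.fourier_eq]
  have key : ∀ t : Rd d, Real.fourierChar (-inner ℝ t η) • packet α φ x ξ hξ t =
      ((Real.fourierChar (-inner ℝ x ζ) : ℂ) * σ) *
        (fun y : Rd d => Real.fourierChar (-inner ℝ y (s⁻¹ • ζ)) • φ y) (s • (t - x)) := by
    intro t
    have e1 : inner ℝ (s • (t - x)) (s⁻¹ • ζ) = inner ℝ t ζ - inner ℝ x ζ := by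
      rw [inner_smul_left, inner_smul_right, inner_sub_left]
      simp [hs0.ne']
    have e2 : Complex.exp (Complex.I * (inner ℝ t ξ : ℝ)) =
        Real.fourierChar ((2 * Real.pi)⁻¹ * inner ℝ t ξ) := by
      rw [Real.fourierChar_apply]
      congr 1
      push_cast
      have : (Real.pi : ℂ) ≠ 0 := by exact_mod_cast Real.pi_ne_zero
      field_simp
    have e3 : (Real.fourierChar (-inner ℝ t η) : ℂ) *
        Real.fourierChar ((2 * Real.pi)⁻¹ * inner ℝ t ξ) =
        Real.fourierChar (-inner ℝ x ζ) * Real.fourierChar (-(inner ℝ t ζ - inner ℝ x ζ)) := by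
      rw [← Circle.coe_mul, ← Circle.coe_mul, ← AddChar.map_add_eq_mul, ← AddChar.map_add_eq_mul]
      have e4 : inner ℝ t ζ = inner ℝ t η - (2 * Real.pi)⁻¹ * inner ℝ t ξ := by
        rw [hζ, inner_sub_right, inner_smul_right]
      rw [e4]
      ring_nf
    simp only [Circle.smul_def, smul_eq_mul, packet_apply, packetFun, e1]
    rw [e2, ← hσ, ← hs]
    linear_combination (σ * φ (s • (t - x)) : ℂ) * e3
  rw [integral_congr_ae (Filter.Eventually.of_forall key), integral_const_mul,
    integral_comp_smul_sub (fun y : Rd d => Real.fourierChar (-inner ℝ y (s⁻¹ • ζ)) • φ y) hs0 x,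
    norm_mul, norm_mul, Circle.norm_coe, norm_smul, Complex.norm_real,
    Real.norm_of_nonneg hσ0, Real.norm_of_nonneg (by positivity)]
  ring

/-- The packet of the lattice with index `z`. -/
noncomputable def PhaseLattice.atom (Ω : PhaseLattice d α) (φ : 𝓢(Rd d, ℂ))
    (z : ℕ × (Fin d → ℤ)) : 𝓢(Rd d, ℂ) :=
  packet α φ (Ω.pos z.1 z.2) (Ω.freq z.1) (Ω.freq_ne_zero z.1)

variable (Ω : PhaseLattice d α) (φ : 𝓢(Rd d, ℂ))

/-- The amplitude of the packets with frequency index `k`. -/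
noncomputable def PhaseLattice.amp (k : ℕ) : ℝ := ‖Ω.freq k‖ ^ ((d : ℝ) / 2 * (1 - α))

theorem PhaseLattice.amp_pos (k : ℕ) : 0 < Ω.amp k := Real.rpow_pos_of_pos (Ω.norm_freq_pos k) _

/-- The `L²` normalization: the squared amplitude cancels the Jacobian of the dilation. -/
theorem PhaseLattice.amp_mul_amp (k : ℕ) : Ω.amp k * Ω.amp k = Ω.width k ^ d := by
  rw [amp, width, ← Real.rpow_add (Ω.norm_freq_pos k), ← Real.rpow_natCast, ← Real.rpow_mul
    (norm_nonneg _)]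
  congr 1
  ring

theorem PhaseLattice.norm_atom (z : ℕ × (Fin d → ℤ)) (t : Rd d) :
    ‖Ω.atom φ z t‖ = Ω.amp z.1 * ‖φ (Ω.width z.1 • (t - Ω.pos z.1 z.2))‖ :=
  norm_packet φ _ _ _ t

theorem PhaseLattice.exists_norm_atom_le (n : ℕ) : ∃ C : ℝ, 0 ≤ C ∧ ∀ z t,
    ‖Ω.atom φ z t‖ * (1 + Ω.width z.1 * ‖t - Ω.pos z.1 z.2‖) ^ n ≤ C * Ω.amp z.1 := by
  obtain ⟨q, -, hq⟩ := exists_seminorm_decay d n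
  refine ⟨q φ, apply_nonneg q φ, fun z t => ?_⟩
  have h := hq φ (Ω.width z.1 • (t - Ω.pos z.1 z.2))
  have := (Ω.amp_pos z.1).le
  rw [norm_smul, Real.norm_of_nonneg (Ω.width_pos z.1).le] at h
  rw [Ω.norm_atom]
  calc _ = Ω.amp z.1 * ((1 + Ω.width z.1 * ‖t - Ω.pos z.1 z.2‖) ^ n *
        ‖φ (Ω.width z.1 • (t - Ω.pos z.1 z.2))‖) := by ring
    _ ≤ Ω.amp z.1 * q φ := by gcongr
    _ = _ := mul_comm _ _

theorem PhaseLattice.norm_sub_le_of_fourier_atom_ne_zero {c : ℝ}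
    (hc : ∀ ζ, 𝓕 φ ζ ≠ 0 → ‖ζ‖ ≤ c) {z : ℕ × (Fin d → ℤ)} {η : Rd d}
    (h : 𝓕 (Ω.atom φ z) η ≠ 0) :
    ‖η - (2 * Real.pi)⁻¹ • Ω.freq z.1‖ ≤ c * Ω.width z.1 := by
  have hw := Ω.width_pos z.1
  have h1 := norm_fourier_packet (α := α) φ (Ω.pos z.1 z.2) (Ω.freq z.1) (Ω.freq_ne_zero z.1) η
  have h2 : 𝓕 φ ((‖Ω.freq z.1‖ ^ (1 - α))⁻¹ • (η - (2 * Real.pi)⁻¹ • Ω.freq z.1)) ≠ 0 := by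
    intro h0
    rw [h0, norm_zero, mul_zero, norm_eq_zero] at h1
    exact h h1
  have h3 := hc _ h2
  change ‖(Ω.width z.1)⁻¹ • _‖ ≤ c at h3
  rw [norm_smul, norm_inv, Real.norm_of_nonneg hw.le, inv_mul_le_iff₀ hw] at h3
  linarith

theorem one_add_mul_norm_sub_le {s : ℝ} (hs : 0 ≤ s) (x y t : Rd d) :
    1 + s * ‖x - y‖ ≤ (1 + s * ‖t - x‖) * (1 + s * ‖t - y‖) := by
  have h : ‖x - y‖ ≤ ‖t - x‖ + ‖t - y‖ := by
    rw [norm_sub_rev t x]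
    exact norm_sub_le_norm_sub_add_norm_sub _ _ _
  have h1 : s * ‖x - y‖ ≤ s * (‖t - x‖ + ‖t - y‖) := by gcongr
  have h2 : 0 ≤ s * ‖t - x‖ * (s * ‖t - y‖) := by positivity
  nlinarith

/-- The Gram matrix of band-limited packets is localized. -/
theorem PhaseLattice.rapid_gram (hα : 0 < α) {c : ℝ} (hc : ∀ ζ, 𝓕 φ ζ ≠ 0 → ‖ζ‖ ≤ c) :
    Ω.Rapid fun z w => ∫ t, inner ℂ (Ω.atom φ z t) (Ω.atom φ w t) := by
  intro N
  obtain ⟨C₀, hC₀⟩ := Ω.exists_freqDist_le hα (2 * Real.pi * c)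
  obtain ⟨B₀, m, hB₀, hB₀'⟩ := Ω.exists_width_le hα
  -- `N` powers pay for `tau z w ^ N`, and `d + 1` for integrability.
  obtain ⟨A, hA, hA'⟩ := Ω.exists_norm_atom_le φ (N + (d + 1))
  set B : ℝ := B₀ * (1 + |C₀|) ^ m with hB
  have hB1 : 1 ≤ B := one_le_mul_of_one_le_of_one_le hB₀
    (one_le_pow₀ (by linarith [abs_nonneg C₀]))
  set K : ℝ := (1 + |C₀| + (1 + B)) * B with hK
  have hK0 : 0 ≤ K := by positivity
  set I : ℝ := ∫ t : Rd d, ((1 + ‖t‖) ^ (d + 1))⁻¹ with hI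
  have hI0 : 0 ≤ I := integral_nonneg fun t => by positivity
  refine ⟨A * A * K ^ N * B ^ d * I, fun z w => ?_⟩
  -- By Plancherel the entry vanishes if the Fourier transforms have no common point `η` in their
  -- supports. Otherwise such an `η` puts the frequencies at bounded distance, the widths are
  -- comparable, and only spatial decay is needed.
  by_cases h0 : ∀ η, inner ℂ (𝓕 (Ω.atom φ z) η) (𝓕 (Ω.atom φ w) η) = 0
  · have : ∫ t, inner ℂ (Ω.atom φ z t) (Ω.atom φ w t) = 0 := by
      rw [← integral_inner_fourier_fourier, integral_congr_ae (Filter.Eventually.of_forall h0),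
        integral_zero]
    simp only [this, norm_zero, zero_mul]
    positivity
  push Not at h0
  obtain ⟨η, hη⟩ := h0
  have hz := Ω.norm_sub_le_of_fourier_atom_ne_zero φ hc (z := z) (η := η)
    fun h => hη (by rw [h, inner_zero_left])
  have hw := Ω.norm_sub_le_of_fourier_atom_ne_zero φ hc (z := w) (η := η)
    fun h => hη (by rw [h, inner_zero_right])
  have hd : ‖Ω.freq z.1 - Ω.freq w.1‖ ≤ 2 * Real.pi * c * (Ω.width z.1 + Ω.width w.1) := by
    have e : Ω.freq z.1 - Ω.freq w.1 = (2 * Real.pi) • ((η - (2 * Real.pi)⁻¹ • Ω.freq w.1) -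
        (η - (2 * Real.pi)⁻¹ • Ω.freq z.1)) := by
      rw [sub_sub_sub_cancel_left, ← smul_sub, smul_smul, mul_inv_cancel₀ (by positivity), one_smul]
    rw [e, norm_smul, Real.norm_of_nonneg (by positivity), mul_assoc (2 * Real.pi)]
    refine mul_le_mul_of_nonneg_left ((norm_sub_le _ _).trans ?_) (by positivity)
    linarith
  have hf : Ω.freqDist z.1 w.1 ≤ |C₀| := (hC₀ _ _ hd).trans (le_abs_self _)
  have hfn := Ω.freqDist_nonneg z.1 w.1
  have wz := Ω.width_pos z.1
  have ww := Ω.width_pos w.1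
  have h1 : Ω.width z.1 ≤ B * Ω.width w.1 := (hB₀' z.1 w.1).trans (by rw [hB]; gcongr)
  have h2 : Ω.width w.1 ≤ B * Ω.width z.1 := (hB₀' w.1 z.1).trans (by
    rw [hB, Ω.freqDist_comm]; gcongr)
  have htau : ∀ t, Ω.tau z w ≤ K * ((1 + Ω.width z.1 * ‖t - Ω.pos z.1 z.2‖) *
      (1 + Ω.width w.1 * ‖t - Ω.pos w.1 w.2‖)) := by
    intro t
    have t1 := one_add_mul_norm_sub_le wz.le (Ω.pos z.1 z.2) (Ω.pos w.1 w.2) t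
    set D := ‖Ω.pos z.1 z.2 - Ω.pos w.1 w.2‖ with hD
    have hD0 : 0 ≤ D := norm_nonneg _
    have t2 : 1 + Ω.width z.1 * ‖t - Ω.pos w.1 w.2‖ ≤
        B * (1 + Ω.width w.1 * ‖t - Ω.pos w.1 w.2‖) := by
      have := mul_le_mul_of_nonneg_right h1 (norm_nonneg (t - Ω.pos w.1 w.2))
      linarith
    have t3 : Ω.tau z w ≤ (1 + |C₀| + (1 + B)) * (1 + Ω.width z.1 * D) := by
      have := mul_le_mul_of_nonneg_right h2 hD0
      rw [tau, ← hD]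
      have : 0 ≤ Ω.width z.1 * D := by positivity
      nlinarith [abs_nonneg C₀]
    refine t3.trans ?_
    rw [hK, mul_assoc]
    gcongr
    refine t1.trans ?_
    calc _ ≤ (1 + Ω.width z.1 * ‖t - Ω.pos z.1 z.2‖) *
          (B * (1 + Ω.width w.1 * ‖t - Ω.pos w.1 w.2‖)) := by gcongr
      _ = _ := by ring
  have az := Ω.amp_pos z.1
  have aw := Ω.amp_pos w.1
  have ha : Ω.amp w.1 ≤ B ^ d * Ω.amp z.1 := by
    refine (sq_le_sq₀ aw.le (by positivity)).mp ?_
    calc Ω.amp w.1 ^ 2 = Ω.width w.1 ^ d := by rw [sq, Ω.amp_mul_amp]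
      _ ≤ (B * Ω.width z.1) ^ d := by gcongr
      _ = B ^ d * 1 * Ω.amp z.1 ^ 2 := by rw [mul_pow, sq, Ω.amp_mul_amp, mul_one]
      _ ≤ B ^ d * B ^ d * Ω.amp z.1 ^ 2 := by
        gcongr
        exact one_le_pow₀ hB1
      _ = _ := by ring
  have hpt : ∀ t, ‖((Ω.tau z w : ℂ) ^ N) • inner ℂ (Ω.atom φ z t) (Ω.atom φ w t)‖ ≤
      (A * Ω.amp z.1 * (A * Ω.amp w.1) * K ^ N) *
        ((1 + Ω.width z.1 * ‖t - Ω.pos z.1 z.2‖) ^ (d + 1))⁻¹ := by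
    intro t
    have ht0 := (Ω.tau_pos z w).le
    have p1 := hA' z t
    have p2 := hA' w t
    set X := 1 + Ω.width z.1 * ‖t - Ω.pos z.1 z.2‖ with hX
    set Y := 1 + Ω.width w.1 * ‖t - Ω.pos w.1 w.2‖ with hY
    have hX1 : 1 ≤ X := by rw [hX]; linarith [mul_nonneg wz.le (norm_nonneg (t - Ω.pos z.1 z.2))]
    have hY1 : 1 ≤ Y := by rw [hY]; linarith [mul_nonneg ww.le (norm_nonneg (t - Ω.pos w.1 w.2))]
    have hX0 : 0 < X := by linarith
    rw [← div_eq_mul_inv, le_div_iff₀ (by positivity), norm_smul, norm_pow, Complex.norm_real,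
      Real.norm_of_nonneg ht0]
    have p3 : ‖Ω.atom φ w t‖ * Y ^ N ≤ A * Ω.amp w.1 := by
      refine le_trans ?_ p2
      gcongr
      · omega
    calc _ ≤ (K * (X * Y)) ^ N * (‖Ω.atom φ z t‖ * ‖Ω.atom φ w t‖) * X ^ (d + 1) := by
          gcongr
          · exact htau t
          · exact norm_inner_le_norm _ _
      _ = (‖Ω.atom φ z t‖ * X ^ (N + (d + 1))) * (‖Ω.atom φ w t‖ * Y ^ N) * K ^ N := by
          rw [mul_pow, mul_pow, pow_add]; ring_nf
      _ ≤ _ := by gcongr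
  have := norm_integral_le_of_decay wz _ hpt
  rw [integral_smul, norm_smul, norm_pow, Complex.norm_real,
    Real.norm_of_nonneg (Ω.tau_pos z w).le] at this
  rw [mul_comm]
  refine this.trans ?_
  rw [← hI]
  clear_value I K B
  calc A * Ω.amp z.1 * (A * Ω.amp w.1) * K ^ N * ((Ω.width z.1 ^ d)⁻¹ * I)
      = A * A * K ^ N * I * (Ω.amp w.1 * Ω.amp z.1) * (Ω.width z.1 ^ d)⁻¹ := by ring
    _ ≤ A * A * K ^ N * I * (B ^ d * Ω.amp z.1 * Ω.amp z.1) * (Ω.width z.1 ^ d)⁻¹ := by gcongr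
    _ = A * A * K ^ N * B ^ d * I * (Ω.width z.1 ^ d * (Ω.width z.1 ^ d)⁻¹) := by
      rw [← Ω.amp_mul_amp]; ring
    _ = _ := by rw [mul_inv_cancel₀ (by positivity), mul_one]

end packets

end Subdyadic

/-! ### Calculus of polynomial growth. -/

namespace Subdyadic

/-- Domination of a family by a power of `T`. -/
def PolyGrowth {Λ : Type*} (T f : Λ → ℝ) : Prop := ∃ (C : ℝ) (m : ℕ), 0 ≤ C ∧ ∀ z, f z ≤ C * T z ^ m

section growth

variable {Λ : Type*} {T f g : Λ → ℝ}

theorem PolyGrowth.mono (hf : PolyGrowth T f) (h : ∀ z, g z ≤ f z) : PolyGrowth T g := by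
  obtain ⟨C, m, hC, hf⟩ := hf
  exact ⟨C, m, hC, fun z => (h z).trans (hf z)⟩

theorem PolyGrowth.add (hT : ∀ z, 1 ≤ T z) (hf : PolyGrowth T f) (hg : PolyGrowth T g) :
    PolyGrowth T fun z => f z + g z := by
  obtain ⟨C, m, hC, hf⟩ := hf
  obtain ⟨C', m', hC', hg⟩ := hg
  refine ⟨C + C', m + m', by positivity, fun z => ?_⟩
  have h1 : T z ^ m ≤ T z ^ (m + m') := pow_le_pow_right₀ (hT z) (by omega)
  have h2 : T z ^ m' ≤ T z ^ (m + m') := pow_le_pow_right₀ (hT z) (by omega)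
  rw [add_mul]
  exact add_le_add ((hf z).trans (by gcongr)) ((hg z).trans (by gcongr))

theorem PolyGrowth.mul (hT : ∀ z, 1 ≤ T z) (hf : PolyGrowth T f) (hg : PolyGrowth T g)
    (hg0 : ∀ z, 0 ≤ g z) : PolyGrowth T fun z => f z * g z := by
  obtain ⟨C, m, hC, hf⟩ := hf
  obtain ⟨C', m', hC', hg⟩ := hg
  refine ⟨C * C', m + m', by positivity, fun z => ?_⟩
  have hT0 : 0 ≤ T z := zero_le_one.trans (hT z)
  calc f z * g z ≤ (C * T z ^ m) * (C' * T z ^ m') :=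
        mul_le_mul (hf z) (hg z) (hg0 z) (by positivity)
    _ = _ := by rw [pow_add]; ring

theorem PolyGrowth.pow (hT : ∀ z, 1 ≤ T z) (hf : PolyGrowth T f) (hf0 : ∀ z, 0 ≤ f z) (n : ℕ) :
    PolyGrowth T fun z => f z ^ n := by
  induction n with
  | zero => exact ⟨1, 0, zero_le_one, fun z => by simp⟩
  | succ n ih =>
    simp only [pow_succ]
    exact ih.mul hT hf hf0

theorem PolyGrowth.const (c : ℝ) : PolyGrowth T fun _ => c :=
  ⟨|c|, 0, abs_nonneg _, fun z => by simp [le_abs_self]⟩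

theorem PolyGrowth.trans {S : Λ → ℝ} (hf : PolyGrowth T f) (hT : PolyGrowth S T)
    (hT0 : ∀ z, 0 ≤ T z) : PolyGrowth S f := by
  obtain ⟨C, m, hC, hf⟩ := hf
  obtain ⟨C', m', hC', hT⟩ := hT
  refine ⟨C * C' ^ m, m' * m, by positivity, fun z => (hf z).trans ?_⟩
  rw [mul_assoc, pow_mul, ← mul_pow]
  gcongr
  · exact hT0 z
  · exact hT z

end growth

/-! ### Decay of the coefficients of Schwartz functions. -/

namespace PhaseLattice

variable {d : ℕ} {α : ℝ} (Ω : PhaseLattice d α) (φ : 𝓢(Rd d, ℂ))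

theorem polyGrowth_rpow (hα : 0 < α) (γ : ℝ) :
    PolyGrowth (fun k => 1 + ‖Ω.freq k‖) fun k => ‖Ω.freq k‖ ^ γ :=
  Ω.exists_norm_freq_rpow_le_pow hα γ

theorem one_le_one_add_norm_freq (k : ℕ) : 1 ≤ 1 + ‖Ω.freq k‖ := by
  linarith [norm_nonneg (Ω.freq k)]

theorem inv_width (k : ℕ) : (Ω.width k)⁻¹ = ‖Ω.freq k‖ ^ (α - 1) :=
  inv_eq_of_mul_eq_one_right (Ω.width_mul k)

/-- The function and the packet both decay in space. The packet does so at scale `1 / width`, and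
converting this to unit scale costs a power of the frequency. -/
theorem norm_inner_atom_le_of_space (hα : 0 < α) (n : ℕ) : ∃ (q : Seminorm ℂ 𝓢(Rd d, ℂ)) (m : ℕ),
    Continuous q ∧ ∀ u z, (1 + ‖Ω.pos z.1 z.2‖) ^ n * ‖∫ t, inner ℂ (Ω.atom φ z t) (u t)‖ ≤
      q u * (1 + ‖Ω.freq z.1‖) ^ m := by
  obtain ⟨q, hq, hq'⟩ := exists_seminorm_decay d (n + (d + 1))
  obtain ⟨A, hA, hA'⟩ := Ω.exists_norm_atom_le φ n
  set I : ℝ := ∫ t : Rd d, ((1 + ‖t‖) ^ (d + 1))⁻¹ with hI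
  have hI0 : 0 ≤ I := integral_nonneg fun t => by positivity
  have hW : ∀ k, 0 ≤ 1 + (Ω.width k)⁻¹ := fun k => by have := Ω.width_pos k; positivity
  have hpg : PolyGrowth (fun k => 1 + ‖Ω.freq k‖) fun k => Ω.amp k * (1 + (Ω.width k)⁻¹) ^ n := by
    refine PolyGrowth.mul Ω.one_le_one_add_norm_freq (Ω.polyGrowth_rpow hα _) (PolyGrowth.pow
      Ω.one_le_one_add_norm_freq (PolyGrowth.add Ω.one_le_one_add_norm_freq (PolyGrowth.const 1)
      ((Ω.polyGrowth_rpow hα (α - 1)).mono fun k => (Ω.inv_width k).le)) hW n)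
      fun k => pow_nonneg (hW k) n
  obtain ⟨C, m, hC, hm⟩ := hpg
  refine ⟨NNReal.mk (A * C * I) (by positivity) • q, m, hq.const_smul _, fun u z => ?_⟩
  have hw := Ω.width_pos z.1
  have ha := (Ω.amp_pos z.1).le
  have hWz := hW z.1
  have hpt : ∀ t, ‖((1 + ‖Ω.pos z.1 z.2‖ : ℝ) : ℂ) ^ n • inner ℂ (Ω.atom φ z t) (u t)‖ ≤
      (A * (Ω.amp z.1 * (1 + (Ω.width z.1)⁻¹) ^ n) * q u) *
        ((1 + 1 * ‖t - 0‖) ^ (d + 1))⁻¹ := by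
    intro t
    rw [sub_zero, one_mul, ← div_eq_mul_inv, le_div_iff₀ (by positivity), norm_smul, norm_pow,
      Complex.norm_real, Real.norm_of_nonneg (by positivity)]
    have h1 : 1 + ‖Ω.pos z.1 z.2‖ ≤ (1 + (Ω.width z.1)⁻¹) *
        (1 + Ω.width z.1 * ‖t - Ω.pos z.1 z.2‖) * (1 + ‖t‖) := by
      have h2 := one_add_mul_norm_sub_le zero_le_one (Ω.pos z.1 z.2) 0 t
      simp only [sub_zero, one_mul] at h2
      refine h2.trans ?_
      gcongr
      have : (1 + (Ω.width z.1)⁻¹) * (1 + Ω.width z.1 * ‖t - Ω.pos z.1 z.2‖) =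
          1 + ‖t - Ω.pos z.1 z.2‖ + ((Ω.width z.1)⁻¹ + Ω.width z.1 * ‖t - Ω.pos z.1 z.2‖) := by
        field_simp
        ring
      rw [this]
      have : 0 ≤ (Ω.width z.1)⁻¹ + Ω.width z.1 * ‖t - Ω.pos z.1 z.2‖ := by positivity
      linarith
    calc _ ≤ ((1 + (Ω.width z.1)⁻¹) * (1 + Ω.width z.1 * ‖t - Ω.pos z.1 z.2‖) * (1 + ‖t‖)) ^ n *
          (‖Ω.atom φ z t‖ * ‖u t‖) * (1 + ‖t‖) ^ (d + 1) := by
          gcongr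
          exact norm_inner_le_norm _ _
      _ = (1 + (Ω.width z.1)⁻¹) ^ n *
          (‖Ω.atom φ z t‖ * (1 + Ω.width z.1 * ‖t - Ω.pos z.1 z.2‖) ^ n) *
          ((1 + ‖t‖) ^ (n + (d + 1)) * ‖u t‖) := by
          rw [mul_pow, mul_pow, pow_add]; ring
      _ ≤ (1 + (Ω.width z.1)⁻¹) ^ n * (A * Ω.amp z.1) * q u := by
          refine mul_le_mul (mul_le_mul_of_nonneg_left (hA' z t) (by positivity)) (hq' u t)
            (by positivity) (by positivity)
      _ = _ := by ring
  have := norm_integral_le_of_decay one_pos 0 hpt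
  rw [integral_smul, norm_smul, norm_pow, Complex.norm_real,
    Real.norm_of_nonneg (by positivity), one_pow, inv_one, one_mul, ← hI] at this
  refine this.trans ?_
  have hqu : 0 ≤ q u := apply_nonneg q u
  change _ ≤ A * C * I * q u * _
  have hmz := mul_le_mul_of_nonneg_left (hm z.1) (by positivity : 0 ≤ A * q u * I)
  simp only at hmz
  linarith

/-- As `α > 0`, the width `|ξ|^(1-α)` is small compared with `|ξ|` at high frequency, so the Fourier
support of a packet stays at distance comparable to `|ξ|` from the origin. -/
theorem exists_one_add_norm_freq_le (hα : 0 < α) (c : ℝ) : ∃ K : ℝ, 0 ≤ K ∧ ∀ (k : ℕ) (η : Rd d),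
    ‖η - (2 * Real.pi)⁻¹ • Ω.freq k‖ ≤ c * Ω.width k → 1 + ‖Ω.freq k‖ ≤ K * (1 + ‖η‖) := by
  set P : ℝ := 2 * Real.pi with hP
  have hP0 : 0 < P := by positivity
  have hP1 : 1 ≤ P := by linarith [Real.pi_gt_three]
  -- Beyond this threshold the radius `|c| * width` is at most half of `|ξ| / (2π)`.
  set L : ℝ := (2 * P * |c|) ^ α⁻¹ with hL
  have hL0 : 0 ≤ L := by positivity
  refine ⟨1 + L + 2 * P, by positivity, fun k η h => ?_⟩
  have hξ := Ω.norm_freq_pos k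
  rcases le_total ‖Ω.freq k‖ L with hle | hle
  · nlinarith [norm_nonneg η]
  · have h1 : 2 * P * |c| ≤ ‖Ω.freq k‖ ^ α := by
      have := Real.rpow_le_rpow hL0 hle hα.le
      rwa [hL, ← Real.rpow_mul (by positivity), inv_mul_cancel₀ hα.ne', Real.rpow_one] at this
    have h2 : ‖Ω.freq k‖ ^ α * Ω.width k = ‖Ω.freq k‖ := by
      rw [width, ← Real.rpow_add hξ, add_sub_cancel, Real.rpow_one]
    have h3 : 2 * P * |c| * Ω.width k ≤ ‖Ω.freq k‖ := by
      rw [← h2]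
      exact mul_le_mul_of_nonneg_right h1 (Ω.width_pos k).le
    have h4 : ‖P⁻¹ • Ω.freq k‖ ≤ ‖η‖ + |c| * Ω.width k := by
      have h5 := norm_sub_norm_le (P⁻¹ • Ω.freq k) η
      rw [norm_sub_rev] at h5
      have h6 := mul_le_mul_of_nonneg_right (le_abs_self c) (Ω.width_pos k).le
      linarith
    rw [norm_smul, norm_inv, Real.norm_of_nonneg hP0.le, inv_mul_le_iff₀ hP0] at h4
    nlinarith [norm_nonneg η]

/-- By Plancherel the coefficient is an integral over the Fourier support of the packet. There `1 +
|ξ|` is bounded by a multiple of `1 + |η|`, so any power of it is absorbed by the decay of the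
transform of `u`. -/
theorem norm_inner_atom_le_of_freq (hα : 0 < α) {c : ℝ} (hc : ∀ ζ, 𝓕 φ ζ ≠ 0 → ‖ζ‖ ≤ c) (n : ℕ) :
    ∃ q : Seminorm ℂ 𝓢(Rd d, ℂ), Continuous q ∧
      ∀ u z, (1 + ‖Ω.freq z.1‖) ^ n * ‖∫ t, inner ℂ (Ω.atom φ z t) (u t)‖ ≤ q u := by
  obtain ⟨K, hK, hK'⟩ := Ω.exists_one_add_norm_freq_le hα c
  obtain ⟨q₀, -, hq₀⟩ := exists_seminorm_decay d 0
  set I : ℝ := ∫ t : Rd d, ((1 + ‖t‖) ^ (d + 1))⁻¹ with hI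
  have hI0 : 0 ≤ I := integral_nonneg fun t => by positivity
  have hpg : PolyGrowth (fun k => 1 + ‖Ω.freq k‖) fun k => Ω.amp k * (Ω.width k ^ d)⁻¹ := by
    have hW : ∀ k, 0 ≤ (Ω.width k)⁻¹ := fun k => by have := Ω.width_pos k; positivity
    simp only [← inv_pow]
    exact PolyGrowth.mul Ω.one_le_one_add_norm_freq (Ω.polyGrowth_rpow hα _) (PolyGrowth.pow
      Ω.one_le_one_add_norm_freq ((Ω.polyGrowth_rpow hα (α - 1)).mono fun k => (Ω.inv_width k).le)
      hW d) fun k => pow_nonneg (hW k) d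
  obtain ⟨C, m, hC, hm⟩ := hpg
  obtain ⟨q, hq, hq'⟩ := exists_seminorm_decay d (n + m + (d + 1))
  have hq₀' : 0 ≤ q₀ (𝓕 φ) := apply_nonneg _ _
  refine ⟨NNReal.mk (C * K ^ (n + m) * q₀ (𝓕 φ) * I) (by positivity) •
    q.comp (FourierTransform.fourierCLM ℂ 𝓢(Rd d, ℂ)).toLinearMap,
    (hq.comp (FourierTransform.fourierCLM ℂ 𝓢(Rd d, ℂ)).continuous).const_smul _, fun u z => ?_⟩
  set Y := 1 + ‖Ω.freq z.1‖ with hY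
  have hY1 : 1 ≤ Y := Ω.one_le_one_add_norm_freq z.1
  have hY0 : 0 < Y := by linarith
  have ha := (Ω.amp_pos z.1).le
  have hw := Ω.width_pos z.1
  have hpt : ∀ η, ‖(Y : ℂ) ^ n • inner ℂ (𝓕 (Ω.atom φ z) η) (𝓕 u η)‖ ≤
      (C * K ^ (n + m) * q₀ (𝓕 φ) * q (𝓕 u)) * ((1 + 1 * ‖η - 0‖) ^ (d + 1))⁻¹ := by
    intro η
    have hqu : 0 ≤ q (𝓕 u) := apply_nonneg _ _
    rw [sub_zero, one_mul, ← div_eq_mul_inv, le_div_iff₀ (by positivity), norm_smul, norm_pow,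
      Complex.norm_real, Real.norm_of_nonneg hY0.le]
    by_cases h0 : 𝓕 (Ω.atom φ z) η = 0
    · rw [h0, inner_zero_left, norm_zero, mul_zero, zero_mul]
      positivity
    have h1 := hK' _ _ (Ω.norm_sub_le_of_fourier_atom_ne_zero φ hc h0)
    have h2 : ‖𝓕 (Ω.atom φ z) η‖ ≤ C * Y ^ m * q₀ (𝓕 φ) := by
      rw [atom, norm_fourier_packet]
      refine mul_le_mul (hm z.1) ?_ (norm_nonneg _) (by positivity)
      have := hq₀ (𝓕 φ) ((‖Ω.freq z.1‖ ^ (1 - α))⁻¹ • (η - (2 * Real.pi)⁻¹ • Ω.freq z.1))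
      rwa [pow_zero, one_mul] at this
    calc _ ≤ Y ^ n * (C * Y ^ m * q₀ (𝓕 φ) * ‖𝓕 u η‖) * (1 + ‖η‖) ^ (d + 1) := by
          gcongr
          exact (norm_inner_le_norm _ _).trans (by gcongr)
      _ = C * q₀ (𝓕 φ) * Y ^ (n + m) * ‖𝓕 u η‖ * (1 + ‖η‖) ^ (d + 1) := by
          rw [pow_add]; ring
      _ ≤ C * q₀ (𝓕 φ) * (K * (1 + ‖η‖)) ^ (n + m) * ‖𝓕 u η‖ * (1 + ‖η‖) ^ (d + 1) := by
          gcongr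
      _ = C * K ^ (n + m) * q₀ (𝓕 φ) * ((1 + ‖η‖) ^ (n + m + (d + 1)) * ‖𝓕 u η‖) := by
          rw [mul_pow, pow_add]; ring
      _ ≤ _ := by
          gcongr
          exact hq' _ η
  have := norm_integral_le_of_decay one_pos 0 hpt
  rw [integral_smul, norm_smul, norm_pow, Complex.norm_real,
    Real.norm_of_nonneg hY0.le, one_pow, inv_one, one_mul, ← hI,
    integral_inner_fourier_fourier] at this
  refine this.trans (le_of_eq ?_)
  change _ = C * K ^ (n + m) * q₀ (𝓕 φ) * I * q (𝓕 u)
  ring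

/-- The coefficients of Schwartz functions decay rapidly. -/
theorem exists_seminorm_inner_atom_le (hα : 0 < α) {c : ℝ} (hc : ∀ ζ, 𝓕 φ ζ ≠ 0 → ‖ζ‖ ≤ c)
    (z₀ : ℕ × (Fin d → ℤ)) (N : ℕ) : ∃ q : Seminorm ℂ 𝓢(Rd d, ℂ), Continuous q ∧
      ∀ u z, ‖∫ t, inner ℂ (Ω.atom φ z t) (u t)‖ * Ω.tau z z₀ ^ N ≤ q u := by
  obtain ⟨C, r, hC, hr⟩ := Ω.exists_tau_le_norm hα z₀
  set n := r * N with hn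
  obtain ⟨q₁, m, hq₁, h₁⟩ := Ω.norm_inner_atom_le_of_space φ hα (2 * n)
  -- The two estimates are multiplied and a square root is taken, hence `2 * n`; the additional `m`
  -- cancels the loss in frequency of the spatial estimate.
  obtain ⟨q₂, hq₂, h₂⟩ := Ω.norm_inner_atom_le_of_freq φ hα hc (2 * n + m)
  refine ⟨NNReal.mk (C ^ N) (by positivity) • (q₁ + q₂), (hq₁.add hq₂).const_smul _, fun u z => ?_⟩
  have a₁ := h₁ u z
  have a₂ := h₂ u z
  have b₁ : 0 ≤ q₁ u := apply_nonneg _ _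
  have b₂ : 0 ≤ q₂ u := apply_nonneg _ _
  set X := 1 + ‖Ω.pos z.1 z.2‖ with hX
  set Y := 1 + ‖Ω.freq z.1‖ with hY
  have hX0 : 0 < X := by positivity
  have hY0 : 0 < Y := by positivity
  set v := ‖∫ t, inner ℂ (Ω.atom φ z t) (u t)‖ with hv
  have hv0 : 0 ≤ v := norm_nonneg _
  have key : v * (X * Y) ^ n ≤ q₁ u + q₂ u := by
    refine (sq_le_sq₀ (by positivity) (by positivity)).mp ?_
    have h3 : (X ^ (2 * n) * v) * (Y ^ (2 * n + m) * v) ≤ (q₁ u * Y ^ m) * q₂ u :=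
      mul_le_mul a₁ a₂ (by positivity) (by positivity)
    have h4 : (v * (X * Y) ^ n) ^ 2 * Y ^ m ≤ q₁ u * q₂ u * Y ^ m := by
      calc _ = (X ^ (2 * n) * v) * (Y ^ (2 * n + m) * v) := by
            rw [mul_pow, ← pow_mul, mul_pow, pow_add, mul_comm n 2]; ring
        _ ≤ _ := h3
        _ = _ := by ring
    have h5 := le_of_mul_le_mul_right h4 (by positivity)
    nlinarith
  change _ ≤ C ^ N * (q₁ u + q₂ u)
  calc v * Ω.tau z z₀ ^ N ≤ v * (C * (X * Y) ^ r) ^ N := by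
        gcongr
        · exact (Ω.tau_pos z z₀).le
        · exact hr z
    _ = C ^ N * (v * (X * Y) ^ n) := by rw [mul_pow, ← pow_mul]; ring
    _ ≤ _ := by gcongr

end PhaseLattice

end Subdyadic

namespace Subdyadic

/-! ### Schwartz seminorms of packets and series in the Schwartz space. -/

section derivatives

variable {d : ℕ} {α : ℝ}

theorem contDiff_exp_I : ContDiff ℝ (⊤ : ℕ∞) fun θ : ℝ => Complex.exp (Complex.I * θ) :=
  (contDiff_const.mul Complex.ofRealCLM.contDiff).cexp

theorem norm_iteratedFDeriv_exp_inner_le (ξ t : Rd d) (n : ℕ) :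
    ‖iteratedFDeriv ℝ n (fun t : Rd d => Complex.exp (Complex.I * (inner ℝ t ξ : ℝ))) t‖ ≤
      ‖ξ‖ ^ n := by
  have e : (fun t : Rd d => Complex.exp (Complex.I * (inner ℝ t ξ : ℝ))) =
      (fun θ : ℝ => Complex.exp (Complex.I * θ)) ∘ (innerSL ℝ ξ) := by
    funext t
    simp only [Function.comp_apply, innerSL_apply_apply]
    rw [real_inner_comm]
  rw [e, ContinuousLinearMap.iteratedFDeriv_comp_right _ contDiff_exp_I t
    (by exact_mod_cast le_top)]
  refine (ContinuousMultilinearMap.norm_compContinuousLinearMap_le _ _).trans ?_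
  rw [norm_iteratedFDeriv_eq_norm_iteratedDeriv, iteratedDeriv_exp_I, norm_mul, norm_pow,
    Complex.norm_I, mul_comm Complex.I, Complex.norm_exp_ofReal_mul_I]
  simp

theorem norm_iteratedFDeriv_dilate_le (φ : 𝓢(Rd d, ℂ)) {s : ℝ} (hs : 0 ≤ s) (x t : Rd d) (n : ℕ) :
    ‖iteratedFDeriv ℝ n (fun t : Rd d => φ (s • (t - x))) t‖ ≤
      s ^ n * ‖iteratedFDeriv ℝ n φ (s • (t - x))‖ := by
  have h := iteratedFDeriv_comp_sub (𝕜 := ℝ) (f := fun t : Rd d => φ (s • t)) n x t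
  rw [h]
  have e : (fun t : Rd d => φ (s • t)) = φ ∘ (s • ContinuousLinearMap.id ℝ (Rd d)) := rfl
  rw [e, ContinuousLinearMap.iteratedFDeriv_comp_right _ (φ.smooth ⊤) _ (by exact_mod_cast le_top)]
  refine (ContinuousMultilinearMap.norm_compContinuousLinearMap_le _ _).trans ?_
  rw [mul_comm]
  refine mul_le_mul_of_nonneg_right ?_ (norm_nonneg _)
  rw [Finset.prod_const, Finset.card_univ, Fintype.card_fin, norm_smul, Real.norm_of_nonneg hs]
  gcongr
  exact mul_le_of_le_one_right hs ContinuousLinearMap.norm_id_le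

namespace PhaseLattice

variable (Ω : PhaseLattice d α) (φ : 𝓢(Rd d, ℂ))

/-- In Leibniz's rule each derivative costs `|ξ|` on the exponential and the width on the dilated
window; the binomial theorem collects the terms. -/
theorem norm_iteratedFDeriv_atom_le (z : ℕ × (Fin d → ℤ)) (n : ℕ) (t : Rd d) {S : ℝ}
    (hS : ∀ j ≤ n, ‖iteratedFDeriv ℝ j φ (Ω.width z.1 • (t - Ω.pos z.1 z.2))‖ ≤ S) :
    ‖iteratedFDeriv ℝ n (Ω.atom φ z) t‖ ≤ Ω.amp z.1 * ((‖Ω.freq z.1‖ + Ω.width z.1) ^ n * S) := by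
  have hw := (Ω.width_pos z.1).le
  set e : Rd d → ℂ := fun t => Complex.exp (Complex.I * (inner ℝ t (Ω.freq z.1) : ℝ)) with he
  set f : Rd d → ℂ := fun t => φ (Ω.width z.1 • (t - Ω.pos z.1 z.2)) with hf
  have hec : ContDiff ℝ (⊤ : ℕ∞) e := (hasTemperateGrowth_exp_inner (Ω.freq z.1)).1
  have hfc : ContDiff ℝ (⊤ : ℕ∞) f :=
    (φ.smooth ⊤).comp (contDiff_const_smul _ |>.comp (contDiff_id.sub contDiff_const))
  have h1 : (Ω.atom φ z : Rd d → ℂ) = (Ω.amp z.1 : ℂ) • fun t => e t * f t := by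
    funext t
    rw [atom, packet_apply, packetFun]
    simp only [Pi.smul_apply, smul_eq_mul, he, hf, amp, width]
    ring
  rw [h1, iteratedFDeriv_const_smul_apply
    ((hec.mul hfc).of_le (by exact_mod_cast le_top)).contDiffAt,
    norm_smul, Complex.norm_real, Real.norm_of_nonneg (Ω.amp_pos _).le]
  refine mul_le_mul_of_nonneg_left ?_ (Ω.amp_pos _).le
  refine (norm_iteratedFDeriv_mul_le hec hfc t (by exact_mod_cast le_top)).trans ?_
  rw [add_pow, Finset.sum_mul]
  refine Finset.sum_le_sum fun j hj => ?_
  have h2 := norm_iteratedFDeriv_exp_inner_le (Ω.freq z.1) t j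
  have h3 := (norm_iteratedFDeriv_dilate_le φ hw (Ω.pos z.1 z.2) t (n - j)).trans
    (mul_le_mul_of_nonneg_left (hS (n - j) (Nat.sub_le _ _)) (by positivity))
  calc _ ≤ (n.choose j : ℝ) * ‖Ω.freq z.1‖ ^ j * (Ω.width z.1 ^ (n - j) * S) := by gcongr
    _ = _ := by ring

theorem polyGrowth_atom_bound (hα : 0 < α) (z₀ : ℕ × (Fin d → ℤ)) (k n : ℕ) {q : ℝ} (hq : 0 ≤ q) :
    PolyGrowth (fun z => Ω.tau z z₀) fun z =>
      ((1 + ‖Ω.pos z.1 z.2‖) * (1 + (Ω.width z.1)⁻¹)) ^ k *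
        (Ω.amp z.1 * ((‖Ω.freq z.1‖ + Ω.width z.1) ^ n * q)) := by
  set T : ℕ × (Fin d → ℤ) → ℝ := fun z => (1 + ‖Ω.pos z.1 z.2‖) * (1 + ‖Ω.freq z.1‖) with hT
  have hT1 : ∀ z, 1 ≤ T z := fun z => one_le_mul_of_one_le_of_one_le
    (by linarith [norm_nonneg (Ω.pos z.1 z.2)]) (Ω.one_le_one_add_norm_freq _)
  refine PolyGrowth.trans (T := T) ?_ (Ω.exists_norm_le_tau hα z₀) fun z =>
    zero_le_one.trans (hT1 z)
  have hY : PolyGrowth T fun z => 1 + ‖Ω.freq z.1‖ := ⟨1, 1, zero_le_one, fun z => by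
    rw [one_mul, pow_one]
    exact le_mul_of_one_le_left (by positivity) (by linarith [norm_nonneg (Ω.pos z.1 z.2)])⟩
  have hX : PolyGrowth T fun z => 1 + ‖Ω.pos z.1 z.2‖ := ⟨1, 1, zero_le_one, fun z => by
    rw [one_mul, pow_one]
    exact le_mul_of_one_le_right (by positivity) (Ω.one_le_one_add_norm_freq _)⟩
  have hpow : ∀ γ : ℝ, PolyGrowth T fun z => ‖Ω.freq z.1‖ ^ γ := fun γ => by
    obtain ⟨C, m, hC, h⟩ := Ω.polyGrowth_rpow hα γ
    have h' : PolyGrowth (fun z : ℕ × (Fin d → ℤ) => 1 + ‖Ω.freq z.1‖)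
        fun z => ‖Ω.freq z.1‖ ^ γ := ⟨C, m, hC, fun z => h z.1⟩
    exact h'.trans hY fun z => zero_le_one.trans (Ω.one_le_one_add_norm_freq z.1)
  have hW : ∀ z : ℕ × (Fin d → ℤ), 0 ≤ 1 + (Ω.width z.1)⁻¹ := fun z => by
    have := Ω.width_pos z.1; positivity
  have hwn : ∀ z : ℕ × (Fin d → ℤ), 0 ≤ ‖Ω.freq z.1‖ + Ω.width z.1 := fun z =>
    add_nonneg (norm_nonneg _) (Ω.width_pos z.1).le
  have g1 : PolyGrowth T fun z => (1 + ‖Ω.pos z.1 z.2‖) * (1 + (Ω.width z.1)⁻¹) :=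
    PolyGrowth.mul hT1 hX (PolyGrowth.add hT1 (PolyGrowth.const 1)
      ((hpow (α - 1)).mono fun z => (Ω.inv_width z.1).le)) hW
  have g2 : PolyGrowth T fun z => (‖Ω.freq z.1‖ + Ω.width z.1) ^ n :=
    PolyGrowth.pow hT1 (PolyGrowth.add hT1 (hY.mono fun z => by linarith) (hpow (1 - α))) hwn n
  have g3 : PolyGrowth T fun z => Ω.amp z.1 := hpow ((d : ℝ) / 2 * (1 - α))
  have g4 : PolyGrowth T fun z => ((1 + ‖Ω.pos z.1 z.2‖) * (1 + (Ω.width z.1)⁻¹)) ^ k :=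
    PolyGrowth.pow hT1 g1 (fun z => mul_nonneg (by positivity) (hW z)) k
  have g5 : PolyGrowth T fun z => (‖Ω.freq z.1‖ + Ω.width z.1) ^ n * q :=
    PolyGrowth.mul hT1 g2 (PolyGrowth.const q) fun _ => hq
  have g6 : PolyGrowth T fun z => Ω.amp z.1 * ((‖Ω.freq z.1‖ + Ω.width z.1) ^ n * q) :=
    PolyGrowth.mul hT1 g3 g5 fun z => mul_nonneg (pow_nonneg (hwn z) n) hq
  exact PolyGrowth.mul hT1 g4 g6
    fun z => mul_nonneg (Ω.amp_pos _).le (mul_nonneg (pow_nonneg (hwn z) n) hq)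

/-- The Schwartz seminorms of the packets grow at most polynomially. -/
theorem polyGrowth_seminorm_atom (hα : 0 < α) (z₀ : ℕ × (Fin d → ℤ)) (k n : ℕ) :
    PolyGrowth (fun z => Ω.tau z z₀) fun z => SchwartzMap.seminorm ℂ k n (Ω.atom φ z) := by
  obtain ⟨q, hq0, hq⟩ : ∃ q : ℝ, 0 ≤ q ∧ ∀ j ≤ n, ∀ y,
      (1 + ‖y‖) ^ k * ‖iteratedFDeriv ℝ j φ y‖ ≤ q :=
    ⟨_, mul_nonneg (by positivity) (apply_nonneg _ _), fun j hj y =>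
      one_add_le_sup_seminorm_apply (𝕜 := ℂ) (m := (k, n)) le_rfl hj φ y⟩
  refine (Ω.polyGrowth_atom_bound hα z₀ k n hq0).mono fun z => ?_
  have hw := Ω.width_pos z.1
  have ha := Ω.amp_pos z.1
  refine seminorm_le_bound ℂ k n _ (by positivity) fun t => ?_
  have h1 : ∀ j ≤ n, ‖iteratedFDeriv ℝ j φ (Ω.width z.1 • (t - Ω.pos z.1 z.2))‖ ≤
      ((1 + ‖Ω.width z.1 • (t - Ω.pos z.1 z.2)‖) ^ k)⁻¹ * q := fun j hj => by
    rw [le_inv_mul_iff₀ (by positivity)]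
    exact hq j hj _
  have h2 := Ω.norm_iteratedFDeriv_atom_le φ z n t h1
  have hyn : ‖Ω.width z.1 • (t - Ω.pos z.1 z.2)‖ = Ω.width z.1 * ‖t - Ω.pos z.1 z.2‖ := by
    rw [norm_smul, Real.norm_of_nonneg hw.le]
  rw [hyn] at h2
  have h4 : ‖t‖ ≤ ‖t - Ω.pos z.1 z.2‖ + ‖Ω.pos z.1 z.2‖ := by
    simpa using norm_add_le (t - Ω.pos z.1 z.2) (Ω.pos z.1 z.2)
  have hD1 := norm_nonneg (iteratedFDeriv ℝ n (Ω.atom φ z) t)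
  generalize ‖iteratedFDeriv ℝ n (Ω.atom φ z) t‖ = D at h2 hD1 ⊢
  generalize ‖Ω.freq z.1‖ + Ω.width z.1 = E at h2 ⊢
  have hD0 := norm_nonneg (t - Ω.pos z.1 z.2)
  have hx0 := norm_nonneg (Ω.pos z.1 z.2)
  have ht0 := norm_nonneg t
  generalize ‖t - Ω.pos z.1 z.2‖ = r at *
  generalize ‖Ω.pos z.1 z.2‖ = x at *
  generalize ‖t‖ = t' at *
  generalize Ω.width z.1 = s at *
  -- This moves the polynomial weight from the origin to the centre of the packet and from unit
  -- scale to the scale of the packet, where the decay of the window absorbs it.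
  have h3 : t' ≤ (1 + x) * (1 + s⁻¹) * (1 + s * r) := by
    have h5 : (1 + s⁻¹) * (1 + s * r) = 1 + r + (s⁻¹ + s * r) := by
      field_simp
      ring
    rw [mul_assoc, h5]
    have h6 : 0 ≤ s⁻¹ + s * r := by positivity
    nlinarith [mul_nonneg hx0 h6, mul_nonneg hx0 hD0]
  have hs0 : 0 < 1 + s * r := by positivity
  calc t' ^ k * D ≤ ((1 + x) * (1 + s⁻¹) * (1 + s * r)) ^ k *
        (Ω.amp z.1 * (E ^ n * (((1 + s * r) ^ k)⁻¹ * q))) :=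
        mul_le_mul (pow_le_pow_left₀ ht0 h3 k) h2 hD1 (by positivity)
    _ = ((1 + x) * (1 + s⁻¹)) ^ k * (Ω.amp z.1 * (E ^ n * q)) *
          ((1 + s * r) ^ k * ((1 + s * r) ^ k)⁻¹) := by rw [mul_pow _ (1 + s * r)]; ring
    _ = _ := by rw [mul_inv_cancel₀ (by positivity), mul_one]

end PhaseLattice

/-- Absolutely convergent series of Schwartz functions converge. -/
theorem exists_hasSum_schwartz {Λ : Type*} (u : Λ → 𝓢(Rd d, ℂ))
    (h : ∀ k n, Summable fun z => SchwartzMap.seminorm ℂ k n (u z)) : ∃ v, HasSum u v := by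
  have hb : ∀ (n : ℕ) z x, ‖iteratedFDeriv ℝ n (u z) x‖ ≤ SchwartzMap.seminorm ℂ 0 n (u z) :=
    fun n z x => by simpa using le_seminorm ℂ 0 n (u z) x
  have hs : ∀ (n : ℕ) x, Summable fun z => iteratedFDeriv ℝ n (u z) x := fun n x =>
    Summable.of_norm_bounded (h 0 n) fun z => hb n z x
  have hd : ∀ n : ℕ, (iteratedFDeriv ℝ n fun x => ∑' z, u z x) =
      fun x => ∑' z, iteratedFDeriv ℝ n (u z) x := fun n =>
    iteratedFDeriv_tsum (N := ⊤) (fun z => (u z).smooth ⊤) (fun n _ => h 0 n)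
      (fun n z x _ => hb n z x) le_top
  -- A general subset is allowed because two cases are needed: the whole index set, for the decay of
  -- the sum, and complements of finite sets, for convergence in each seminorm.
  have hdecay : ∀ (k n : ℕ) (s : Set Λ) x, ‖x‖ ^ k * ‖∑' z : s, iteratedFDeriv ℝ n (u z) x‖ ≤
      ∑' z : s, SchwartzMap.seminorm ℂ k n (u z) := by
    intro k n s x
    have h1 : Summable fun z : s => ‖x‖ ^ k * ‖iteratedFDeriv ℝ n (u z) x‖ :=
      Summable.of_nonneg_of_le (fun z => by positivity) (fun z => le_seminorm ℂ k n (u z) x)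
        ((h k n).subtype s)
    have h2 : Summable fun z : s => ‖iteratedFDeriv ℝ n (u z) x‖ :=
      Summable.of_nonneg_of_le (fun z => by positivity) (fun z => hb n z x) ((h 0 n).subtype s)
    calc _ ≤ ‖x‖ ^ k * ∑' z : s, ‖iteratedFDeriv ℝ n (u z) x‖ := by
          gcongr
          exact norm_tsum_le_tsum_norm h2
      _ = ∑' z : s, ‖x‖ ^ k * ‖iteratedFDeriv ℝ n (u z) x‖ := tsum_mul_left.symm
      _ ≤ _ := h1.tsum_le_tsum (fun z => le_seminorm ℂ k n (u z) x) ((h k n).subtype s)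
  let v : 𝓢(Rd d, ℂ) :=
    { toFun := fun x => ∑' z, u z x
      smooth' := contDiff_tsum (N := ⊤) (fun z => (u z).smooth ⊤) (fun n _ => h 0 n)
        fun n z x _ => hb n z x
      decay' := fun k n => ⟨∑' z, SchwartzMap.seminorm ℂ k n (u z), fun x => by
        rw [hd]
        have := hdecay k n Set.univ x
        rwa [tsum_univ (fun z => iteratedFDeriv ℝ n (u z) x),
          tsum_univ (fun z => SchwartzMap.seminorm ℂ k n (u z))] at this⟩ }
  refine ⟨v, ?_⟩
  rw [HasSum, (schwartz_withSeminorms ℂ (Rd d) ℂ).tendsto_nhds]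
  rintro ⟨k, n⟩ ε hε
  have ht := tendsto_tsum_compl_atTop_zero fun z => SchwartzMap.seminorm ℂ k n (u z)
  filter_upwards [ht.eventually (gt_mem_nhds hε)] with s hs'
  refine lt_of_le_of_lt ?_ hs'
  refine seminorm_le_bound ℂ k n _ (tsum_nonneg fun z => apply_nonneg _ _) fun x => ?_
  have h1 : iteratedFDeriv ℝ n (∑ z ∈ s, u z - v) x =
      -∑' z : {z // z ∉ s}, iteratedFDeriv ℝ n (u z) x := by
    have h2 : iteratedFDeriv ℝ n v x = ∑' z, iteratedFDeriv ℝ n (u z) x := congrFun (hd n) x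
    have h3 : iteratedFDeriv ℝ n ⇑(∑ z ∈ s, u z) x = ∑ z ∈ s, iteratedFDeriv ℝ n (u z) x := by
      have e : ((∑ z ∈ s, u z : 𝓢(Rd d, ℂ)) : Rd d → ℂ) = ∑ z ∈ s, (u z : Rd d → ℂ) :=
        map_sum (FunLike.coeAddMonoidHom 𝓢(Rd d, ℂ) _ _) u s
      rw [e]
      exact iteratedFDeriv_sum_apply fun z _ => ((u z).smooth n).contDiffAt
    have h4 : ((∑ z ∈ s, u z - v : 𝓢(Rd d, ℂ)) : Rd d → ℂ) = ⇑(∑ z ∈ s, u z) - ⇑v := rfl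
    rw [h4, iteratedFDeriv_sub_apply ((SchwartzMap.smooth _ n).contDiffAt) (v.smooth n).contDiffAt,
      h2, h3, ← (hs n x).sum_add_tsum_subtype_compl s, sub_add_cancel_left]
  rw [h1, norm_neg]
  exact hdecay k n {z | z ∉ s} x

end derivatives

end Subdyadic

namespace Subdyadic

/-! ### Frame expansions and dual packets in the Schwartz space. -/

section duals

variable {d : ℕ} {α : ℝ} (Ω : PhaseLattice d α) (φ : 𝓢(Rd d, ℂ))

namespace PhaseLattice

/-- Rapid decay of a family over the lattice, with respect to the base point `z₀`. -/
def RapidSeq (z₀ : ℕ × (Fin d → ℤ)) (a : ℕ × (Fin d → ℤ) → ℂ) : Prop :=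
  ∀ N : ℕ, ∃ C : ℝ, ∀ z, ‖a z‖ * Ω.tau z z₀ ^ N ≤ C

variable {Ω}

theorem Rapid.rapidSeq {M : ℕ × (Fin d → ℤ) → ℕ × (Fin d → ℤ) → ℂ} (hM : Ω.Rapid M)
    (w : ℕ × (Fin d → ℤ)) : Ω.RapidSeq w fun z => M z w := fun N => by
  obtain ⟨C, hC⟩ := hM N
  exact ⟨C, fun z => hC z w⟩

theorem exists_summable_tau (hα : 0 < α) : ∃ (N : ℕ) (S : ℝ), ∀ z,
    Summable (fun w => (Ω.tau z w ^ N)⁻¹) ∧ ∑' w, (Ω.tau z w ^ N)⁻¹ ≤ S := by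
  obtain ⟨N, C, hC, h⟩ := Ω.exists_tsum_tau_le hα
  refine ⟨N, C.toReal, fun z => ?_⟩
  have h0 : ∀ w, 0 ≤ (Ω.tau z w ^ N)⁻¹ := fun w => by have := Ω.tau_pos z w; positivity
  have hne := ne_top_of_le_ne_top hC (h z)
  have hs : Summable fun w => (Ω.tau z w ^ N)⁻¹ :=
    (ENNReal.summable_toReal hne).congr fun w => ENNReal.toReal_ofReal (h0 w)
  refine ⟨hs, ?_⟩
  rw [← ENNReal.ofReal_le_iff_le_toReal hC, ENNReal.ofReal_tsum_of_nonneg h0 hs]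
  exact h z

/-- Series of packets with rapidly decaying coefficients converge in the Schwartz space. -/
theorem RapidSeq.exists_hasSum (hα : 0 < α) {z₀ : ℕ × (Fin d → ℤ)} {a : ℕ × (Fin d → ℤ) → ℂ}
    (ha : Ω.RapidSeq z₀ a) : ∃ v, HasSum (fun z => a z • Ω.atom φ z) v := by
  refine exists_hasSum_schwartz _ fun k n => ?_
  obtain ⟨N, S, hS⟩ := exists_summable_tau (Ω := Ω) hα
  obtain ⟨C, m, hC, hm⟩ := Ω.polyGrowth_seminorm_atom φ hα z₀ k n
  obtain ⟨A, hA⟩ := ha (N + m)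
  refine Summable.of_nonneg_of_le (fun z => apply_nonneg _ _) (fun z => ?_)
    ((hS z₀).1.mul_left (A * C))
  have ht := Ω.tau_pos z z₀
  rw [map_smul_eq_mul, Ω.tau_comm z₀ z, ← div_eq_mul_inv, le_div_iff₀ (by positivity)]
  calc _ ≤ ‖a z‖ * (C * Ω.tau z z₀ ^ m) * Ω.tau z z₀ ^ N := by gcongr; exact hm z
    _ = (‖a z‖ * Ω.tau z z₀ ^ (N + m)) * C := by rw [pow_add]; ring
    _ ≤ A * C := by gcongr; exact hA z

/-- The polynomial triangle inequality distributes `tau z z₀ ^ N` over the matrix and the sequence;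
`N₀` further powers of decay of the matrix make the sum converge. -/
theorem RapidSeq.mulVec (hα : 0 < α) {z₀ : ℕ × (Fin d → ℤ)} {a : ℕ × (Fin d → ℤ) → ℂ}
    (ha : Ω.RapidSeq z₀ a) {M : ℕ × (Fin d → ℤ) → ℕ × (Fin d → ℤ) → ℂ} (hM : Ω.Rapid M) :
    Ω.RapidSeq z₀ fun z => ∑' w, M z w * a w := by
  intro N
  obtain ⟨K, m, hK, htri⟩ := Ω.exists_tau_triangle hα
  obtain ⟨N₀, S, hS⟩ := exists_summable_tau (Ω := Ω) hα
  obtain ⟨A, hA⟩ := ha (m * N)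
  obtain ⟨B, hB⟩ := hM (N₀ + m * N)
  have hA0 : 0 ≤ A := (mul_nonneg (norm_nonneg _) (pow_nonneg (Ω.tau_pos _ _).le _)).trans (hA z₀)
  have hB0 : 0 ≤ B :=
    (mul_nonneg (norm_nonneg _) (pow_nonneg (Ω.tau_pos _ _).le _)).trans (hB z₀ z₀)
  refine ⟨B * A * K ^ N * S, fun z => ?_⟩
  have hz := Ω.tau_pos z z₀
  have hpt : ∀ w, ‖M z w * a w‖ * Ω.tau z z₀ ^ N ≤ B * A * K ^ N * (Ω.tau z w ^ N₀)⁻¹ := by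
    intro w
    have h1 := Ω.tau_pos z w
    have h2 := Ω.tau_pos w z₀
    rw [← div_eq_mul_inv, le_div_iff₀ (by positivity), norm_mul]
    calc _ ≤ ‖M z w‖ * ‖a w‖ * (K * (Ω.tau z w * Ω.tau w z₀) ^ m) ^ N * Ω.tau z w ^ N₀ := by
          gcongr
          exact htri z w z₀
      _ = (‖M z w‖ * Ω.tau z w ^ (N₀ + m * N)) * (‖a w‖ * Ω.tau w z₀ ^ (m * N)) * K ^ N := by
          rw [mul_pow K, ← pow_mul, mul_pow (Ω.tau z w), pow_add]; ring
      _ ≤ _ := by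
          gcongr
          · exact hB z w
          · exact hA w
  have hs : Summable fun w => ‖M z w * a w‖ * Ω.tau z z₀ ^ N :=
    Summable.of_nonneg_of_le (fun w => by positivity) hpt ((hS z).1.mul_left _)
  have hs' : Summable fun w => ‖M z w * a w‖ :=
    (summable_mul_right_iff (pow_pos hz N).ne').mp hs
  calc _ ≤ (∑' w, ‖M z w * a w‖) * Ω.tau z z₀ ^ N := by
        gcongr
        exact norm_tsum_le_tsum_norm hs'
    _ = ∑' w, ‖M z w * a w‖ * Ω.tau z z₀ ^ N := tsum_mul_right.symm
    _ ≤ ∑' w, B * A * K ^ N * (Ω.tau z w ^ N₀)⁻¹ := hs.tsum_le_tsum hpt ((hS z).1.mul_left _)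
    _ = B * A * K ^ N * ∑' w, (Ω.tau z w ^ N₀)⁻¹ := tsum_mul_left
    _ ≤ _ := by
        gcongr
        exact (hS z).2

variable (Ω)

/-- The coefficient `⟨u, φ_z⟩` of a Schwartz function. -/
noncomputable def atomCoeff (z : ℕ × (Fin d → ℤ)) (u : 𝓢(Rd d, ℂ)) : ℂ :=
  ∫ t, inner ℂ (Ω.atom φ z t) (u t)

theorem atomCoeff_eq_inner (z : ℕ × (Fin d → ℤ)) (u : 𝓢(Rd d, ℂ)) :
    Ω.atomCoeff φ z u = inner ℂ ((Ω.atom φ z).toLp 2 volume) (u.toLp 2 volume) :=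
  (inner_toL2_toL2_eq _ _ _).symm

theorem gaborTransform_eq_inner (f : Lp ℂ 2 (volume : Measure (Rd d))) (z : ℕ × (Fin d → ℤ)) :
    gaborTransform α φ f (Ω.pos z.1 z.2) (Ω.freq z.1) =
      inner ℂ ((Ω.atom φ z).toLp 2 volume) f := by
  rw [L2.inner_def, gaborTransform]
  refine integral_congr_ae ?_
  filter_upwards [coeFn_toLp (Ω.atom φ z) 2 volume] with t ht
  rw [ht, RCLike.inner_apply, atom, packet_apply]

/-- Schwartz convergence implies `L²` convergence, and Schwartz functions embed injectively in `L²`.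
This identifies the Schwartz sum of a series whose `L²` sum is known. -/
theorem eq_of_hasSum_toLp {a : ℕ × (Fin d → ℤ) → ℂ} {u v : 𝓢(Rd d, ℂ)}
    (h : HasSum (fun z => a z • Ω.atom φ z) v)
    (h' : HasSum (fun z => a z • (Ω.atom φ z).toLp 2 volume) (u.toLp 2 volume)) : v = u := by
  refine injective_toLp 2 (volume : Measure (Rd d)) ?_
  have h2 := h.mapL (toLpCLM ℂ ℂ 2 (volume : Measure (Rd d)))
  simp only [map_smul, toLpCLM_apply] at h2
  exact h2.unique h'

/-- The reconstruction of Schwartz functions from their coefficients, and the dual packets. -/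
theorem exists_schwartz_dual (hα : 0 < α) {c : ℝ} (hc : ∀ ζ, 𝓕 φ ζ ≠ 0 → ‖ζ‖ ≤ c)
    (hφ : IsGaborFrame Ω φ) :
    ∃ (H P : ℕ × (Fin d → ℤ) → ℕ × (Fin d → ℤ) → ℂ) (ψ : ℕ × (Fin d → ℤ) → 𝓢(Rd d, ℂ)),
      Ω.Rapid H ∧ Ω.Rapid P ∧ (∀ z w, H w z = starRingEnd ℂ (H z w)) ∧
      (∀ z w, P w z = starRingEnd ℂ (P z w)) ∧
      (∀ u, HasSum (fun z => (∑' w, H z w * Ω.atomCoeff φ w u) • Ω.atom φ z) u) ∧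
      (∀ w, HasSum (fun z => P z w • Ω.atom φ z) (Ω.atom φ w)) ∧
      ∀ z w, Ω.atomCoeff φ z (ψ w) = P z w := by
  obtain ⟨A, B, hA, hB, hAB⟩ := hφ
  have hframe : ∀ f : Lp ℂ 2 (volume : Measure (Rd d)), ENNReal.ofReal A * ‖f‖ₑ ^ 2 ≤
      ∑' z, ‖inner ℂ ((Ω.atom φ z).toLp 2 volume) f‖ₑ ^ 2 ∧
      ∑' z, ‖inner ℂ ((Ω.atom φ z).toLp 2 volume) f‖ₑ ^ 2 ≤ ENNReal.ofReal B * ‖f‖ₑ ^ 2 := by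
    intro f
    have e : ∑' z, ‖inner ℂ ((Ω.atom φ z).toLp 2 volume) f‖ₑ ^ 2 =
        ∑' (k : ℕ) (j : Fin d → ℤ), ‖gaborTransform α φ f (Ω.pos k j) (Ω.freq k)‖ₑ ^ 2 := by
      rw [ENNReal.tsum_prod']
      exact tsum_congr fun k => tsum_congr fun j => by
        rw [← Ω.gaborTransform_eq_inner φ f (k, j)]
    rw [e]
    exact hAB f
  have hG : Ω.Rapid fun z w => inner ℂ ((Ω.atom φ z).toLp 2 (volume : Measure (Rd d)))
      ((Ω.atom φ w).toLp 2 volume) := by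
    simp only [inner_toL2_toL2_eq]
    exact Ω.rapid_gram φ hα hc
  obtain ⟨H, P, Ψ, hH, hP, hH', hP', hu, hPs, hHs, hPsi⟩ :=
    Ω.exists_localized_dual hα (fun z => (Ω.atom φ z).toLp 2 volume) hA hB hframe hG
  -- The dual vectors, known so far in `L²` only, are Schwartz functions because the columns of `H`
  -- decay rapidly.
  choose ψ hψ using fun w => (hH.rapidSeq w).exists_hasSum φ hα
  have hψΨ : ∀ w, Ψ w = (ψ w).toLp 2 volume := by
    intro w
    have h2 := (hψ w).mapL (toLpCLM ℂ ℂ 2 (volume : Measure (Rd d)))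
    simp only [map_smul, toLpCLM_apply] at h2
    exact (hHs w).unique h2
  refine ⟨H, P, ψ, hH, hP, hH', hP', fun u => ?_, fun w => ?_, fun z w => ?_⟩
  · obtain ⟨b, hb, hbu⟩ := hu (u.toLp 2 volume)
    have e : (fun z => ∑' w, H z w * Ω.atomCoeff φ w u) = b := by
      funext z
      simp only [atomCoeff_eq_inner]
      exact (hb z).tsum_eq
    have hr : Ω.RapidSeq (0, 0) b := by
      rw [← e]
      refine RapidSeq.mulVec hα (fun N => ?_) hH
      obtain ⟨q, -, hq⟩ := Ω.exists_seminorm_inner_atom_le φ hα hc (0, 0) N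
      exact ⟨q u, fun z => hq u z⟩
    obtain ⟨v, hv⟩ := hr.exists_hasSum φ hα
    rw [Ω.eq_of_hasSum_toLp φ hv hbu] at hv
    rw [← e] at hv
    exact hv
  · obtain ⟨v, hv⟩ := (hP.rapidSeq w).exists_hasSum φ hα
    rwa [Ω.eq_of_hasSum_toLp φ hv (hPs w)] at hv
  · rw [atomCoeff_eq_inner, ← hψΨ, hPsi]

end PhaseLattice

end duals

end Subdyadic

namespace Subdyadic

variable {d : ℕ} {α : ℝ} (Ω : PhaseLattice d α) (φ : 𝓢(Rd d, ℂ))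

/-! ### Weighted sequence spaces over the lattice. -/

namespace PhaseLattice

/-- The norm of a family over the lattice in the weighted space `ℓ^q(ℓ^p)`. -/
noncomputable def seqNorm (p q β : ℝ) (c : ℕ × (Fin d → ℤ) → ℂ) : ℝ≥0∞ :=
  mixNorm p q (Ω.freqWeight β) fun k i => ‖c (k, i)‖ₑ

variable {Ω}

theorem enorm_lt_top_of_mixNorm {p q β : ℝ} (hp : 0 < p) (hq : 0 < q)
    {a : ℕ → (Fin d → ℤ) → ℝ≥0∞} (h : mixNorm p q (Ω.freqWeight β) a ≠ ∞) (k : ℕ)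
    (i : Fin d → ℤ) : a k i ≠ ∞ := by
  intro h0
  have := le_mixNorm hp hq (Ω.freqWeight β) a k i
  rw [h0, ENNReal.top_mul (Ω.freqWeight_ne_zero β k), top_le_iff] at this
  exact h this

/-- Localized matrices act on the weighted mixed-norm spaces. -/
theorem Rapid.exists_mixNorm_le (hα : 0 < α) {M : ℕ × (Fin d → ℤ) → ℕ × (Fin d → ℤ) → ℂ}
    (hM : Ω.Rapid M) (β : ℝ) : ∃ C : ℝ≥0, ∀ {p p' q q' : ℝ}, p.HolderConjugate p' →
      q.HolderConjugate q' → ∀ c, mixNorm p q (Ω.freqWeight β)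
        (fun k i => ∑' w, ‖M (k, i) w * c w‖ₑ) ≤ C * Ω.seqNorm p q β c := by
  obtain ⟨N, C, hC, h⟩ := Ω.exists_kernel_le hα β
  obtain ⟨A, hA⟩ := hM.le N
  refine ⟨A * C.toNNReal, fun {p p' q q'} hp hq c => ?_⟩
  have hp0 := hp.pos
  have hq0 := hq.pos
  refine (mixNorm_mono hp0.le hq0.le _ (b := fun k i => (A : ℝ≥0∞) * ∑' l, ∑' j,
    ENNReal.ofReal (Ω.tau (k, i) (l, j) ^ N)⁻¹ * ‖c (l, j)‖ₑ) fun k i => ?_).trans ?_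
  · simp only [← ENNReal.tsum_mul_left]
    rw [ENNReal.tsum_prod']
    refine ENNReal.tsum_le_tsum fun l => ENNReal.tsum_le_tsum fun j => ?_
    rw [enorm_mul, ← mul_assoc]
    gcongr
    rw [← ofReal_norm, ← ENNReal.ofReal_coe_nnreal, ← ENNReal.ofReal_mul A.coe_nonneg]
    exact ENNReal.ofReal_le_ofReal (hA _ _)
  · rw [mixNorm_const_mul hp0 hq0, ENNReal.coe_mul, ENNReal.coe_toNNReal hC, mul_assoc]
    gcongr
    exact (h hp hq (fun l j => ‖c (l, j)‖ₑ) 0).2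

theorem Rapid.exists_seqNorm_le (hα : 0 < α) {M : ℕ × (Fin d → ℤ) → ℕ × (Fin d → ℤ) → ℂ}
    (hM : Ω.Rapid M) (β : ℝ) : ∃ C : ℝ≥0, ∀ {p p' q q' : ℝ}, p.HolderConjugate p' →
      q.HolderConjugate q' → ∀ c, Ω.seqNorm p q β c ≠ ∞ →
        (∀ z, Summable fun w => ‖M z w * c w‖) ∧
        Ω.seqNorm p q β (fun z => ∑' w, M z w * c w) ≤ C * Ω.seqNorm p q β c := by
  obtain ⟨C, hC⟩ := hM.exists_mixNorm_le hα β
  refine ⟨C, fun {p p' q q'} hp hq c hc => ?_⟩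
  have h1 := hC hp hq c
  have h2 : ∀ z, Summable fun w => ‖M z w * c w‖ := fun z => by
    have := ENNReal.summable_toReal (enorm_lt_top_of_mixNorm hp.pos hq.pos
      (ne_top_of_le_ne_top (ENNReal.mul_ne_top (by simp) hc) h1) z.1 z.2)
    simpa using this
  refine ⟨h2, le_trans (mixNorm_mono hp.nonneg hq.nonneg _ fun k i => ?_) h1⟩
  exact enorm_tsum_le_tsum_enorm

theorem tsum_enorm_mul_le_seqNorm {p p' q q' : ℝ} (hp : p.HolderConjugate p')
    (hq : q.HolderConjugate q') (β : ℝ) (b c : ℕ × (Fin d → ℤ) → ℂ) :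
    ∑' z, ‖b z‖ₑ * ‖c z‖ₑ ≤ Ω.seqNorm p q β b * Ω.seqNorm p' q' (-β) c := by
  rw [ENNReal.tsum_prod']
  have := tsum_mul_le_mixNorm hp hq (w := Ω.freqWeight β) (Ω.freqWeight_ne_zero β)
    (Ω.freqWeight_ne_top β) (fun k i => ‖b (k, i)‖ₑ) (fun k i => ‖c (k, i)‖ₑ)
  simp only [← Ω.freqWeight_neg] at this
  exact this

/-- Rapidly decaying families belong to all the mixed-norm spaces. -/
theorem exists_seqNorm_le_of_decay (hα : 0 < α) (β : ℝ) (z₀ : ℕ × (Fin d → ℤ)) :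
    ∃ (N : ℕ) (C : ℝ≥0), ∀ {p p' q q' : ℝ}, p.HolderConjugate p' → q.HolderConjugate q' →
      ∀ (c : ℕ × (Fin d → ℤ) → ℂ) (A : ℝ), (∀ z, ‖c z‖ * Ω.tau z z₀ ^ N ≤ A) →
        Ω.seqNorm p q β c ≤ C * ENNReal.ofReal A := by
  obtain ⟨N, C, hC, h⟩ := Ω.exists_kernel_le hα β
  have hC' : C * Ω.freqWeight β z₀.1 ≠ ∞ := ENNReal.mul_ne_top hC (Ω.freqWeight_ne_top β _)
  refine ⟨N, (C * Ω.freqWeight β z₀.1).toNNReal, fun {p p' q q'} hp hq c A hA => ?_⟩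
  -- The given decay says that the family is dominated by the kernel applied to the single entry `A`
  -- at `z₀`.
  have h1 := (h hp hq (Pi.single z₀.1 (Pi.single z₀.2 (ENNReal.ofReal A))) 0).2
  rw [mixNorm_single hp.pos hq.pos] at h1
  rw [ENNReal.coe_toNNReal hC', mul_assoc, mul_comm (Ω.freqWeight β z₀.1)]
  refine (mixNorm_mono hp.nonneg hq.nonneg _ fun k i => ?_).trans h1
  have ht := Ω.tau_pos (k, i) z₀
  have hA0 : 0 ≤ A := (mul_nonneg (norm_nonneg _) (pow_nonneg (Ω.tau_pos _ _).le _)).trans (hA z₀)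
  rw [tsum_eq_single z₀.1 (fun l hl => by simp [Pi.single_eq_of_ne hl]), tsum_eq_single z₀.2
    (fun j hj => by simp [Pi.single_eq_of_ne hj]), Pi.single_eq_same, Pi.single_eq_same,
    ← ENNReal.ofReal_mul (by positivity), ← ofReal_norm]
  apply ENNReal.ofReal_le_ofReal
  rw [inv_mul_eq_div, le_div_iff₀ (by positivity)]
  exact hA (k, i)

end PhaseLattice

/-! ### Coefficients of distributions -/

/-- The family of the coefficients of a tempered distribution. -/
noncomputable def distCoeff (f : 𝓢'(Rd d, ℂ)) (z : ℕ × (Fin d → ℤ)) : ℂ := coeff Ω φ f z.1 z.2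

theorem distCoeff_eq (f : 𝓢'(Rd d, ℂ)) (z : ℕ × (Fin d → ℤ)) :
    distCoeff Ω φ f z = f (conjSchwartz (Ω.atom φ z)) := rfl

theorem modENorm_eq_seqNorm {p q : ℝ} (β : ℝ) (hq : 0 < q) (f : 𝓢'(Rd d, ℂ)) :
    modENorm Ω φ p q β f = Ω.seqNorm p q β (distCoeff Ω φ f) :=
  modENorm_eq Ω φ p q β hq f

theorem distCoeff_toTemperedDistribution (u : 𝓢(Rd d, ℂ)) (z : ℕ × (Fin d → ℤ)) :
    distCoeff Ω φ (toTemperedDistributionCLM (Rd d) ℂ volume u) z = Ω.atomCoeff φ z u := by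
  refine (toTemperedDistributionCLM_apply_apply volume u _).trans ?_
  refine integral_congr_ae (Filter.Eventually.of_forall fun t => ?_)
  simp only [conjSchwartz_apply, RCLike.inner_apply, smul_eq_mul]
  exact mul_comm _ _

theorem conjSchwartz_conjSchwartz (u : 𝓢(Rd d, ℂ)) : conjSchwartz (conjSchwartz u) = u := by
  ext t
  simp [conjSchwartz_apply]

theorem conjSchwartz_smul (c : ℂ) (u : 𝓢(Rd d, ℂ)) :
    conjSchwartz (c • u) = starRingEnd ℂ c • conjSchwartz u := by
  ext t
  simp [conjSchwartz_apply]

theorem conjSchwartz_add (u v : 𝓢(Rd d, ℂ)) :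
    conjSchwartz (u + v) = conjSchwartz u + conjSchwartz v := by
  ext t
  simp [conjSchwartz_apply]

theorem hasSum_conjSchwartz {ι : Type*} {f : ι → 𝓢(Rd d, ℂ)} {u : 𝓢(Rd d, ℂ)} (h : HasSum f u) :
    HasSum (fun z => conjSchwartz (f z)) (conjSchwartz u) :=
  h.mapL (postcompCLM (𝕜 := ℝ) (Complex.conjCLE : ℂ →L[ℝ] ℂ))

/-- Continuity of `f` on the Schwartz space allows termwise evaluation, so expansions of test
functions become identities for the coefficients of an arbitrary tempered distribution. -/
theorem hasSum_apply_conjSchwartz (f : 𝓢'(Rd d, ℂ)) {a : ℕ × (Fin d → ℤ) → ℂ} {u : 𝓢(Rd d, ℂ)}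
    (h : HasSum (fun z => a z • Ω.atom φ z) u) :
    HasSum (fun z => starRingEnd ℂ (a z) * distCoeff Ω φ f z) (f (conjSchwartz u)) := by
  have h1 := hasSum_conjSchwartz h
  have h2 : Continuous f := f.cont
  have h3 := h1.map f h2
  refine h3.congr_fun fun z => ?_
  simp only [Function.comp_apply, conjSchwartz_smul, map_smul, smul_eq_mul, distCoeff_eq]

end Subdyadic

namespace Subdyadic

variable {d : ℕ} {α : ℝ} {Ω : PhaseLattice d α} {φ : 𝓢(Rd d, ℂ)}

theorem PhaseLattice.atomCoeff_sum {ι : Type*} (s : Finset ι) (a : ι → ℂ) (u : ι → 𝓢(Rd d, ℂ))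
    (z : ℕ × (Fin d → ℤ)) : Ω.atomCoeff φ z (∑ i ∈ s, a i • u i) =
      ∑ i ∈ s, a i * Ω.atomCoeff φ z (u i) := by
  have h : ∀ u, Ω.atomCoeff φ z u = (innerSL ℂ ((Ω.atom φ z).toLp 2 volume) ∘L
      toLpCLM ℂ ℂ 2 (volume : Measure (Rd d))) u := fun u => Ω.atomCoeff_eq_inner φ z u
  simp only [h, map_sum, map_smul, smul_eq_mul]

/-- Schwartz functions belong to the modulation spaces, with continuous inclusion. -/
theorem exists_modENorm_schwartz_le (hα : 0 < α) {c : ℝ} (hc : ∀ ζ, 𝓕 φ ζ ≠ 0 → ‖ζ‖ ≤ c)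
    {p p' q q' : ℝ} (hp : p.HolderConjugate p') (hq : q.HolderConjugate q') (β : ℝ) :
    ∃ s : Seminorm ℂ 𝓢(Rd d, ℂ), Continuous s ∧ ∀ u,
      modENorm Ω φ p q β (toTemperedDistributionCLM (Rd d) ℂ volume u) ≤ ENNReal.ofReal (s u) := by
  obtain ⟨N, C, hC⟩ := Ω.exists_seqNorm_le_of_decay hα β (0, 0)
  obtain ⟨s, hs, h⟩ := Ω.exists_seminorm_inner_atom_le φ hα hc (0, 0) N
  refine ⟨C • s, hs.const_smul C, fun u => ?_⟩
  rw [modENorm_eq_seqNorm Ω φ β hq.pos]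
  refine (hC hp hq _ (s u) fun z => ?_).trans_eq ?_
  · rw [distCoeff_toTemperedDistribution]
    exact h u z
  · change _ = ENNReal.ofReal (C * s u)
    rw [ENNReal.ofReal_mul C.coe_nonneg, ENNReal.ofReal_coe_nnreal]

/-! ### Functionals on the modulation spaces and density of Schwartz functions. -/

section modSpace

variable {p q β : ℝ} [Fact (1 ≤ p)] [Fact (1 ≤ q)]

/-- The coefficients of an element of the modulation space. -/
noncomputable def ModSpace.coeffs (f : ModSpace Ω φ p q β) : ℕ × (Fin d → ℤ) → ℂ :=
  distCoeff Ω φ (ModSpace.toDistribution Ω φ p q β f)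

theorem ModSpace.coeffs_add (f g : ModSpace Ω φ p q β) (z : ℕ × (Fin d → ℤ)) :
    (f + g).coeffs z = f.coeffs z + g.coeffs z := by
  simp only [ModSpace.coeffs, map_add]
  rfl

theorem ModSpace.coeffs_smul (a : ℂ) (f : ModSpace Ω φ p q β) (z : ℕ × (Fin d → ℤ)) :
    (a • f).coeffs z = a * f.coeffs z := by
  simp only [ModSpace.coeffs, map_smul]
  rfl

theorem ModSpace.enorm_eq (f : ModSpace Ω φ p q β) : ‖f‖ₑ = Ω.seqNorm p q β f.coeffs := by
  rw [← ofReal_norm, ModSpace.norm_def, ENNReal.ofReal_toReal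
    (ModSpace.enorm_lt_top Ω φ p q β f).ne]
  exact modENorm_eq_seqNorm Ω φ β (zero_lt_one.trans_le Fact.out) _

theorem ModSpace.seqNorm_ne_top (f : ModSpace Ω φ p q β) : Ω.seqNorm p q β f.coeffs ≠ ∞ := by
  rw [← ModSpace.enorm_eq]
  exact enorm_ne_top

/-- The inclusion of the Schwartz space in a modulation space. -/
noncomputable def ModSpace.ofSchwartz
    (h : ∀ u : 𝓢(Rd d, ℂ), toTemperedDistributionCLM (Rd d) ℂ volume u ∈ modSubmodule Ω φ p q β) :
    𝓢(Rd d, ℂ) →ₗ[ℂ] ModSpace Ω φ p q β :=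
  LinearMap.codRestrict (modSubmodule Ω φ p q β)
    (toTemperedDistributionCLM (Rd d) ℂ volume).toLinearMap h

variable (h : ∀ u : 𝓢(Rd d, ℂ),
  toTemperedDistributionCLM (Rd d) ℂ volume u ∈ modSubmodule Ω φ p q β)

theorem ModSpace.coeffs_ofSchwartz (u : 𝓢(Rd d, ℂ)) (z : ℕ × (Fin d → ℤ)) :
    (ModSpace.ofSchwartz h u).coeffs z = Ω.atomCoeff φ z u :=
  distCoeff_toTemperedDistribution Ω φ u z

/-- The values of a functional at the packets belong to the dual sequence space. -/
theorem ModSpace.exists_seqNorm_functional_le (hα : 0 < α) {c : ℝ}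
    (hc : ∀ ζ, 𝓕 φ ζ ≠ 0 → ‖ζ‖ ≤ c) {p' q' : ℝ} (hp : p.HolderConjugate p')
    (hq : q.HolderConjugate q') : ∃ C : ℝ≥0, ∀ l : StrongDual ℂ (ModSpace Ω φ p q β),
      Ω.seqNorm p' q' (-β) (fun z => l (ModSpace.ofSchwartz h (Ω.atom φ z))) ≤ C * ‖l‖ₑ := by
  classical
  obtain ⟨C, hC⟩ := (Ω.rapid_gram φ hα hc).exists_seqNorm_le hα β
  refine ⟨C, fun l => ?_⟩
  set a : ℕ × (Fin d → ℤ) → ℂ := fun z => l (ModSpace.ofSchwartz h (Ω.atom φ z)) with ha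
  refine mixNorm_le_of_forall_dual hp.symm hq.symm (Ω.freqWeight_ne_zero _)
    (Ω.freqWeight_ne_top _) _ _ fun s t b hb hb1 => ?_
  simp only [← Ω.freqWeight_neg, neg_neg] at hb1
  -- The test sequence gets the conjugate phase of `a`, so that `l` evaluates to `∑ |a| b`. Where `a
  -- w = 0`, the convention `0 / 0 = 0` gives `e w = 0`.
  set e : ℕ × (Fin d → ℤ) → ℂ := fun w => (b w.1 w.2 : ℂ) * (starRingEnd ℂ (a w) / ‖a w‖) with he
  have he0 : ∀ w ∉ s ×ˢ t, e w = 0 := fun w hw => by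
    rw [Finset.mem_product, not_and_or] at hw
    simp [he, hb w.1 w.2 hw]
  have hen : ∀ w, ‖e w‖ₑ ≤ b w.1 w.2 := fun w => by
    rw [← ofReal_norm, ← ENNReal.ofReal_coe_nnreal]
    apply ENNReal.ofReal_le_ofReal
    simp only [he, norm_mul, norm_div, RCLike.norm_conj, Complex.norm_real, norm_norm]
    refine (mul_le_of_le_one_right (norm_nonneg _) (div_self_le_one _)).trans_eq ?_
    simp
  have hes : Ω.seqNorm p q β e ≤ 1 :=
    (mixNorm_mono hp.nonneg hq.nonneg _ fun k i => hen (k, i)).trans hb1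
  set u : 𝓢(Rd d, ℂ) := ∑ w ∈ s ×ˢ t, e w • Ω.atom φ w with hu
  have hcu : ∀ z, (ModSpace.ofSchwartz h u).coeffs z =
      ∑' w, (∫ x, inner ℂ (Ω.atom φ z x) (Ω.atom φ w x)) * e w := by
    intro z
    rw [ModSpace.coeffs_ofSchwartz, hu, PhaseLattice.atomCoeff_sum, tsum_eq_sum (s := s ×ˢ t)
      fun w hw => by rw [he0 w hw, mul_zero]]
    exact Finset.sum_congr rfl fun w _ => mul_comm _ _
  have hnu : ‖ModSpace.ofSchwartz h u‖ₑ ≤ C := by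
    rw [ModSpace.enorm_eq, funext hcu]
    refine (hC hp hq e (ne_top_of_le_ne_top ENNReal.one_ne_top hes)).2.trans ?_
    exact mul_le_of_le_one_right bot_le hes
  have hlu : l (ModSpace.ofSchwartz h u) = ((∑ w ∈ s ×ˢ t, ‖a w‖ * b w.1 w.2 : ℝ) : ℂ) := by
    rw [hu, map_sum, map_sum]
    push_cast
    refine Finset.sum_congr rfl fun w _ => ?_
    rw [map_smul, map_smul, smul_eq_mul]
    change e w * a w = _
    rw [he]
    by_cases h0 : a w = 0
    · simp [h0]
    · have h1 : (‖a w‖ : ℂ) ≠ 0 := by simpa using h0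
      have h2 := RCLike.conj_mul (a w)
      field_simp
      linear_combination (b w.1 w.2 : ℂ) * h2
  calc _ = ∑ w ∈ s ×ˢ t, ‖a w‖ₑ * b w.1 w.2 := by
        rw [← ENNReal.tsum_prod (f := fun k i => ‖a (k, i)‖ₑ * (b k i : ℝ≥0∞)),
          tsum_eq_sum (s := s ×ˢ t) fun w hw => ?_]
        rw [Finset.mem_product, not_and_or] at hw
        simp [hb w.1 w.2 hw]
    _ = ‖l (ModSpace.ofSchwartz h u)‖ₑ := by
        rw [hlu, ← ofReal_norm, Complex.norm_real, Real.norm_of_nonneg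
          (Finset.sum_nonneg fun w _ => by positivity), ENNReal.ofReal_sum_of_nonneg
          fun w _ => by positivity]
        refine Finset.sum_congr rfl fun w _ => ?_
        rw [ENNReal.ofReal_mul (norm_nonneg _), ofReal_norm, ENNReal.ofReal_coe_nnreal]
    _ ≤ ‖l‖ₑ * ‖ModSpace.ofSchwartz h u‖ₑ := l.le_opENorm _
    _ ≤ _ := by
        rw [mul_comm]
        gcongr

/-- Schwartz functions are dense in the modulation spaces. -/
theorem ModSpace.denseRange_ofSchwartz (hα : 0 < α) {p' q' : ℝ} (hp : p.HolderConjugate p')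
    (hq : q.HolderConjugate q') {P : ℕ × (Fin d → ℤ) → ℕ × (Fin d → ℤ) → ℂ}
    {ψ : ℕ × (Fin d → ℤ) → 𝓢(Rd d, ℂ)} (hP : Ω.Rapid P)
    (hP' : ∀ z w, P w z = starRingEnd ℂ (P z w))
    (hPs : ∀ w, HasSum (fun z => P z w • Ω.atom φ z) (Ω.atom φ w))
    (hψ : ∀ z w, Ω.atomCoeff φ z (ψ w) = P z w) : DenseRange (ModSpace.ofSchwartz h) := by
  classical
  obtain ⟨C, hC⟩ := hP.exists_seqNorm_le hα β
  intro f
  rw [EMetric.mem_closure_iff]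
  intro ε hε
  -- The minimum with `1` keeps `δ` finite, `C + 1` avoids division by zero, and the factor `2`
  -- leaves room for the strict inequality.
  set δ : ℝ≥0∞ := min 1 ε / (2 * (C + 1)) with hδ
  have hm0 : min 1 ε ≠ 0 := (lt_min one_pos hε).ne'
  have hmt : min 1 ε ≠ ∞ := ne_top_of_le_ne_top ENNReal.one_ne_top (min_le_left _ _)
  have hK0 : (2 * (C + 1) : ℝ≥0∞) ≠ 0 := by positivity
  have hKt : (2 * (C + 1) : ℝ≥0∞) ≠ ∞ := by finiteness
  have hδ0 : δ ≠ 0 := ENNReal.div_ne_zero.mpr ⟨hm0, hKt⟩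
  have hδt : δ ≠ ∞ := ENNReal.div_ne_top hmt hK0
  obtain ⟨F, hF⟩ := exists_mixNorm_tail_le hp.pos hq.pos (Ω.freqWeight_ne_zero β)
    (Ω.freqWeight_ne_top β) (fun k i => ‖f.coeffs (k, i)‖ₑ) f.seqNorm_ne_top hδ0
  -- The approximant is a truncated expansion in the dual packets. As `P` reproduces the
  -- coefficients of `f`, the error has `P` applied to the tail as its coefficients.
  set u : 𝓢(Rd d, ℂ) := ∑ z ∈ F, f.coeffs z • ψ z with hu
  refine ⟨_, ⟨u, rfl⟩, ?_⟩
  set r : ℕ × (Fin d → ℤ) → ℂ := fun z => if z ∈ F then 0 else f.coeffs z with hr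
  have hrn : Ω.seqNorm p q β r ≤ δ := by
    refine le_trans (le_of_eq ?_) hF
    rw [PhaseLattice.seqNorm]
    congr 1
    funext k i
    by_cases hz : (k, i) ∈ F <;> simp [hr, hz]
  have hrep : ∀ w, HasSum (fun z => P w z * f.coeffs z) (f.coeffs w) := by
    intro w
    have := hasSum_apply_conjSchwartz Ω φ (ModSpace.toDistribution Ω φ p q β f) (hPs w)
    refine this.congr_fun fun z => ?_
    rw [← hP' z w]
    rfl
  have hcoef : ∀ w, (f - ModSpace.ofSchwartz h u).coeffs w = ∑' z, P w z * r z := by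
    intro w
    have h1 : (f - ModSpace.ofSchwartz h u).coeffs w =
        f.coeffs w - (ModSpace.ofSchwartz h u).coeffs w := by
      rw [sub_eq_add_neg, ModSpace.coeffs_add, ← neg_one_smul ℂ, ModSpace.coeffs_smul]
      ring
    have h2 : (ModSpace.ofSchwartz h u).coeffs w = ∑ z ∈ F, P w z * f.coeffs z := by
      rw [ModSpace.coeffs_ofSchwartz, hu, PhaseLattice.atomCoeff_sum]
      exact Finset.sum_congr rfl fun z _ => by rw [hψ, mul_comm]
    have h3 : HasSum (fun z => if z ∈ F then P w z * f.coeffs z else 0)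
        (∑ z ∈ F, P w z * f.coeffs z) := by
      have := hasSum_sum_of_ne_finset_zero (L := .unconditional _)
        (f := fun z => if z ∈ F then P w z * f.coeffs z else 0) (s := F) fun z hz => if_neg hz
      rwa [Finset.sum_congr rfl fun z hz => if_pos hz] at this
    have h4 := (hrep w).sub h3
    rw [h1, h2]
    refine h4.tsum_eq.symm.trans ?_
    refine tsum_congr fun z => ?_
    by_cases hz : z ∈ F <;> simp [hr, hz]
  rw [edist_eq_enorm_sub, ModSpace.enorm_eq, funext hcoef]
  calc _ ≤ C * Ω.seqNorm p q β r := (hC hp hq r (ne_top_of_le_ne_top hδt hrn)).2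
    _ ≤ (C + 1) * δ := by gcongr; exact le_self_add
    _ = min 1 ε / 2 := by
        rw [hδ, ENNReal.div_eq_inv_mul, ENNReal.mul_inv (by simp) (by simp), ← mul_assoc,
          mul_comm (C + 1 : ℝ≥0∞), mul_assoc 2⁻¹, ENNReal.inv_mul_cancel (by simp) (by finiteness),
          mul_one, ENNReal.div_eq_inv_mul]
    _ < min 1 ε := ENNReal.half_lt_self hm0 hmt
    _ ≤ ε := min_le_right _ _

end modSpace

end Subdyadic

namespace Subdyadic

variable {d : ℕ} {α : ℝ} {Ω : PhaseLattice d α} {φ : 𝓢(Rd d, ℂ)}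

theorem summable_of_tsum_enorm_ne_top {ι : Type*} {f : ι → ℂ} (h : ∑' i, ‖f i‖ₑ ≠ ∞) :
    Summable f := by
  have := ENNReal.summable_toReal h
  simp only [toReal_enorm] at this
  exact this.of_norm

/-! ### The pairing and the representation of functionals. -/

section pairing

variable {p p' q q' β : ℝ} [Fact (1 ≤ p)] [Fact (1 ≤ p')] [Fact (1 ≤ q)] [Fact (1 ≤ q')]

/-- The sesquilinear pairing of modulation spaces given by a localized matrix. -/
theorem ModSpace.exists_pairing (hα : 0 < α) (hp : p.HolderConjugate p')
    (hq : q.HolderConjugate q') {H : ℕ × (Fin d → ℤ) → ℕ × (Fin d → ℤ) → ℂ} (hH : Ω.Rapid H) :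
    ∃ T : ModSpace Ω φ p' q' (-β) →SL[starRingEnd ℂ] StrongDual ℂ (ModSpace Ω φ p q β),
      ∀ g f, T g f = ∑' z, f.coeffs z * starRingEnd ℂ (∑' w, H z w * g.coeffs w) := by
  obtain ⟨C, hC⟩ := hH.exists_seqNorm_le hα (-β)
  have hb := fun g : ModSpace Ω φ p' q' (-β) => hC hp.symm hq.symm g.coeffs g.seqNorm_ne_top
  have hsum : ∀ (g : ModSpace Ω φ p' q' (-β)) (f : ModSpace Ω φ p q β),
      ∑' z, ‖f.coeffs z * starRingEnd ℂ (∑' w, H z w * g.coeffs w)‖ₑ ≤ C * ‖g‖ₑ * ‖f‖ₑ := by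
    intro g f
    simp only [enorm_mul, RCLike.enorm_conj]
    refine (Ω.tsum_enorm_mul_le_seqNorm hp hq β _ _).trans ?_
    rw [ModSpace.enorm_eq f, ModSpace.enorm_eq g, mul_comm]
    gcongr
    exact (hb g).2
  have hs : ∀ (g : ModSpace Ω φ p' q' (-β)) (f : ModSpace Ω φ p q β),
      Summable fun z => f.coeffs z * starRingEnd ℂ (∑' w, H z w * g.coeffs w) := fun g f =>
    summable_of_tsum_enorm_ne_top (ne_top_of_le_ne_top (by finiteness) (hsum g f))
  refine ⟨LinearMap.mkContinuous₂ (LinearMap.mk₂'ₛₗ (starRingEnd ℂ) (RingHom.id ℂ)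
    (fun (g : ModSpace Ω φ p' q' (-β)) (f : ModSpace Ω φ p q β) =>
      ∑' z, f.coeffs z * starRingEnd ℂ (∑' w, H z w * g.coeffs w)) (fun g g' f => ?_)
    (fun a g f => ?_) (fun g f f' => ?_) (fun a g f => ?_)) C (fun g f => ?_), fun g f => rfl⟩
  · rw [← (hs g f).tsum_add (hs g' f)]
    refine tsum_congr fun z => ?_
    rw [← mul_add, ← map_add, ← ((hb g).1 z).of_norm.tsum_add ((hb g').1 z).of_norm]
    simp only [ModSpace.coeffs_add, mul_add]
  · rw [smul_eq_mul, ← tsum_mul_left]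
    refine tsum_congr fun z => ?_
    simp only [ModSpace.coeffs_smul, mul_left_comm _ a, tsum_mul_left, map_mul]
    exact mul_left_comm _ _ _
  · rw [← (hs g f).tsum_add (hs g f')]
    simp only [ModSpace.coeffs_add, add_mul]
  · rw [smul_eq_mul, RingHom.id_apply, ← tsum_mul_left]
    simp only [ModSpace.coeffs_smul, mul_assoc]
  · have h1 := (enorm_tsum_le_tsum_enorm).trans (hsum g f)
    have h2 := ENNReal.toReal_mono (by finiteness) h1
    simpa [ENNReal.toReal_mul] using h2

variable (h : ∀ u : 𝓢(Rd d, ℂ),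
  toTemperedDistributionCLM (Rd d) ℂ volume u ∈ modSubmodule Ω φ p q β)

/-- On Schwartz functions the pairing is the distributional one. -/
theorem ModSpace.pairing_ofSchwartz (hα : 0 < α) (hp : p.HolderConjugate p')
    (hq : q.HolderConjugate q') {H : ℕ × (Fin d → ℤ) → ℕ × (Fin d → ℤ) → ℂ} (hH : Ω.Rapid H)
    (hH' : ∀ z w, H w z = starRingEnd ℂ (H z w))
    (hu : ∀ u, HasSum (fun z => (∑' w, H z w * Ω.atomCoeff φ w u) • Ω.atom φ z) u)
    (g : ModSpace Ω φ p' q' (-β)) (u : 𝓢(Rd d, ℂ)) :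
    ∑' z, (ModSpace.ofSchwartz h u).coeffs z * starRingEnd ℂ (∑' w, H z w * g.coeffs w) =
      starRingEnd ℂ (ModSpace.toDistribution Ω φ p' q' (-β) g (conjSchwartz u)) := by
  obtain ⟨C, hC⟩ := hH.exists_mixNorm_le hα (-β)
  have h1 := hasSum_apply_conjSchwartz Ω φ (ModSpace.toDistribution Ω φ p' q' (-β) g) (hu u)
  -- Absolute convergence, needed to exchange the sums, follows from Hölder's inequality, because
  -- `|H|` also acts boundedly on the dual sequence space.
  have hF : Summable (Function.uncurry fun w z =>
      H z w * Ω.atomCoeff φ w u * starRingEnd ℂ (g.coeffs z)) := by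
    refine summable_of_tsum_enorm_ne_top ?_
    rw [ENNReal.tsum_prod']
    have h2 : ∑' w, ∑' z, ‖H z w * Ω.atomCoeff φ w u * starRingEnd ℂ (g.coeffs z)‖ₑ =
        ∑' w, ‖(ModSpace.ofSchwartz h u).coeffs w‖ₑ * ∑' z, ‖H w z * g.coeffs z‖ₑ := by
      refine tsum_congr fun w => ?_
      rw [← ENNReal.tsum_mul_left]
      refine tsum_congr fun z => ?_
      rw [ModSpace.coeffs_ofSchwartz, hH' z w]
      simp only [enorm_mul, RCLike.enorm_conj]
      ring
    simp only [Function.uncurry]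
    rw [h2, ENNReal.tsum_prod']
    have h3 := tsum_mul_le_mixNorm hp hq (w := Ω.freqWeight β) (Ω.freqWeight_ne_zero β)
      (Ω.freqWeight_ne_top β) (fun k i => ‖(ModSpace.ofSchwartz h u).coeffs (k, i)‖ₑ)
      (fun k i => ∑' z, ‖H (k, i) z * g.coeffs z‖ₑ)
    simp only [← Ω.freqWeight_neg] at h3
    refine ne_top_of_le_ne_top (ENNReal.mul_ne_top
      (ModSpace.ofSchwartz h u).seqNorm_ne_top (ne_top_of_le_ne_top (ENNReal.mul_ne_top
      ENNReal.coe_ne_top g.seqNorm_ne_top) (hC hp.symm hq.symm g.coeffs))) h3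
  rw [← h1.tsum_eq, Complex.conj_tsum]
  calc _ = ∑' w, ∑' z, H z w * Ω.atomCoeff φ w u * starRingEnd ℂ (g.coeffs z) := by
        refine tsum_congr fun w => ?_
        rw [ModSpace.coeffs_ofSchwartz, Complex.conj_tsum, ← tsum_mul_left]
        refine tsum_congr fun z => ?_
        rw [map_mul, ← hH' w z]
        ring
    _ = ∑' z, ∑' w, H z w * Ω.atomCoeff φ w u * starRingEnd ℂ (g.coeffs z) := hF.tsum_comm.symm
    _ = _ := by
        refine tsum_congr fun z => ?_
        rw [tsum_mul_right, map_mul, RCLike.conj_conj]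
        rfl

/-- A bounded functional is given by a tempered distribution on Schwartz functions. -/
theorem ModSpace.exists_representing_distribution (hα : 0 < α) {c : ℝ}
    (hc : ∀ ζ, 𝓕 φ ζ ≠ 0 → ‖ζ‖ ≤ c) (hp : p.HolderConjugate p') (hq : q.HolderConjugate q')
    (l : StrongDual ℂ (ModSpace Ω φ p q β)) : ∃ g : ModSpace Ω φ p' q' (-β), ∀ u,
      ModSpace.toDistribution Ω φ p' q' (-β) g (conjSchwartz u) =
        starRingEnd ℂ (l (ModSpace.ofSchwartz h u)) := by
  obtain ⟨s, hs, hsb⟩ := exists_modENorm_schwartz_le (Ω := Ω) (φ := φ) hα hc hp hq β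
  obtain ⟨C, hC⟩ := ModSpace.exists_seqNorm_functional_le h hα hc hp hq
  let L : 𝓢(Rd d, ℂ) →ₗ[ℂ] ℂ := l.toLinearMap ∘ₗ ModSpace.ofSchwartz h
  have hL : Continuous L := by
    have hb : ∀ u, ‖L u‖ ≤ ‖l‖ * s u := fun u => by
      refine (l.le_opNorm _).trans ?_
      gcongr
      have := hsb u
      rw [ModSpace.norm_def]
      exact ENNReal.toReal_le_of_le_ofReal (apply_nonneg _ _) this
    have h2 : Continuous ((normSeminorm ℂ ℂ).comp L) :=
      Seminorm.continuous_of_le (q := ‖l‖₊ • s) (hs.const_smul _) hb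
    refine continuous_of_continuousAt_zero L ?_
    rw [ContinuousAt, map_zero, tendsto_zero_iff_norm_tendsto_zero]
    have := h2.tendsto 0
    rwa [map_zero] at this
  -- Conjugating both the argument and the value makes the functional linear again.
  let G : 𝓢(Rd d, ℂ) →L[ℂ] ℂ :=
    { toFun := fun u => starRingEnd ℂ (L (conjSchwartz u))
      map_add' := fun u v => by simp only [conjSchwartz_add, map_add]
      map_smul' := fun a u => by
        simp only [conjSchwartz_smul, map_smul, smul_eq_mul, map_mul, RCLike.conj_conj,
          RingHom.id_apply]
      cont := Complex.continuous_conj.comp (hL.comp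
        (postcompCLM (𝕜 := ℝ) (Complex.conjCLE : ℂ →L[ℝ] ℂ)).continuous) }
  let g : 𝓢'(Rd d, ℂ) := ContinuousLinearMap.toPointwiseConvergenceCLM ℂ (RingHom.id ℂ) _ _ G
  have hg : ∀ u, g (conjSchwartz u) = starRingEnd ℂ (L u) := fun u => by
    change starRingEnd ℂ (L (conjSchwartz (conjSchwartz u))) = _
    rw [conjSchwartz_conjSchwartz]
  have hmem : g ∈ modSubmodule Ω φ p' q' (-β) := by
    change modENorm Ω φ p' q' (-β) g < ∞
    rw [modENorm_eq_seqNorm Ω φ (-β) hq.symm.pos]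
    -- The coefficients of `g` are the conjugates of the values of `l` at the packets.
    refine lt_of_le_of_lt (le_of_eq ?_) ((hC l).trans_lt (by finiteness))
    unfold PhaseLattice.seqNorm
    congr 1
    funext k i
    rw [distCoeff_eq, hg, RCLike.enorm_conj]
    rfl
  exact ⟨⟨g, hmem⟩, hg⟩

end pairing

end Subdyadic

/-! ### The duality theorem. -/

open Subdyadic
theorem proposition4p10 {d : ℕ} {α : ℝ} (hα : 0 < α)
    (Ω : PhaseLattice d α) (φ : 𝓢(Rd d, ℂ))
    (hφ : IsAdmissibleWindow Ω φ)
    (p p' q q' β : ℝ) [Fact (1 ≤ p)] [Fact (1 ≤ p')] [Fact (1 ≤ q)] [Fact (1 ≤ q')]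
    (hp : p.HolderConjugate p') (hq : q.HolderConjugate q') :
    -- Schwartz functions belong to both spaces
    (∀ u : 𝓢(Rd d, ℂ),
      toTemperedDistributionCLM (Rd d) ℂ volume u ∈ modSubmodule Ω φ p q β ∧
      toTemperedDistributionCLM (Rd d) ℂ volume u ∈
        modSubmodule Ω φ p' q' (-β)) ∧
    -- the `L²` pairing on them extends, in a unique way, to an identification of the dual
    ∃! T : ModSpace Ω φ p' q' (-β) ≃SL[starRingEnd ℂ]
        StrongDual ℂ (ModSpace Ω φ p q β),
      ∀ (f : ModSpace Ω φ p q β) (g : ModSpace Ω φ p' q' (-β))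
        (u v : 𝓢(Rd d, ℂ)),
        ModSpace.toDistribution Ω φ p q β f =
          toTemperedDistributionCLM (Rd d) ℂ volume u →
        ModSpace.toDistribution Ω φ p' q' (-β) g =
          toTemperedDistributionCLM (Rd d) ℂ volume v →
        T g f = ∫ x, u x * starRingEnd ℂ (v x) := by
  obtain ⟨⟨c₁, c, -, -, hsupp⟩, hframe⟩ := hφ
  have hc : ∀ ζ, 𝓕 φ ζ ≠ 0 → ‖ζ‖ ≤ c := fun ζ hζ => (hsupp hζ).2
  have h₁ : ∀ u : 𝓢(Rd d, ℂ),
      toTemperedDistributionCLM (Rd d) ℂ volume u ∈ modSubmodule Ω φ p q β := fun u => by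
    obtain ⟨s, -, hs⟩ := exists_modENorm_schwartz_le (Ω := Ω) (φ := φ) hα hc hp hq β
    exact (hs u).trans_lt ENNReal.ofReal_lt_top
  have h₂ : ∀ u : 𝓢(Rd d, ℂ),
      toTemperedDistributionCLM (Rd d) ℂ volume u ∈ modSubmodule Ω φ p' q' (-β) := fun u => by
    obtain ⟨s, -, hs⟩ := exists_modENorm_schwartz_le (Ω := Ω) (φ := φ) hα hc hp.symm hq.symm (-β)
    exact (hs u).trans_lt ENNReal.ofReal_lt_top
  refine ⟨fun u => ⟨h₁ u, h₂ u⟩, ?_⟩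
  obtain ⟨H, P, ψ, hH, hP, hH', hP', hu, hPs, hψ⟩ := Ω.exists_schwartz_dual φ hα hc hframe
  have dense₁ : DenseRange (ModSpace.ofSchwartz h₁) :=
    ModSpace.denseRange_ofSchwartz h₁ hα hp hq hP hP' hPs hψ
  have dense₂ : DenseRange (ModSpace.ofSchwartz h₂) :=
    ModSpace.denseRange_ofSchwartz h₂ hα hp.symm hq.symm hP hP' hPs hψ
  obtain ⟨T, hT⟩ := ModSpace.exists_pairing (φ := φ) (β := β) hα hp hq hH
  -- This formula no longer involves `H`; it shows that `T g` determines `g` as a distribution, and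
  -- that its values at the packets are the conjugate coefficients of `g`.
  have star : ∀ g u, T g (ModSpace.ofSchwartz h₁ u) =
      starRingEnd ℂ (ModSpace.toDistribution Ω φ p' q' (-β) g (conjSchwartz u)) := fun g u => by
    rw [hT]
    exact ModSpace.pairing_ofSchwartz h₁ hα hp hq hH hH' hu g u
  have inj : Function.Injective T := by
    intro g g' hgg
    refine Subtype.ext (DFunLike.ext _ _ fun u => ?_)
    have := congrArg (fun l : StrongDual ℂ (ModSpace Ω φ p q β) =>
      l (ModSpace.ofSchwartz h₁ (conjSchwartz u))) hgg
    simp only [star, conjSchwartz_conjSchwartz] at this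
    exact (starRingEnd ℂ).injective this
  have surj : Function.Surjective T := by
    intro l
    obtain ⟨g, hg⟩ := ModSpace.exists_representing_distribution h₁ hα hc hp hq l
    refine ⟨g, DFunLike.coe_injective (dense₁.equalizer (T g).cont l.cont (funext fun u => ?_))⟩
    simp only [Function.comp_apply, star, hg, RCLike.conj_conj]
  obtain ⟨C, hC⟩ := ModSpace.exists_seqNorm_functional_le h₁ hα hc hp hq
  -- The coefficients of `g` have the same absolute values as `T g` at the packets, so the bound for
  -- functionals applies.
  have lower : ∀ g, ‖g‖ ≤ C * ‖T g‖ := by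
    intro g
    have h3 : ‖g‖ₑ ≤ C * ‖T g‖ₑ := by
      rw [ModSpace.enorm_eq]
      refine le_trans (le_of_eq ?_) (hC (T g))
      unfold PhaseLattice.seqNorm
      congr 1
      funext k i
      simp only [star, RCLike.enorm_conj]
      rfl
    have h4 := ENNReal.toReal_mono (by finiteness) h3
    simpa [ENNReal.toReal_mul] using h4
  have pair : ∀ g u v, ModSpace.toDistribution Ω φ p' q' (-β) g =
      toTemperedDistributionCLM (Rd d) ℂ volume v →
      T g (ModSpace.ofSchwartz h₁ u) = ∫ x, u x * starRingEnd ℂ (v x) := by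
    intro g u v hg
    rw [star, hg]
    refine (congrArg (starRingEnd ℂ) (toTemperedDistributionCLM_apply_apply volume v _)).trans ?_
    rw [← integral_conj]
    refine integral_congr_ae (Filter.Eventually.of_forall fun x => ?_)
    simp only [conjSchwartz_apply, smul_eq_mul, map_mul, RCLike.conj_conj]
  let E : ModSpace Ω φ p' q' (-β) ≃ₛₗ[starRingEnd ℂ] StrongDual ℂ (ModSpace Ω φ p q β) :=
    LinearEquiv.ofBijective T.toLinearMap ⟨inj, surj⟩
  refine ⟨E.toContinuousLinearEquivOfBounds ‖T‖ C (fun g => T.le_opNorm g) fun l => ?_, ?_, ?_⟩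
  · have := lower (E.symm l)
    have e : T (E.symm l) = l := E.apply_symm_apply l
    rwa [e] at this
  · intro f g u v hf hg
    have hf' : f = ModSpace.ofSchwartz h₁ u := Subtype.ext hf
    rw [hf']
    exact pair g u v hg
  -- The pairing prescribes `S` for Schwartz functions in both arguments. Density in the second
  -- space and then in the first extends the equality.
  · intro S hS
    refine ContinuousLinearEquiv.ext (dense₂.equalizer S.continuous
      (ContinuousLinearEquiv.continuous _) (funext fun v => ?_))
    refine DFunLike.coe_injective (dense₁.equalizer (S _).cont (ContinuousLinearMap.cont _)
      (funext fun u => ?_))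
    exact (hS _ _ u v rfl rfl).trans (pair _ u v rfl).symm
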